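/- **Setting.** A hypergraph $H=(V,\mathcal E)$ is a finite indexed family of non-empty hyperedges (equal sets at different indices count as distinct hyperedges); its incidence graph is assumed connected. Let $m=|\mathcal E|$ and $N=\sum_{E\in\mathcal E}|E|$. A join tree of $H$ is a tree whose nodes are the hyperedges such that for every vertex the hyperedges containing it induce a subtree. $H$ is acyclic if it has a join tree. The union join graph $G$ has the hyperedges as vertices; two of them are adjacent iff they are adjacent in some join tree. $|G|$ is the number of edges of $G$. The separator of an edge $EE'$ of a join tree is $E\cap E'$. The subset graph of a family of sets has an arc $(S,S')$ iff $S\subseteq S'$ (for distinct members). **Algorithm 1** (input: $H$ and a join tree $T$). Choose a root and a pre-order $E_1,\dots,E_m$ of $T$; let $\lambda(v)=\min\{i: v\in E_i\}$. For $i=2,\dots,m$ put $S^\uparrow(E_i)=\{v\in E_i:\lambda(v)<i\}$ and make $E_j$, $j=\max\{\lambda(v): v\in S^\uparrow(E_i)\}$, the parent of $E_i$. Return the new tree and the family of all $S^\uparrow(E_i)$, $i\ge 2$. **Algorithm 2** (input: acyclic $H$ and an algorithm $\mathcal A$ that computes the subset graph of any family of non-empty sets). Find a join tree of $H$, apply Algorithm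 1, and let $T$ and $\mathcal S$ be the resulting tree and family of separators. Use $\mathcal A$ once, to compute the subset graph of $\mathcal S$. Start with $E_G=\emptyset$. For each $S\in\mathcal S$: for each $S'\in\mathcal S$ with $S\subseteq S'$ (including $S$ itself) put into $\mathbb E$ the endpoint, farther from $S$ in $T$, of the edge of $T$ that $S'$ represents (both endpoints if $S'$ and $S$ represent the same edge); split $\mathbb E$ into $\mathbb E_1,\mathbb E_2$ by the side of the edge of $S$ in $T$; add all pairs in $\mathbb E_1\times\mathbb E_2$ to $E_G$. **Theorem.** There are a program $P$ for the unit-cost random access machine (registers and arrays; constants, copying, addition, subtraction, indirect load and store, comparisons, and calls of a subroutine $\mathcal A$ at the cost of $\mathcal A$'s own running time) and a constant $C$ such that for every acyclic hypergraph $H$ the following hold. 1. For every join tree $T$ of $H$ and distinct hyperedges $E_i,E_j$: $E_iE_j$ is an edge of $G$ iff some separator $S$ on the path from $E_i$ to $E_j$ in $T$ satisfies $S\subseteq S_i$ and $S\subseteq S_j$, where $S_i,S_j$ are the separators on this path closest to $E_i$ and $E_j$. 2. In every run of Algorithm 2 (whatever join tree, root and pre-order are chosen) the tree returned by Algorithm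 1 is a join tree of $H$ and $S^\uparrow(E)$ is the intersection of $E$ with its parent for every non-root $E$; the graph $(\mathcal E,E_G)$ is $G$; and each edge is added at most twice. 3. For every correct $\mathcal A$ and every listing of the edges of the incidence graph of $H$ as input, $P$ carries out a run of Algorithm 2, calling $\mathcal A$ exactly once, on a listing of the incidences of the family of all separators, and outputs the modified tree, the edges in $\mathbb E_1\times\mathbb E_2$ added over all $S$ (with multiplicity), and a list containing each edge of $G$ exactly once. It halts after at most $C\,(T_{\mathcal A}(H)+N+|G|)$ steps, where $T_{\mathcal A}(H)$ is the number of steps of $\mathcal A$ in that call, that is, on the separator hypergraph of $H$. -/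

import Mathlib

namespace UnionJoin

open Finset

/-! ## Hypergraphs, join trees, union join graphs -/

/-- A finite hypergraph with vertices `Fin n` and `m` hyperedges.  Hyperedges are non-empty and form an
indexed family: two different indices are two distinct hyperedges, even if their vertex sets agree. -/
structure HGraph (n m : ℕ) where
  edge : Fin m → Finset (Fin n)
  edge_nonempty : ∀ i, (edge i).Nonempty

namespace HGraph

variable {n m : ℕ} (H : HGraph n m)

/-- The incidence graph: a vertex `v` and a hyperedge `i` are adjacent iff `v` lies in `i`. -/
def incidenceGraph : SimpleGraph (Fin n ⊕ Fin m) :=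
  SimpleGraph.fromRel fun a b => ∃ v i, a = Sum.inl v ∧ b = Sum.inr i ∧ v ∈ H.edge i

/-- The total size `N` of all hyperedges. -/
def size : ℕ := ∑ i, (H.edge i).card

/-- The nodes of the tree `T` are the hyperedges, and for each vertex the hyperedges that contain it
induce a subtree of `T` (a connected subgraph). -/
def IsJoinTree (T : SimpleGraph (Fin m)) : Prop :=
  T.IsTree ∧ ∀ v : Fin n, (T.induce {i | v ∈ H.edge i}).Preconnected

def IsAcyclic : Prop := ∃ T, H.IsJoinTree T

/-- Two hyperedges are adjacent in the union join graph iff they are adjacent in some join tree. -/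
def unionJoinGraph : SimpleGraph (Fin m) where
  Adj i j := ∃ T, H.IsJoinTree T ∧ T.Adj i j
  symm := ⟨fun _ _ ⟨T, hT, h⟩ => ⟨T, hT, h.symm⟩⟩
  loopless := ⟨fun _ ⟨_, _, h⟩ => h.ne rfl⟩

/-- The intersection of two hyperedges; for hyperedges that are adjacent in a join tree this is the
separator which that tree edge represents. -/
def sep (i j : Fin m) : Finset (Fin n) := H.edge i ∩ H.edge j

end HGraph

/-! ## The modification of a join tree -/

/-- `x` is an ancestor of `y` (possibly `y` itself) in the tree `T` rooted in `r`. -/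
def IsAncestor {m : ℕ} (T : SimpleGraph (Fin m)) (r x y : Fin m) : Prop :=
  ∃ p : T.Walk r y, p.IsPath ∧ x ∈ p.support

/-- `pos` numbers the nodes of the tree `T` rooted in `r` in a pre-order: every node comes before its
descendants, and the descendants of a node (with the node itself) are numbered consecutively. -/
def IsPreorder {m : ℕ} (T : SimpleGraph (Fin m)) (r : Fin m) (pos : Equiv.Perm (Fin m)) : Prop :=
  (∀ x y, IsAncestor T r x y → pos x ≤ pos y) ∧
    ∀ x y z, pos x ≤ pos y → pos y ≤ pos z → IsAncestor T r x z → IsAncestor T r x y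

namespace HGraph

variable {n m : ℕ} (H : HGraph n m)

/-- `λ(v)`: the least position of a hyperedge that contains `v`. -/
noncomputable def firstPos (pos : Equiv.Perm (Fin m)) (v : Fin n) : ℕ :=
  sInf {k | ∃ i, v ∈ H.edge i ∧ k = (pos i : ℕ)}

/-- The up-separator `{v ∈ E_x | λ(v) < position of x}`. -/
noncomputable def upSep (pos : Equiv.Perm (Fin m)) (x : Fin m) : Finset (Fin n) :=
  (H.edge x).filter fun v => H.firstPos pos v < (pos x : ℕ)

end HGraph

/-- A run of the algorithm that makes every hyperedge adjacent to its highest possible ancestor: it is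
given a join tree `T`, picks a root and a pre-order, and makes the hyperedge at position
`max {λ(v) | v ∈ upSep x}` the parent of each `x ≠ root`. -/
structure TreeRun {n m : ℕ} (H : HGraph n m) where
  T : SimpleGraph (Fin m)
  isJoinTree : H.IsJoinTree T
  root : Fin m
  pos : Equiv.Perm (Fin m)
  isPreorder : IsPreorder T root pos
  parent : Fin m → Fin m
  pos_parent : ∀ x, x ≠ root → (pos (parent x) : ℕ) = (H.upSep pos x).sup (H.firstPos pos)

/-! ## The union join graph algorithm, at the level of its pseudo-code -/

namespace TreeRun

variable {n m : ℕ} {H : HGraph n m} (R : TreeRun H)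

/-- The modified tree. -/
def tree : SimpleGraph (Fin m) :=
  SimpleGraph.fromRel fun x y => x ≠ R.root ∧ y = R.parent x

/-- The separators are indexed by the hyperedges `c ≠ root`; the separator of `c` represents the edge
between `c` and `parent c` of the modified tree. -/
noncomputable def up (c : Fin m) : Finset (Fin n) := H.upSep R.pos c

/-- Distance, in the modified tree, of the hyperedge `x` from the tree edge of the separator of `c`. -/
noncomputable def distTo (c x : Fin m) : ℕ :=
  min (R.tree.dist x c) (R.tree.dist x (R.parent c))

open Classical in
/-- The set `𝔼` collected for the separator of `c`: for each separator (of `c'`) that contains it, the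
endpoint of its tree edge that is farther away, and for the separator of `c` itself both endpoints. -/
noncomputable def collected (c : Fin m) : Finset (Fin m) :=
  Finset.univ.filter fun x => ∃ c', c' ≠ R.root ∧ R.up c ⊆ R.up c' ∧
    ((c' = c ∧ (x = c ∨ x = R.parent c)) ∨
      (c' ≠ c ∧ x = c' ∧ R.distTo c (R.parent c') < R.distTo c c') ∨
      (c' ≠ c ∧ x = R.parent c' ∧ R.distTo c c' < R.distTo c (R.parent c')))

open Classical in
/-- The members of `𝔼` that lie on the side of `z` after the tree edge of the separator of `c` is
removed; used for the two endpoints `z` of this tree edge. -/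
noncomputable def sideOf (c z : Fin m) : Finset (Fin m) :=
  (R.collected c).filter fun x => (R.tree.deleteEdges {s(c, R.parent c)}).Reachable x z

/-- All edges that the main loop adds to the graph, with multiplicity: one for each separator and each
pair in `𝔼₁ × 𝔼₂`. -/
noncomputable def added : Multiset (Sym2 (Fin m)) :=
  ∑ c ∈ Finset.univ.erase R.root,
    (R.sideOf c c ×ˢ R.sideOf c (R.parent c)).val.map fun q => s(q.1, q.2)

/-- The computed graph `G = (ℰ, E_G)`. -/
noncomputable def graph : SimpleGraph (Fin m) :=
  SimpleGraph.fromEdgeSet {e | e ∈ R.added}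

end TreeRun

/-! ## Representations as lists of pairs -/

/-- Forget the bounds in a list of pairs. -/
def natPairs {a b : ℕ} (L : List (Fin a × Fin b)) : List (ℕ × ℕ) :=
  L.map fun q => ((q.1 : ℕ), (q.2 : ℕ))

/-- `L` lists, in any order and without repetition, the edges of the incidence graph of the family `F`. -/
def ListsIncidences {n k : ℕ} (F : Fin k → Finset (Fin n)) (L : List (Fin n × Fin k)) : Prop :=
  L.Nodup ∧ ∀ v s, (v, s) ∈ L ↔ v ∈ F s

/-- `D` lists, in any order and without repetition, the edges `(s, s')`, `F s ⊆ F s'`, of the subset graph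
of `F`.  Loops may be listed or not. -/
def ListsSubsetGraph {n k : ℕ} (F : Fin k → Finset (Fin n)) (D : List (Fin k × Fin k)) : Prop :=
  D.Nodup ∧ ∀ s s', s ≠ s' → ((s, s') ∈ D ↔ F s ⊆ F s')

/-- `D` lists every edge of the undirected graph `G` exactly once, and nothing else. -/
def ListsEdges {m : ℕ} (G : SimpleGraph (Fin m)) (D : List (Fin m × Fin m)) : Prop :=
  (D.map fun q => s(q.1, q.2)).Nodup ∧ ∀ e, e ∈ (D.map fun q => s(q.1, q.2)) ↔ e ∈ G.edgeSet

/-- The input of a subset graph algorithm: a family of `sets` sets over the vertices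
`0, …, verts - 1`, given by the edges of its incidence graph. -/
structure Query where
  verts : ℕ
  sets : ℕ
  inc : List (ℕ × ℕ)

/-- An algorithm for the subset graph problem, used as a subroutine: its output and its number of steps
on each input. -/
structure SubsetAlg where
  answer : Query → List (ℕ × ℕ)
  time : Query → ℕ

/-- The algorithm computes the subset graph of every family of non-empty sets. -/
def SubsetAlg.IsCorrect (A : SubsetAlg) : Prop :=
  ∀ (n k : ℕ) (F : Fin k → Finset (Fin n)), (∀ s, (F s).Nonempty) →
    ∀ L : List (Fin n × Fin k), ListsIncidences F L →
      ∃ D : List (Fin k × Fin k), ListsSubsetGraph F D ∧ A.answer ⟨n, k, natPairs L⟩ = natPairs D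

/-! ## Random access machines with unit cost -/

/-- Memory: registers and arrays, both numbered by `ℕ`.  The field `queries` records the calls to the
subroutine; no instruction reads it. -/
structure Mem where
  reg : ℕ → ℕ
  arr : ℕ → ℕ → ℕ
  queries : List Query

/-- The first `len` entries of two arrays as a list of pairs. -/
def Mem.pairs (s : Mem) (a b len : ℕ) : List (ℕ × ℕ) :=
  (List.range len).map fun k => (s.arr a k, s.arr b k)

/-- Elementary instructions. -/
inductive Instr where
  /-- `reg r := k` -/
  | const (r k : ℕ)
  /-- `reg r := reg x` -/
  | move (r x : ℕ)
  /-- `reg r := reg x + reg y` -/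
  | add (r x y : ℕ)
  /-- `reg r := reg x - reg y` (truncated) -/
  | sub (r x y : ℕ)
  /-- `reg r := arr a [reg x]` -/
  | load (r a x : ℕ)
  /-- `arr a [reg x] := reg r` -/
  | store (a x r : ℕ)

def Instr.run : Instr → Mem → Mem
  | const r k, s => { s with reg := Function.update s.reg r k }
  | move r x, s => { s with reg := Function.update s.reg r (s.reg x) }
  | add r x y, s => { s with reg := Function.update s.reg r (s.reg x + s.reg y) }
  | sub r x y, s => { s with reg := Function.update s.reg r (s.reg x - s.reg y) }
  | load r a x, s => { s with reg := Function.update s.reg r (s.arr a (s.reg x)) }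
  | store a x r, s =>
      { s with arr := Function.update s.arr a (Function.update (s.arr a) (s.reg x) (s.reg r)) }

/-- Comparisons of two registers. -/
inductive Test where
  | lt (x y : ℕ)
  | eq (x y : ℕ)

def Test.Holds : Test → Mem → Prop
  | lt x y, s => s.reg x < s.reg y
  | eq x y, s => s.reg x = s.reg y

/-- Programs.  `call v k l a b l' a' b'` passes the family of `reg k` sets over `reg v` vertices whose
incidences are the first `reg l` entries of the arrays `a`, `b` to the subroutine; the pairs of the answer
are placed in the arrays `a'`, `b'`, their number in the register `l'`. -/
inductive Prog where
  | skip
  | instr (i : Instr)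
  | seq (p q : Prog)
  | ite (b : Test) (p q : Prog)
  | loop (b : Test) (p : Prog)
  | call (v k l a b l' a' b' : ℕ)

/-- Write the list `D` of pairs to the arrays `a`, `b` and its length to the register `l`. -/
def Mem.putPairs (s : Mem) (D : List (ℕ × ℕ)) (l a b : ℕ) : Mem :=
  let arr₁ := Function.update s.arr a fun i => (D[i]?).elim (s.arr a i) Prod.fst
  { s with
    reg := Function.update s.reg l D.length
    arr := Function.update arr₁ b fun i => (D[i]?).elim (arr₁ b i) Prod.snd }

/-- The query made by a call. -/
def Mem.query (s : Mem) (v k l a b : ℕ) : Query :=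
  ⟨s.reg v, s.reg k, s.pairs a b (s.reg l)⟩

/-- `Exec A p s t s'`: with the subroutine `A`, the program `p` started in `s` halts in `s'` after exactly
`t` steps.  Each elementary instruction and each evaluation of a test is one step; a call takes the
steps of the subroutine and one more. -/
inductive Exec (A : SubsetAlg) : Prog → Mem → ℕ → Mem → Prop
  | skip (s) : Exec A .skip s 1 s
  | instr (i s) : Exec A (.instr i) s 1 (i.run s)
  | seq {p q s t₁ s₁ t₂ s₂} :
      Exec A p s t₁ s₁ → Exec A q s₁ t₂ s₂ → Exec A (.seq p q) s (t₁ + t₂) s₂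
  | iteTrue {b p q s t s'} : b.Holds s → Exec A p s t s' → Exec A (.ite b p q) s (t + 1) s'
  | iteFalse {b p q s t s'} : ¬ b.Holds s → Exec A q s t s' → Exec A (.ite b p q) s (t + 1) s'
  | loopDone {b p s} : ¬ b.Holds s → Exec A (.loop b p) s 1 s
  | loopStep {b p s t₁ s₁ t₂ s₂} : b.Holds s → Exec A p s t₁ s₁ → Exec A (.loop b p) s₁ t₂ s₂ →
      Exec A (.loop b p) s (t₁ + t₂ + 1) s₂
  | call (v k l a b l' a' b' s) :
      Exec A (.call v k l a b l' a' b') s (A.time (s.query v k l a b) + 1)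
        { s.putPairs (A.answer (s.query v k l a b)) l' a' b' with
          queries := s.queries ++ [s.query v k l a b] }

/-- A program has at most one result and one number of steps on each input. -/
theorem Exec.unique {A : SubsetAlg} {p : Prog} {s s₁ s₂ : Mem} {t₁ t₂ : ℕ}
    (h₁ : Exec A p s t₁ s₁) (h₂ : Exec A p s t₂ s₂) : t₁ = t₂ ∧ s₁ = s₂ := by
  induction h₁ generalizing t₂ s₂ with
  | skip s => cases h₂; exact ⟨rfl, rfl⟩
  | instr i s => cases h₂; exact ⟨rfl, rfl⟩
  | seq _ _ ih₁ ih₂ =>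
    cases h₂ with
    | seq a b =>
      obtain ⟨rfl, rfl⟩ := ih₁ a
      obtain ⟨rfl, rfl⟩ := ih₂ b
      exact ⟨rfl, rfl⟩
  | iteTrue hb _ ih =>
    cases h₂ with
    | iteTrue _ a => obtain ⟨rfl, rfl⟩ := ih a; exact ⟨rfl, rfl⟩
    | iteFalse hn _ => exact absurd hb hn
  | iteFalse hb _ ih =>
    cases h₂ with
    | iteTrue hn _ => exact absurd hn hb
    | iteFalse _ a => obtain ⟨rfl, rfl⟩ := ih a; exact ⟨rfl, rfl⟩
  | loopDone hb =>
    cases h₂ with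
    | loopDone _ => exact ⟨rfl, rfl⟩
    | loopStep hn _ _ => exact absurd hn hb
  | loopStep hb _ _ ih₁ ih₂ =>
    cases h₂ with
    | loopDone hn => exact absurd hb hn
    | loopStep _ a b =>
      obtain ⟨rfl, rfl⟩ := ih₁ a
      obtain ⟨rfl, rfl⟩ := ih₂ b
      exact ⟨rfl, rfl⟩
  | call => cases h₂; exact ⟨rfl, rfl⟩

/-- The initial memory for a hypergraph with `n` vertices and `m` hyperedges whose incidences are listed
by `L`: registers `0, 1, 2` hold `n`, `m` and the length of `L`, arrays `0, 1` hold `L`, and everything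
else is `0`. -/
def inputMem {n m : ℕ} (L : List (Fin n × Fin m)) : Mem :=
  Mem.putPairs
    { reg := fun r => if r = 0 then n else if r = 1 then m else 0
      arr := fun _ _ => 0
      queries := [] } (natPairs L) 2 0 1

/-- The program, using the subroutine `A`, carries out the run `R` of the union join graph algorithm from
the input list `L` to the final memory `s`, where its only query to `A` is `q`:
* `q` is a representation of the family of all separators of `R`, in some order;
* register `2` and array `4` hold the root and the parents of the modified tree;
* the pairs in the arrays `2, 3` (number in register `1`) are the edges added by the main loop;
* the pairs in the arrays `0, 1` (number in register `0`) list the edges of the computed graph. -/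
structure Implements {n m : ℕ} {H : HGraph n m} (R : TreeRun H) (s : Mem) (q : Query) : Prop where
  queries_eq : s.queries = [q]
  query_spec : ∃ (ix : Fin (m - 1) ≃ {c : Fin m // c ≠ R.root}) (Q : List (Fin n × Fin (m - 1))),
    ListsIncidences (fun k => R.up (ix k)) Q ∧ q = ⟨n, m - 1, natPairs Q⟩
  root_eq : s.reg 2 = (R.root : ℕ)
  parent_eq : ∀ x : Fin m, x ≠ R.root → s.arr 4 x = (R.parent x : ℕ)
  added_eq : ∃ D : List (Fin m × Fin m), s.pairs 2 3 (s.reg 1) = natPairs D ∧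
    (D.map fun p => s(p.1, p.2) : Multiset (Sym2 (Fin m))) = R.added
  graph_eq : ∃ D : List (Fin m × Fin m), s.pairs 0 1 (s.reg 0) = natPairs D ∧ ListsEdges R.graph D

end UnionJoin

/-! Everything rests on exchanging an edge of a join tree. If removing an edge `XY` puts `i` and `j`
on different sides, then E_i ∩ E_j lies in the separator of `XY`; if conversely the separator lies
in E_i ∩ E_j, then `XY` may be replaced by `ij` (`HGraph.IsJoinTree.exchange`). On the other hand,
if `ij` is an edge of some join tree, then every walk from `i` to `j` in another tree has to cross
between the two sides of that edge, and the crossing edge has its intersection inside E_i ∩ E_j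
(`exists_dart_of_unionJoinGraph_adj`). So `i` and `j` are adjacent in G iff some separator on their
tree path is contained in both, which gives the characterisation.

Algorithm 1 makes the parent of c the first of all hyperedges that contain the separator S of c.
This needs only a numbering with parents before children (`HGraph.isRun_of_linear_extension`). Hence
any hyperedge other than this parent that contains S has S inside its own up-separator, and its tree
edge points away from that of c. So 𝔼 consists of exactly the hyperedges that contain S, and the
pairs added for S are the pairs separated by its tree edge whose intersection is S. Separators that
add the same pair are equal as sets and therefore hang below the same parent; their subtrees are
disjoint and each contains exactly one end of the pair, so there are at most two of them
(`TreeRun.count_added_le_two`).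

The program never builds the initial join tree. A maximum cardinality order is compatible with some
join tree, again by exchange (`HGraph.IsMaxCard.exists_grownIn`), and Algorithm 1 needs only the
order. The resulting tree is also the outcome of a run with a genuine pre-order
(`HGraph.IsRun.exists_treeRun`). The search takes time O(N) with stacks indexed by weight and a
potential argument; sides of tree edges are decided by intervals of pre-order numbers; the subset
graph has at most m more arcs than there are additions, and there are at most 2|G| additions. -/

namespace UnionJoin

open Finset

/-! ### Rooted trees given by parent functions -/

section ParentTrees

variable {V : Type*}

/-- The graph in which every `x ≠ r` is joined to its parent `p x`. -/
def parentGraph (r : V) (p : V → V) : SimpleGraph V :=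
  SimpleGraph.fromRel fun x y => x ≠ r ∧ y = p x

/-- `Desc r p x y`: the node `y` is a descendant of `x` (or `x` itself) for the parent function `p`
with root `r`. -/
inductive Desc (r : V) (p : V → V) (x : V) : V → Prop
  | refl : Desc r p x x
  | step {y : V} : y ≠ r → Desc r p x (p y) → Desc r p x y

variable {r : V} {p : V → V} {rk : V → ℕ}

theorem Desc.trans {x y z : V} (h : Desc r p x y) (h' : Desc r p y z) : Desc r p x z := by
  induction h' with
  | refl => exact h
  | step hy _ ih => exact .step hy ih

theorem Desc.eq_or {x y : V} (h : Desc r p x y) : y = x ∨ (y ≠ r ∧ Desc r p x (p y)) := by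
  cases h with
  | refl => exact .inl rfl
  | step h h' => exact .inr ⟨h, h'⟩

theorem Desc.parent {x : V} (hx : x ≠ r) : Desc r p (p x) x := .step hx .refl

/-- Parents are unique, so the ancestors of `z` form a chain. -/
theorem Desc.total {x y z : V} (h : Desc r p x z) (h' : Desc r p y z) :
    Desc r p x y ∨ Desc r p y x := by
  induction h with
  | refl => exact .inr h'
  | step hy h ih =>
    rcases h'.eq_or with rfl | ⟨_, h'⟩
    · exact .inl (.step hy h)
    · exact ih h'

/-- Parents have a smaller rank than their children. -/
def RankDecreases (r : V) (p : V → V) (rk : V → ℕ) : Prop := ∀ x, x ≠ r → rk (p x) < rk x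

theorem Desc.eq_or_lt (hrk : RankDecreases r p rk) {x y : V} (h : Desc r p x y) :
    y = x ∨ rk x < rk y := by
  induction h with
  | refl => exact .inl rfl
  | step hy _ ih =>
    right
    have := hrk _ hy
    rcases ih with ih | ih
    · rwa [ih] at this
    · exact ih.trans this

theorem Desc.rank_le (hrk : RankDecreases r p rk) {x y : V} (h : Desc r p x y) : rk x ≤ rk y := by
  rcases h.eq_or_lt hrk with rfl | h
  exacts [le_rfl, h.le]

theorem Desc.antisymm (hrk : RankDecreases r p rk) {x y : V} (h : Desc r p x y)
    (h' : Desc r p y x) : x = y := by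
  rcases h.eq_or_lt hrk with rfl | h
  · rfl
  · exact absurd (h'.rank_le hrk) (not_le.2 h)

theorem Desc.eq_of_root {x : V} (h : Desc r p x r) : x = r := by
  cases h with
  | refl => rfl
  | step h _ => exact absurd rfl h

theorem not_desc_parent (hrk : RankDecreases r p rk) {x : V} (hx : x ≠ r) : ¬ Desc r p x (p x) :=
  fun h => absurd (h.rank_le hrk) (not_le.2 (hrk x hx))

/-- Induction from the root downwards; the rank only serves to make it well founded. -/
theorem rank_induction (hrk : RankDecreases r p rk) {P : V → Prop} (hr : P r)
    (hp : ∀ x, x ≠ r → P (p x) → P x) (x : V) : P x := by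
  induction h : rk x using Nat.strong_induction_on generalizing x with
  | _ k ih =>
    by_cases hx : x = r
    · exact hx ▸ hr
    · exact hp x hx (ih _ (h ▸ hrk x hx) _ rfl)

theorem Desc.root (hrk : RankDecreases r p rk) (y : V) : Desc r p r y :=
  rank_induction hrk .refl (fun _ hx h => .step hx h) y

theorem parentGraph_adj (hrk : RankDecreases r p rk) {x y : V} :
    (parentGraph r p).Adj x y ↔ (x ≠ r ∧ y = p x) ∨ (y ≠ r ∧ x = p y) := by
  rw [parentGraph, SimpleGraph.fromRel_adj]
  refine ⟨fun h => h.2, fun h => ⟨?_, h⟩⟩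
  rintro rfl
  rcases h with ⟨h, h'⟩ | ⟨h, h'⟩ <;>
  · have := hrk _ h
    rw [← h'] at this
    exact lt_irrefl _ this

theorem parentGraph_adj_parent (hrk : RankDecreases r p rk) {x : V} (hx : x ≠ r) :
    (parentGraph r p).Adj x (p x) := (parentGraph_adj hrk).2 (.inl ⟨hx, rfl⟩)

/-- An edge that leaves the subtree of `x` is the edge from `x` to its parent. -/
theorem desc_crossing (hrk : RankDecreases r p rk) {x a b : V} (h : (parentGraph r p).Adj a b)
    (ha : Desc r p x a) (hb : ¬ Desc r p x b) : a = x ∧ b = p x ∧ x ≠ r := by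
  rcases (parentGraph_adj hrk).1 h with ⟨h, rfl⟩ | ⟨h, rfl⟩
  · rcases ha.eq_or with rfl | ⟨_, ha⟩
    · exact ⟨rfl, rfl, ‹_›⟩
    · exact absurd ha hb
  · exact absurd (.step ‹_› ha) hb

theorem parentGraph_deleteEdges_adj (hrk : RankDecreases r p rk) {x a : V} (hx : x ≠ r)
    (ha : a ≠ r) (hax : a ≠ x) : ((parentGraph r p).deleteEdges {s(x, p x)}).Adj a (p a) := by
  rw [SimpleGraph.deleteEdges_adj]
  refine ⟨parentGraph_adj_parent hrk ha, ?_⟩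
  rw [Set.mem_singleton_iff, Sym2.eq_iff]
  rintro (⟨h, _⟩ | ⟨h, h'⟩)
  · exact hax h
  · have h1 := hrk x hx
    have h2 := hrk a ha
    rw [h'] at h2
    rw [← h] at h1
    exact lt_asymm h1 h2

/-- The deleted edge is the only one that leaves the subtree of `x`, so the two components are this
subtree and its complement. This turns statements about sides of a tree edge into statements about
`Desc`. -/
theorem reachable_delete_iff (hrk : RankDecreases r p rk) {x : V} (hx : x ≠ r) (a : V) :
    (((parentGraph r p).deleteEdges {s(x, p x)}).Reachable a x ↔ Desc r p x a) ∧
      (((parentGraph r p).deleteEdges {s(x, p x)}).Reachable a (p x) ↔ ¬ Desc r p x a) := by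
  have inv : ∀ {a b}, ((parentGraph r p).deleteEdges {s(x, p x)}).Reachable a b →
      (Desc r p x a ↔ Desc r p x b) := by
    rintro a b ⟨w⟩
    induction w with
    | nil => rfl
    | @cons u v _ h _ ih =>
      refine Iff.trans ?_ ih
      rw [SimpleGraph.deleteEdges_adj] at h
      refine ⟨fun hu => ?_, fun hv => ?_⟩
      · by_contra hv
        obtain ⟨rfl, rfl, _⟩ := desc_crossing hrk h.1 hu hv
        exact h.2 rfl
      · by_contra hu
        obtain ⟨rfl, rfl, _⟩ := desc_crossing hrk h.1.symm hv hu
        exact h.2 Sym2.eq_swap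
  have down : Desc r p x a → ((parentGraph r p).deleteEdges {s(x, p x)}).Reachable a x := by
    refine rank_induction hrk (P := fun a => Desc r p x a →
      ((parentGraph r p).deleteEdges {s(x, p x)}).Reachable a x) (fun h => ?_) (fun a ha ih h => ?_) a
    · exact absurd h.eq_of_root hx
    · rcases h.eq_or with rfl | ⟨_, h'⟩
      · rfl
      · refine (SimpleGraph.Adj.reachable (parentGraph_deleteEdges_adj hrk hx ha ?_)).trans (ih h')
        rintro rfl
        exact not_desc_parent hrk hx h'
  have up : ∀ a, ¬ Desc r p x a →
      ((parentGraph r p).deleteEdges {s(x, p x)}).Reachable a r := by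
    refine rank_induction hrk (fun _ => .rfl) (fun a ha ih h => ?_)
    refine (SimpleGraph.Adj.reachable (parentGraph_deleteEdges_adj hrk hx ha ?_)).trans
      (ih fun h' => h (.step ha h'))
    rintro rfl
    exact h .refl
  refine ⟨⟨fun h => (inv h).2 .refl, down⟩, ⟨fun h h' => not_desc_parent hrk hx ((inv h).1 h'),
    fun h => (up a h).trans (up _ (not_desc_parent hrk hx)).symm⟩⟩

/-- Every node climbs to the root, and every edge is a bridge because its removal cuts off a
subtree. -/
theorem parentGraph_isTree (hrk : RankDecreases r p rk) : (parentGraph r p).IsTree := by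
  have conn : ∀ a, (parentGraph r p).Reachable a r :=
    rank_induction hrk .rfl fun a ha ih => (parentGraph_adj_parent hrk ha).reachable.trans ih
  have : Nonempty V := ⟨r⟩
  refine ⟨⟨fun a b => (conn a).trans (conn b).symm⟩, ?_⟩
  rw [SimpleGraph.isAcyclic_iff_forall_adj_isBridge]
  intro a b hab
  have key : ∀ x, x ≠ r → (parentGraph r p).IsBridge s(x, p x) := fun x hx =>
    SimpleGraph.isBridge_iff.2 fun h => (reachable_delete_iff hrk hx x).2.1 h .refl
  rcases (parentGraph_adj hrk).1 hab with ⟨h, rfl⟩ | ⟨h, rfl⟩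
  · exact key _ h
  · rw [Sym2.eq_swap]
    exact key _ h

/-- A walk that leaves the subtree of `x` passes through the parent of `x`. This decides which
endpoint of a tree edge is the farther one in `TreeRun.distTo`. -/
theorem dist_parent_add_one (hrk : RankDecreases r p rk) {x y : V} (hx : x ≠ r)
    (hy : ¬ Desc r p x y) : (parentGraph r p).dist x y = (parentGraph r p).dist (p x) y + 1 := by
  have conn := (parentGraph_isTree hrk).connected
  have key : ∀ {a b} (w : (parentGraph r p).Walk a b), Desc r p x a → ¬ Desc r p x b →
      (parentGraph r p).dist (p x) b + 1 ≤ w.length := by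
    intro a b w
    induction w with
    | nil => exact fun h h' => absurd h h'
    | @cons u v b h w ih =>
      intro hu hb
      rw [SimpleGraph.Walk.length_cons]
      by_cases hv : Desc r p x v
      · exact (ih hv hb).trans (Nat.le_succ _)
      · obtain ⟨rfl, rfl, _⟩ := desc_crossing hrk h hu hv
        exact Nat.succ_le_succ (SimpleGraph.dist_le w)
  refine le_antisymm ?_ ?_
  · have h1 := conn.dist_triangle (u := x) (v := p x) (w := y)
    rw [SimpleGraph.dist_eq_one_iff_adj.2 (parentGraph_adj_parent hrk hx)] at h1
    omega
  · obtain ⟨w, hw⟩ := conn.exists_walk_length_eq_dist x y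
    rw [← hw]
    exact key w .refl hy

/-- With the uniqueness of paths in a tree this identifies `IsAncestor`, defined by paths, with
`Desc`. -/
theorem exists_path_support_iff (hrk : RankDecreases r p rk) (y : V) :
    ∃ w : (parentGraph r p).Walk r y, w.IsPath ∧ ∀ x, x ∈ w.support ↔ Desc r p x y := by
  refine rank_induction hrk (P := fun y => ∃ w : (parentGraph r p).Walk r y, w.IsPath ∧
    ∀ x, x ∈ w.support ↔ Desc r p x y) ?_ ?_ y
  · refine ⟨.nil, .nil, fun x => ?_⟩
    rw [SimpleGraph.Walk.mem_support_nil_iff]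
    exact ⟨fun h => h ▸ .refl, fun h => h.eq_of_root⟩
  · rintro y hy ⟨w, hw, hs⟩
    refine ⟨w.concat (parentGraph_adj_parent hrk hy).symm, ?_, fun x => ?_⟩
    · refine hw.concat ?_ _
      rw [hs]
      exact not_desc_parent hrk hy
    · rw [SimpleGraph.Walk.support_concat, List.mem_append,
        List.mem_singleton, hs]
      refine ⟨?_, fun h => ?_⟩
      · rintro (h | rfl)
        exacts [.step hy h, .refl]
      · rcases h.eq_or with rfl | ⟨_, h⟩
        exacts [.inr rfl, .inl h]

/-- Every tree is the tree of some parent function. -/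
theorem exists_eq_parentGraph {T : SimpleGraph V} (hT : T.IsTree) (r : V) :
    ∃ (p : V → V) (rk : V → ℕ), RankDecreases r p rk ∧ T = parentGraph r p := by
  have conn := hT.connected
  have hex : ∀ x, ∃ y, x ≠ r → T.Adj x y ∧ T.dist y r < T.dist x r := by
    intro x
    by_cases hx : x = r
    · exact ⟨x, fun h => absurd hx h⟩
    · obtain ⟨w, hw⟩ := conn.exists_walk_length_eq_dist x r
      cases w with
      | nil => exact absurd rfl hx
      | @cons _ v _ h w =>
        refine ⟨v, fun _ => ⟨h, ?_⟩⟩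
        rw [← hw, SimpleGraph.Walk.length_cons]
        exact Nat.lt_succ_of_le (SimpleGraph.dist_le w)
  choose p hp using hex
  have hrk : RankDecreases r p fun x => T.dist x r := fun x hx => (hp x hx).2
  refine ⟨p, _, hrk, ?_⟩
  have hle : parentGraph r p ≤ T := by
    intro a b hab
    rcases (parentGraph_adj hrk).1 hab with ⟨h, rfl⟩ | ⟨h, rfl⟩
    · exact (hp _ h).1
    · exact (hp _ h).1.symm
  -- The parent edges already form a connected spanning subgraph, and a tree is a minimal connected
  -- graph.
  exact le_antisymm ((SimpleGraph.isTree_iff_minimal_connected.1 hT).2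
    (parentGraph_isTree hrk).connected hle) hle

theorem isAncestor_iff_desc {m : ℕ} {r : Fin m} {p : Fin m → Fin m} {rk : Fin m → ℕ}
    (hrk : RankDecreases r p rk) (x y : Fin m) :
    IsAncestor (parentGraph r p) r x y ↔ Desc r p x y := by
  obtain ⟨w, hw, hs⟩ := exists_path_support_iff hrk y
  refine ⟨?_, fun h => ⟨w, hw, (hs x).2 h⟩⟩
  rintro ⟨w', hw', hx⟩
  have := ((parentGraph_isTree hrk).isAcyclic.subsingleton_path r y).elim ⟨w', hw'⟩ ⟨w, hw⟩
  rw [Subtype.mk.injEq] at this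
  rw [← hs, ← this]
  exact hx

end ParentTrees

/-! ### Exchange of edges in join trees and the adjacency criterion -/

section JoinTrees

variable {n m : ℕ} {H : HGraph n m} {r : Fin m} {p : Fin m → Fin m} {rk : Fin m → ℕ}

/-- A top hyperedge `t` for each vertex suffices: climbing by parents stays among the hyperedges
that contain the vertex until it reaches `t`. -/
theorem parentGraph_isJoinTree (hrk : RankDecreases r p rk)
    (h : ∀ v, ∃ t, ∀ x, v ∈ H.edge x → v ∈ H.edge t ∧ (x ≠ t → x ≠ r ∧ v ∈ H.edge (p x))) :
    H.IsJoinTree (parentGraph r p) := by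
  refine ⟨parentGraph_isTree hrk, fun v => ?_⟩
  obtain ⟨t, ht⟩ := h v
  have key : ∀ x, ∀ hx : v ∈ H.edge x,
      ((parentGraph r p).induce {i | v ∈ H.edge i}).Reachable ⟨x, hx⟩ ⟨t, (ht x hx).1⟩ := by
    refine rank_induction hrk (fun hx => ?_) (fun x hxr ih hx => ?_)
    · by_cases hrt : r = t
      · subst hrt; rfl
      · exact absurd rfl ((ht r hx).2 hrt).1
    · by_cases hxt : x = t
      · subst hxt; rfl
      · have h2 := ((ht x hx).2 hxt).2
        refine SimpleGraph.Reachable.trans (SimpleGraph.Adj.reachable ?_) (ih h2)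
        exact parentGraph_adj_parent hrk hxr
  rintro ⟨a, ha⟩ ⟨b, hb⟩
  exact (key a ha).trans (key b hb).symm

/-- In a join tree, a vertex of two hyperedges that are separated by the edge above `z` lies in
both endpoints of this edge. -/
theorem HGraph.IsJoinTree.mem_of_desc (hT : H.IsJoinTree (parentGraph r p))
    (hrk : RankDecreases r p rk) {v : Fin n} {x y z : Fin m} (hx : v ∈ H.edge x)
    (hy : v ∈ H.edge y) (hzx : Desc r p z x) (hzy : ¬ Desc r p z y) :
    v ∈ H.edge z ∧ v ∈ H.edge (p z) := by
  obtain ⟨w⟩ := hT.2 v ⟨x, hx⟩ ⟨y, hy⟩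
  have key : ∀ {a b : {i | v ∈ H.edge i}},
      ((parentGraph r p).induce {i | v ∈ H.edge i}).Walk a b → Desc r p z a.1 → ¬ Desc r p z b.1 →
      v ∈ H.edge z ∧ v ∈ H.edge (p z) := by
    intro a b w
    induction w with
    | nil => exact fun h h' => absurd h h'
    | @cons u u' _ h _ ih =>
      intro hu hb
      by_cases hu' : Desc r p z u'.1
      · exact ih hu' hb
      · obtain ⟨h1, h2, _⟩ := desc_crossing hrk h hu hu'
        exact ⟨h1 ▸ u.2, h2 ▸ u'.2⟩
  exact key w hzx hzy

/-- A tree with a distinguished edge `XY`, rooted in `Y`. -/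
theorem exists_parentGraph_of_adj {T : SimpleGraph (Fin m)} (hT : T.IsTree) {X Y : Fin m}
    (hXY : T.Adj X Y) : ∃ (p : Fin m → Fin m) (rk : Fin m → ℕ), RankDecreases Y p rk ∧
      T = parentGraph Y p ∧ X ≠ Y ∧ p X = Y := by
  obtain ⟨p, rk, hrk, rfl⟩ := exists_eq_parentGraph hT Y
  refine ⟨p, rk, hrk, rfl, hXY.ne, ?_⟩
  rcases (parentGraph_adj hrk).1 hXY with ⟨_, h⟩ | ⟨h, _⟩
  exacts [h.symm, absurd rfl h]

theorem HGraph.IsJoinTree.mem_of_sides {T : SimpleGraph (Fin m)} (hT : H.IsJoinTree T)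
    {X Y i j : Fin m} (hXY : T.Adj X Y) (hi : (T.deleteEdges {s(X, Y)}).Reachable i X)
    (hj : (T.deleteEdges {s(X, Y)}).Reachable j Y) : H.sep i j ⊆ H.sep X Y := by
  obtain ⟨p, rk, hrk, rfl, hX, rfl⟩ := exists_parentGraph_of_adj hT.1 hXY
  intro v hv
  rw [HGraph.sep, mem_inter] at hv ⊢
  exact hT.mem_of_desc hrk hv.1 hv.2 ((reachable_delete_iff hrk hX i).1.1 hi)
    ((reachable_delete_iff hrk hX j).2.1 hj)

/-- Exchanging an edge of a join tree. -/
theorem HGraph.IsJoinTree.exchange {T : SimpleGraph (Fin m)} (hT : H.IsJoinTree T)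
    {X Y i j : Fin m} (hXY : T.Adj X Y) (hi : (T.deleteEdges {s(X, Y)}).Reachable i X)
    (hj : (T.deleteEdges {s(X, Y)}).Reachable j Y) (hs : H.sep X Y ⊆ H.sep i j) :
    H.IsJoinTree (T.deleteEdges {s(X, Y)} ⊔ SimpleGraph.edge i j) := by
  obtain ⟨p, rk, hrk, rfl, hX, rfl⟩ := exists_parentGraph_of_adj hT.1 hXY
  have side := reachable_delete_iff hrk hX
  have hiX := (side i).1.1 hi
  have hjX := (side j).2.1 hj
  have hij : i ≠ j := by rintro rfl; exact hjX hiX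
  set D := (parentGraph (p X) p).deleteEdges {s(X, p X)} with hD
  have hadj : (D ⊔ SimpleGraph.edge i j).Adj i j := by
    rw [SimpleGraph.sup_adj, SimpleGraph.edge_adj]
    exact .inr ⟨.inl ⟨rfl, rfl⟩, hij⟩
  have : Nonempty (Fin m) := ⟨i⟩
  refine ⟨⟨⟨fun a b => ?_⟩, ?_⟩, fun v => ?_⟩
  · have key : ∀ a, (D ⊔ SimpleGraph.edge i j).Reachable a i := by
      intro a
      by_cases ha : Desc (p X) p X a
      · exact (((side a).1.2 ha).trans hi.symm).mono le_sup_left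
      · exact ((((side a).2.2 ha).trans hj.symm).mono le_sup_left).trans hadj.symm.reachable
    exact (key a).trans (key b).symm
  · rw [SimpleGraph.isAcyclic_add_edge_iff_of_not_reachable]
    · exact hT.1.isAcyclic.anti (SimpleGraph.deleteEdges_le _)
    · exact fun h => hjX ((side j).1.1 (h.symm.trans hi))
  -- If `v` lies in the separator, its hyperedges on each side of `XY` still hang together (`k1`,
  -- `k2`) and the new edge joins them, as `i` and `j` both contain `v`. Otherwise the subtree of
  -- `v` does not use the edge `XY` at all.
  · by_cases hv : v ∈ H.sep X (p X)
    · have hvi := hs hv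
      rw [HGraph.sep, mem_inter] at hv hvi
      have lift : ∀ {a b} (ha : v ∈ H.edge a) (hb : v ∈ H.edge b), D.Adj a b →
          ((D ⊔ SimpleGraph.edge i j).induce {i | v ∈ H.edge i}).Reachable ⟨a, ha⟩ ⟨b, hb⟩ :=
        fun ha hb h => SimpleGraph.Adj.reachable
          (show (D ⊔ SimpleGraph.edge i j).Adj _ _ from Or.inl h)
      have k1 : ∀ a, ∀ ha : v ∈ H.edge a, Desc (p X) p X a →
          ((D ⊔ SimpleGraph.edge i j).induce {i | v ∈ H.edge i}).Reachable ⟨a, ha⟩ ⟨X, hv.1⟩ := by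
        refine rank_induction hrk (fun _ h => absurd h.eq_of_root hX) (fun a har ih ha h => ?_)
        rcases h.eq_or with rfl | ⟨_, h'⟩
        · rfl
        · have hax : a ≠ X := by rintro rfl; exact not_desc_parent hrk hX h'
          have hpa := (hT.mem_of_desc hrk ha hv.1 .refl
            fun h2 => hax (h2.antisymm hrk h)).2
          exact (lift ha hpa (parentGraph_deleteEdges_adj hrk hX har hax)).trans (ih hpa h')
      have k2 : ∀ a, ∀ ha : v ∈ H.edge a, ¬ Desc (p X) p X a →
          ((D ⊔ SimpleGraph.edge i j).induce {i | v ∈ H.edge i}).Reachable ⟨a, ha⟩ ⟨p X, hv.2⟩ := by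
        refine rank_induction hrk (fun _ _ => .rfl) (fun a har ih ha h => ?_)
        have hax : a ≠ X := by rintro rfl; exact h .refl
        have hpa := (hT.mem_of_desc hrk ha hv.2 .refl fun h2 => har h2.eq_of_root).2
        exact (lift ha hpa (parentGraph_deleteEdges_adj hrk hX har hax)).trans
          (ih hpa fun h' => h (.step har h'))
      have hXj := SimpleGraph.Adj.reachable (G := (D ⊔ SimpleGraph.edge i j).induce
        {i | v ∈ H.edge i}) (u := ⟨i, hvi.1⟩) (v := ⟨j, hvi.2⟩) hadj
      have hXpX := ((k1 i hvi.1 hiX).symm.trans hXj).trans (k2 j hvi.2 hjX)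
      have key : ∀ a : {i | v ∈ H.edge i},
          ((D ⊔ SimpleGraph.edge i j).induce {i | v ∈ H.edge i}).Reachable a ⟨X, hv.1⟩ := by
        rintro ⟨a, ha⟩
        by_cases h : Desc (p X) p X a
        · exact k1 a ha h
        · exact (k2 a ha h).trans hXpX.symm
      exact fun a b => (key a).trans (key b).symm
    · refine (hT.2 v).mono fun a b hab => ?_
      refine Or.inl ((SimpleGraph.deleteEdges_adj ..).2 ⟨hab, fun h => hv ?_⟩)
      rw [Set.mem_singleton_iff, Sym2.eq_iff] at h
      rw [HGraph.sep, mem_inter]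
      rcases h with ⟨h1, h2⟩ | ⟨h1, h2⟩
      · exact ⟨h1 ▸ a.2, h2 ▸ b.2⟩
      · exact ⟨h2 ▸ b.2, h1 ▸ a.2⟩

/-- The exchanged tree is the witness; `i` and `j` are distinct because `XY` is a bridge. -/
theorem HGraph.IsJoinTree.unionJoinGraph_adj {T : SimpleGraph (Fin m)} (hT : H.IsJoinTree T)
    {X Y i j : Fin m} (hXY : T.Adj X Y) (hi : (T.deleteEdges {s(X, Y)}).Reachable i X)
    (hj : (T.deleteEdges {s(X, Y)}).Reachable j Y) (hs : H.sep X Y ⊆ H.sep i j) :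
    H.unionJoinGraph.Adj i j := by
  refine ⟨_, hT.exchange hXY hi hj hs, ?_⟩
  rw [SimpleGraph.sup_adj, SimpleGraph.edge_adj]
  refine .inr ⟨.inl ⟨rfl, rfl⟩, ?_⟩
  rintro rfl
  exact SimpleGraph.isBridge_iff.1
    (SimpleGraph.isAcyclic_iff_forall_adj_isBridge.1 hT.1.isAcyclic hXY) (hi.symm.trans hj)

/-- Removing `ij` from the join tree that contains it splits the hyperedges into two sides, and `w`
crosses from one to the other. The ends of the crossing dart are separated by `ij` in that join
tree, so their intersection lies in that of `i` and `j`. -/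
theorem exists_dart_of_unionJoinGraph_adj {T : SimpleGraph (Fin m)} {i j : Fin m}
    (h : H.unionJoinGraph.Adj i j) (w : T.Walk i j) :
    ∃ d ∈ w.darts, H.sep d.fst d.snd ⊆ H.sep i j := by
  obtain ⟨T', hT', hij⟩ := h
  obtain ⟨p, rk, hrk, rfl, hi, rfl⟩ := exists_parentGraph_of_adj hT'.1 hij
  have key : ∀ {a b} (w : T.Walk a b), Desc (p i) p i a → ¬ Desc (p i) p i b →
      ∃ d ∈ w.darts, Desc (p i) p i d.fst ∧ ¬ Desc (p i) p i d.snd := by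
    intro a b w
    induction w with
    | nil => exact fun h h' => absurd h h'
    | @cons u u' _ h _ ih =>
      intro hu hb
      by_cases hu' : Desc (p i) p i u'
      · obtain ⟨d, hd, h⟩ := ih hu' hb
        exact ⟨d, by simp [hd], h⟩
      · exact ⟨⟨(u, u'), h⟩, by simp, hu, hu'⟩
  obtain ⟨d, hd, h1, h2⟩ := key w .refl (not_desc_parent hrk hi)
  refine ⟨d, hd, fun v hv => ?_⟩
  rw [HGraph.sep, mem_inter] at hv ⊢
  exact hT'.mem_of_desc hrk hv.1 hv.2 h1 h2

/-- A path visits no node twice, so its parts before and after the dart avoid the edge of the dart.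
-/
theorem dart_sides {V : Type*} {T : SimpleGraph V} {i j : V} {w : T.Walk i j} (hw : w.IsPath)
    {d : T.Dart} (hd : d ∈ w.darts) :
    (T.deleteEdges {s(d.fst, d.snd)}).Reachable i d.fst ∧
      (T.deleteEdges {s(d.fst, d.snd)}).Reachable j d.snd := by
  induction w with
  | nil => simp at hd
  | @cons u u' b h q ih =>
    rw [SimpleGraph.Walk.cons_isPath_iff] at hw
    rw [SimpleGraph.Walk.darts_cons, List.mem_cons] at hd
    rcases hd with rfl | hd
    · refine ⟨.rfl, ?_⟩
      refine SimpleGraph.Reachable.symm ⟨q.toDeleteEdges _ fun e he => ?_⟩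
      rintro rfl
      exact hw.2 (q.fst_mem_support_of_mem_edges he)
    · obtain ⟨h1, h2⟩ := ih hw.1 hd
      refine ⟨SimpleGraph.Reachable.trans (SimpleGraph.Adj.reachable ?_) h1, h2⟩
      rw [SimpleGraph.deleteEdges_adj]
      refine ⟨h, fun he => ?_⟩
      rw [Set.mem_singleton_iff, Sym2.eq_iff] at he
      rcases he with ⟨rfl, _⟩ | ⟨rfl, _⟩
      · exact hw.2 (q.dart_fst_mem_support_of_mem_darts hd)
      · exact hw.2 (q.dart_snd_mem_support_of_mem_darts hd)

/-- Every separator on the path contains the intersection of the ends (`hle`), in particular the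
outermost ones do; this gives the forward direction from the crossing dart. Conversely, the
outermost separators lie in the ends, so the given separator lies in both ends and its edge can be
exchanged for `ij`. -/
theorem HGraph.IsJoinTree.unionJoinGraph_adj_iff {T : SimpleGraph (Fin m)} (hT : H.IsJoinTree T)
    {i j : Fin m} (w : T.Walk i j) (hij : i ≠ j) (hw : w.IsPath) :
    H.unionJoinGraph.Adj i j ↔ ∃ d ∈ w.darts, H.sep d.fst d.snd ⊆ H.sep i w.snd ∧
      H.sep d.fst d.snd ⊆ H.sep w.penultimate j := by
  have hnil : ¬ w.Nil := SimpleGraph.Walk.not_nil_of_ne hij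
  have hle : ∀ d ∈ w.darts, H.sep i j ⊆ H.sep d.fst d.snd := fun d hd =>
    hT.mem_of_sides d.adj (dart_sides hw hd).1 (dart_sides hw hd).2
  constructor
  · intro h
    obtain ⟨d, hd, hs⟩ := exists_dart_of_unionJoinGraph_adj h w
    exact ⟨d, hd, hs.trans (hle _ (SimpleGraph.Walk.firstDart_mem_darts hnil)),
      hs.trans (hle _ (SimpleGraph.Walk.lastDart_mem_darts hnil))⟩
  · rintro ⟨d, hd, h1, h2⟩
    refine hT.unionJoinGraph_adj d.adj (dart_sides hw hd).1 (dart_sides hw hd).2 ?_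
    exact fun v hv => mem_inter.2 ⟨(mem_inter.1 (h1 hv)).1, (mem_inter.1 (h2 hv)).2⟩

end JoinTrees

/-! ### The tree of highest ancestors -/

section Runs

variable {n m : ℕ} {H : HGraph n m} {root : Fin m} {pos : Equiv.Perm (Fin m)}
  {parent : Fin m → Fin m}

theorem HGraph.firstPos_le {v : Fin n} {x : Fin m} (h : v ∈ H.edge x) :
    H.firstPos pos v ≤ pos x := Nat.sInf_le ⟨x, h, rfl⟩

theorem HGraph.exists_firstPos {v : Fin n} {x : Fin m} (h : v ∈ H.edge x) :
    ∃ t, v ∈ H.edge t ∧ H.firstPos pos v = pos t :=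
  Nat.sInf_mem (s := {k | ∃ i, v ∈ H.edge i ∧ k = (pos i : ℕ)}) ⟨_, x, h, rfl⟩

theorem HGraph.mem_upSep {v : Fin n} {x : Fin m} :
    v ∈ H.upSep pos x ↔ v ∈ H.edge x ∧ H.firstPos pos v < pos x := mem_filter

theorem perm_val_inj {x y : Fin m} : (pos x : ℕ) = pos y ↔ x = y := by
  rw [Fin.val_inj, pos.injective.eq_iff]

/-- The highest ancestors with respect to the numbering `pos` form a join tree. -/
structure HGraph.IsRun (H : HGraph n m) (root : Fin m) (pos : Equiv.Perm (Fin m))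
    (parent : Fin m → Fin m) : Prop where
  pos_root : (pos root : ℕ) = 0
  pos_parent : ∀ x, x ≠ root → (pos (parent x) : ℕ) = (H.upSep pos x).sup (H.firstPos pos)
  upSep_subset : ∀ x, x ≠ root → H.upSep pos x ⊆ H.edge (parent x)

theorem pos_pos_of_ne (h0 : (pos root : ℕ) = 0) {x : Fin m} (hx : x ≠ root) : 0 < (pos x : ℕ) := by
  rw [Nat.pos_iff_ne_zero, ← h0, Ne, perm_val_inj]
  exact hx

/-- All members of the up-separator have their first position before `x`. An empty supremum is `0`,
which is also smaller because `x` is not the root. -/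
theorem rankDecreases_of_sup (h0 : (pos root : ℕ) = 0)
    (h : ∀ x, x ≠ root → (pos (parent x) : ℕ) = (H.upSep pos x).sup (H.firstPos pos)) :
    RankDecreases root parent fun x => (pos x : ℕ) := by
  intro x hx
  show (pos (parent x) : ℕ) < pos x
  rw [h x hx, Finset.sup_lt_iff (pos_pos_of_ne h0 hx)]
  exact fun v hv => (HGraph.mem_upSep.1 hv).2

/-- The first hyperedge that contains a vertex is an ancestor of all others. -/
theorem desc_of_firstPos {p : Fin m → Fin m} (hT : H.IsJoinTree (parentGraph root p))
    (hrk : RankDecreases root p fun x => (pos x : ℕ)) {v : Fin n} {x t : Fin m}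
    (hx : v ∈ H.edge x) (ht : v ∈ H.edge t) (hv : H.firstPos pos v = pos t) :
    Desc root p t x := by
  by_contra hd
  have hne : t ≠ root := by rintro rfl; exact hd (Desc.root hrk x)
  have h1 := H.firstPos_le (pos := pos) (hT.mem_of_desc hrk ht hx .refl hd).2
  rw [hv] at h1
  exact absurd (hrk t hne) (not_lt.2 h1)

/-- Consecutive numbering of descendants is not needed, so this applies to pre-orders and to search
orders alike. Let `v₀` attain the maximum and let `t₀` be its first hyperedge, an ancestor of `x`.
For another `v` in the up-separator, the first hyperedge `t` does not come after `t₀`. Either `t =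
t₀`, or `t` lies outside the subtree of `t₀` and the join property between `x` and `t` puts `v` into
`t₀`. -/
theorem HGraph.isRun_of_linear_extension {p : Fin m → Fin m}
    (hT : H.IsJoinTree (parentGraph root p)) (hrk : RankDecreases root p fun x => (pos x : ℕ))
    (hp : ∀ x, x ≠ root → (pos (parent x) : ℕ) = (H.upSep pos x).sup (H.firstPos pos)) :
    H.IsRun root pos parent := by
  have h0 : (pos root : ℕ) = 0 := by
    have h := (Desc.root hrk (pos.symm ⟨0, root.pos⟩)).rank_le hrk
    simpa using h
  refine ⟨h0, hp, fun x hx v hv => ?_⟩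
  obtain ⟨v₀, hv₀, hs⟩ := exists_mem_eq_sup _ ⟨v, hv⟩ (H.firstPos pos)
  have hv' := HGraph.mem_upSep.1 hv
  have hv₀' := HGraph.mem_upSep.1 hv₀
  obtain ⟨t₀, ht₀, e₀⟩ := H.exists_firstPos (pos := pos) hv₀'.1
  obtain ⟨t, ht, e⟩ := H.exists_firstPos (pos := pos) hv'.1
  have hpt : parent x = t₀ := by rw [← perm_val_inj (pos := pos), hp x hx, hs, e₀]
  rw [hpt]
  have hle : (pos t : ℕ) ≤ pos t₀ := by
    rw [← e, ← e₀, ← hs]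
    exact le_sup (f := H.firstPos pos) hv
  by_cases hd : Desc root p t₀ t
  · rcases hd.eq_or_lt hrk with rfl | h
    · exact ht
    · exact absurd h (not_lt.2 hle)
  · exact (hT.mem_of_desc hrk hv'.1 ht (desc_of_firstPos hT hrk hv₀'.1 ht₀ e₀) hd).1

namespace HGraph.IsRun

variable (hR : H.IsRun root pos parent)
include hR

theorem rank : RankDecreases root parent fun x => (pos x : ℕ) :=
  rankDecreases_of_sup hR.pos_root hR.pos_parent

/-- The first hyperedge of a vertex serves as its top: in any later one the vertex belongs to the
up-separator and hence to the parent. -/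
theorem isJoinTree : H.IsJoinTree (parentGraph root parent) := by
  refine parentGraph_isJoinTree hR.rank fun v => ?_
  by_cases h : ∃ x, v ∈ H.edge x
  · obtain ⟨x, hx⟩ := h
    obtain ⟨t, ht, e⟩ := H.exists_firstPos (pos := pos) hx
    refine ⟨t, fun y hy => ⟨ht, fun hne => ?_⟩⟩
    have hlt : H.firstPos pos v < pos y := by
      refine lt_of_le_of_ne (H.firstPos_le hy) ?_
      rw [e, Ne, perm_val_inj]
      exact Ne.symm hne
    have hyr : y ≠ root := by
      rintro rfl
      rw [hR.pos_root] at hlt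
      exact absurd hlt (Nat.not_lt_zero _)
    exact ⟨hyr, hR.upSep_subset y hyr (mem_upSep.2 ⟨hy, hlt⟩)⟩
  · exact ⟨root, fun x hx => absurd ⟨x, hx⟩ h⟩

theorem upSep_eq_sep {x : Fin m} (hx : x ≠ root) : H.upSep pos x = H.sep x (parent x) := by
  ext v
  rw [mem_upSep, sep, mem_inter]
  refine ⟨fun h => ⟨h.1, hR.upSep_subset x hx (mem_upSep.2 h)⟩, fun h => ⟨h.1, ?_⟩⟩
  exact (H.firstPos_le h.2).trans_lt (hR.rank x hx)

/-- The parent of `c` comes first among the hyperedges that contain the separator of `c`. -/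
theorem pos_parent_le {c x : Fin m} (hc : c ≠ root) (h : H.upSep pos c ⊆ H.edge x) :
    (pos (parent c) : ℕ) ≤ pos x := by
  rw [hR.pos_parent c hc, Finset.sup_le_iff]
  exact fun v hv => H.firstPos_le (h hv)

/-- All vertices of the separator of `c` have occurred by the position of its parent, the first
hyperedge that contains them all; a later hyperedge that contains them has them in its up-separator.
-/
theorem upSep_subset_upSep {c x : Fin m} (hc : c ≠ root) (h : H.upSep pos c ⊆ H.edge x)
    (hx : x ≠ parent c) : x ≠ root ∧ H.upSep pos c ⊆ H.upSep pos x := by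
  have hlt : (pos (parent c) : ℕ) < pos x := by
    refine lt_of_le_of_ne (hR.pos_parent_le hc h) ?_
    rw [Ne, perm_val_inj]
    exact Ne.symm hx
  refine ⟨?_, fun v hv => mem_upSep.2 ⟨h hv, lt_of_le_of_lt ?_ hlt⟩⟩
  · rintro rfl
    rw [hR.pos_root] at hlt
    exact absurd hlt (Nat.not_lt_zero _)
  · rw [hR.pos_parent c hc]
    exact le_sup (f := H.firstPos pos) hv

/-- If `x` were a proper ancestor of `c`, the parent of `x` would contain the separator of `c` and
yet precede the parent of `c`. So the tree edge of a larger separator always has its child on the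
far side. -/
theorem not_desc_of_upSep_subset {c x : Fin m} (hc : c ≠ root) (hx : x ≠ root) (hne : x ≠ c)
    (h : H.upSep pos c ⊆ H.upSep pos x) : ¬ Desc root parent x c := by
  intro hd
  rcases hd.eq_or with rfl | ⟨_, hd⟩
  · exact hne rfl
  · have h1 := hd.rank_le hR.rank
    have h2 := hR.pos_parent_le hc (h.trans (hR.upSep_subset x hx))
    exact absurd (hR.rank x hx) (not_lt.2 (h1.trans h2))

/-- With an empty separator no vertex could occur both inside and outside the subtree of `c`, and
the incidence graph would be disconnected. The subroutine is only required to be correct on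
non-empty sets. -/
theorem upSep_nonempty (hconn : H.incidenceGraph.Connected) {c : Fin m} (hc : c ≠ root) :
    (H.upSep pos c).Nonempty := by
  by_contra hemp
  rw [not_nonempty_iff_eq_empty] at hemp
  have key : ∀ {a b}, H.incidenceGraph.Walk a b →
      (∀ i, a = Sum.inr i → Desc root parent c i) →
      (∀ v, a = Sum.inl v → ∃ i, v ∈ H.edge i ∧ Desc root parent c i) →
      (∀ i, b = Sum.inr i → Desc root parent c i) := by
    intro a b w
    have push : ∀ {v i j}, v ∈ H.edge i → v ∈ H.edge j → Desc root parent c i →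
        Desc root parent c j := by
      intro v i j hi hj hd
      by_contra hd'
      have := hR.isJoinTree.mem_of_desc hR.rank hi hj hd hd'
      have hv : v ∈ H.upSep pos c := by
        rw [hR.upSep_eq_sep hc]
        exact mem_inter.2 this
      rw [hemp] at hv
      exact notMem_empty _ hv
    induction w with
    | nil => exact fun h _ => h
    | @cons u u' _ h _ ih =>
      intro h1 h2
      rw [incidenceGraph, SimpleGraph.fromRel_adj] at h
      apply ih
      · rintro i rfl
        rcases h.2 with ⟨v, i', rfl, hi, hv⟩ | ⟨v, i', hv', _, _⟩
        · obtain ⟨j, hj, hd⟩ := h2 v rfl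
          cases hi
          exact push hj hv hd
        · cases hv'
      · rintro v rfl
        rcases h.2 with ⟨v', i', _, hi, _⟩ | ⟨v', i', hv', rfl, hv⟩
        · cases hi
        · cases hv'
          exact ⟨i', hv, h1 i' rfl⟩
  obtain ⟨w⟩ := hconn.preconnected (Sum.inr c) (Sum.inr root)
  have hd := key w (fun i hi => by cases hi; exact .refl) (fun v hv => by cases hv) root rfl
  exact hc hd.eq_of_root

end HGraph.IsRun

end Runs

/-! ### The edges added by Algorithm 2 -/

namespace TreeRun

variable {n m : ℕ} {H : HGraph n m} (R : TreeRun H)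

/-- A pre-order places parents before children, and injectivity makes this strict. -/
theorem isRun : H.IsRun R.root R.pos R.parent := by
  obtain ⟨p, rk, hrk, hT⟩ := exists_eq_parentGraph R.isJoinTree.1 R.root
  have hpre := R.isPreorder
  rw [hT] at hpre
  refine HGraph.isRun_of_linear_extension (p := p) (hT ▸ R.isJoinTree) (fun x hx => ?_)
    R.pos_parent
  refine lt_of_le_of_ne (hpre.1 _ _ ((isAncestor_iff_desc hrk _ _).2 (.parent hx))) ?_
  rw [Ne, perm_val_inj]
  intro h
  have := hrk x hx
  rw [h] at this
  exact lt_irrefl _ this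

theorem tree_eq : R.tree = parentGraph R.root R.parent := rfl

theorem tree_isJoinTree : H.IsJoinTree R.tree := R.isRun.isJoinTree

theorem tree_adj_parent {c : Fin m} (hc : c ≠ R.root) : R.tree.Adj c (R.parent c) :=
  parentGraph_adj_parent R.isRun.rank hc

theorem up_eq_sep {c : Fin m} (hc : c ≠ R.root) : R.up c = H.sep c (R.parent c) :=
  R.isRun.upSep_eq_sep hc

/-- By `far`, the farther endpoint of a collected tree edge is always its child. The parent of `c`
enters only through the separator of `c` itself. -/
theorem mem_collected {c x : Fin m} (hc : c ≠ R.root) :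
    x ∈ R.collected c ↔ x = R.parent c ∨ (x ≠ R.root ∧ R.up c ⊆ R.up x) := by
  have far : ∀ x, x ≠ R.root → x ≠ c → R.up c ⊆ R.up x →
      R.distTo c (R.parent x) < R.distTo c x := by
    intro x hx hne h
    have hd := R.isRun.not_desc_of_upSep_subset hc hx hne h
    have e1 := dist_parent_add_one R.isRun.rank hx hd
    have e2 := dist_parent_add_one R.isRun.rank hx (y := R.parent c) fun h => hd (.step hc h)
    rw [distTo, distTo, tree_eq, e1, e2]
    omega
  rw [collected, mem_filter]
  constructor
  · rintro ⟨-, c', hc', hsub, ⟨rfl, rfl | rfl⟩ | ⟨hne, rfl, h⟩ | ⟨hne, rfl, h⟩⟩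
    · exact .inr ⟨hc, Subset.rfl⟩
    · exact .inl rfl
    · exact .inr ⟨hc', hsub⟩
    · exact absurd (far c' hc' hne hsub) (not_lt.2 h.le)
  · rintro (rfl | ⟨hx, h⟩)
    · exact ⟨mem_univ _, c, hc, Subset.rfl, .inl ⟨rfl, .inr rfl⟩⟩
    · refine ⟨mem_univ _, x, hx, h, ?_⟩
      by_cases hne : x = c
      · exact .inl ⟨hne, .inl hne⟩
      · exact .inr (.inl ⟨hne, rfl, far x hx hne h⟩)

theorem up_subset_edge_of_mem_collected {c x : Fin m} (hc : c ≠ R.root)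
    (h : x ∈ R.collected c) : R.up c ⊆ H.edge x := by
  rcases (R.mem_collected hc).1 h with rfl | ⟨_, h⟩
  · exact R.isRun.upSep_subset c hc
  · exact h.trans (filter_subset _ _)

/-- With the previous lemma this makes 𝔼 the set of all hyperedges that contain the separator, which
is what the correctness of the algorithm needs. -/
theorem mem_collected_of_up_subset {c x : Fin m} (hc : c ≠ R.root) (h : R.up c ⊆ H.edge x) :
    x ∈ R.collected c := by
  rw [R.mem_collected hc]
  by_cases hx : x = R.parent c
  · exact .inl hx
  · exact .inr (R.isRun.upSep_subset_upSep hc h hx)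

/-- The members of the two sides: those in the subtree of `c` and the others. -/
theorem mem_sideOf_self {c x : Fin m} (hc : c ≠ R.root) :
    x ∈ R.sideOf c c ↔ x ∈ R.collected c ∧ Desc R.root R.parent c x := by
  classical
  rw [sideOf, mem_filter, tree_eq, (reachable_delete_iff R.isRun.rank hc x).1]

theorem mem_sideOf_parent {c x : Fin m} (hc : c ≠ R.root) :
    x ∈ R.sideOf c (R.parent c) ↔ x ∈ R.collected c ∧ ¬ Desc R.root R.parent c x := by
  classical
  rw [sideOf, mem_filter, tree_eq, (reachable_delete_iff R.isRun.rank hc x).2]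

/-- The edges added for the separator of `c`. -/
noncomputable def addedFor (c : Fin m) : Multiset (Sym2 (Fin m)) :=
  (R.sideOf c c ×ˢ R.sideOf c (R.parent c)).val.map fun q => s(q.1, q.2)

theorem added_eq_sum : R.added = ∑ c ∈ Finset.univ.erase R.root, R.addedFor c := by
  classical
  rw [added]
  refine Finset.sum_congr ?_ fun _ _ => rfl
  ext; simp

/-- The negated equivalence says that exactly one end lies below `c`; it is symmetric, as unordered
pairs require. -/
theorem mem_addedFor {c i j : Fin m} (hc : c ≠ R.root) : s(i, j) ∈ R.addedFor c ↔
    (i ∈ R.collected c ∧ j ∈ R.collected c) ∧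
      ¬ (Desc R.root R.parent c i ↔ Desc R.root R.parent c j) := by
  rw [addedFor, Multiset.mem_map]
  constructor
  · rintro ⟨⟨a, b⟩, hq, he⟩
    rw [Finset.mem_val, mem_product, R.mem_sideOf_self hc, R.mem_sideOf_parent hc] at hq
    rcases Sym2.eq_iff.1 he with ⟨rfl, rfl⟩ | ⟨rfl, rfl⟩ <;> tauto
  · rintro ⟨⟨hi, hj⟩, h⟩
    by_cases hd : Desc R.root R.parent c i
    · refine ⟨(i, j), ?_, rfl⟩
      rw [Finset.mem_val, mem_product, R.mem_sideOf_self hc, R.mem_sideOf_parent hc]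
      tauto
    · refine ⟨(j, i), ?_, Sym2.eq_swap⟩
      rw [Finset.mem_val, mem_product, R.mem_sideOf_self hc, R.mem_sideOf_parent hc]
      tauto

theorem addedFor_nodup {c : Fin m} (hc : c ≠ R.root) : (R.addedFor c).Nodup := by
  refine Multiset.Nodup.map_on ?_ (Finset.nodup _)
  rintro ⟨a, b⟩ h ⟨a', b'⟩ h' he
  rw [Finset.mem_val, mem_product, R.mem_sideOf_self hc, R.mem_sideOf_parent hc] at h h'
  rcases Sym2.eq_iff.1 he with ⟨rfl, rfl⟩ | ⟨rfl, rfl⟩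
  · rfl
  · exact absurd h.1.2 h'.2.2

theorem mem_added {e : Sym2 (Fin m)} : e ∈ R.added ↔ ∃ c, c ≠ R.root ∧ e ∈ R.addedFor c := by
  rw [added_eq_sum, Multiset.mem_sum]
  simp

/-- The separator that causes an edge to be added is the intersection of its ends. -/
theorem up_eq_sep_of_mem_addedFor {c i j : Fin m} (hc : c ≠ R.root) (h : s(i, j) ∈ R.addedFor c) :
    R.up c = H.sep i j := by
  rw [R.mem_addedFor hc] at h
  refine Subset.antisymm (subset_inter (R.up_subset_edge_of_mem_collected hc h.1.1)
    (R.up_subset_edge_of_mem_collected hc h.1.2)) fun v hv => ?_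
  rw [R.up_eq_sep hc]
  rw [HGraph.sep, mem_inter] at hv ⊢
  by_cases hd : Desc R.root R.parent c i
  · exact R.tree_isJoinTree.mem_of_desc R.isRun.rank hv.1 hv.2 hd (by tauto)
  · exact R.tree_isJoinTree.mem_of_desc R.isRun.rank hv.2 hv.1 (z := c) (by tauto) hd

/-- An added pair is separated by the edge of `c`, whose separator is the intersection of the pair,
so exchange applies. Conversely, the path between adjacent hyperedges contains an edge whose
separator lies in both ends; both ends are then collected for it, on different sides. -/
theorem mem_added_iff {i j : Fin m} : s(i, j) ∈ R.added ↔ H.unionJoinGraph.Adj i j := by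
  have hrk := R.isRun.rank
  rw [mem_added]
  constructor
  · rintro ⟨c, hc, h⟩
    have he := R.up_eq_sep_of_mem_addedFor hc h
    rw [R.mem_addedFor hc] at h
    rw [R.up_eq_sep hc] at he
    have side := reachable_delete_iff hrk hc
    by_cases hd : Desc R.root R.parent c i
    · exact R.tree_isJoinTree.unionJoinGraph_adj (R.tree_adj_parent hc) ((side i).1.2 hd)
        ((side j).2.2 (by tauto)) he.le
    · refine (R.tree_isJoinTree.unionJoinGraph_adj (R.tree_adj_parent hc)
        ((side j).1.2 (by tauto)) ((side i).2.2 hd) ?_).symm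
      rw [he, HGraph.sep, HGraph.sep, inter_comm]
  · intro h
    obtain ⟨w, hw⟩ := (R.tree_isJoinTree.1.connected i j).exists_isPath
    obtain ⟨d, hd, hs⟩ := exists_dart_of_unionJoinGraph_adj h w
    obtain ⟨h1, h2⟩ := dart_sides hw hd
    have key : ∀ c, c ≠ R.root → H.sep c (R.parent c) ⊆ H.sep i j →
        ¬ (Desc R.root R.parent c i ↔ Desc R.root R.parent c j) →
        ∃ c, c ≠ R.root ∧ s(i, j) ∈ R.addedFor c := by
      intro c hc hsub hsep
      rw [← R.up_eq_sep hc] at hsub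
      exact ⟨c, hc, (R.mem_addedFor hc).2
        ⟨⟨R.mem_collected_of_up_subset hc (hsub.trans inter_subset_left),
          R.mem_collected_of_up_subset hc (hsub.trans inter_subset_right)⟩, hsep⟩⟩
    rcases (parentGraph_adj hrk).1 d.adj with ⟨hc, he⟩ | ⟨hc, he⟩
    · rw [he] at hs h1 h2
      have a1 := (reachable_delete_iff hrk hc i).1.1 h1
      have a2 := (reachable_delete_iff hrk hc j).2.1 h2
      exact key _ hc hs (by tauto)
    · rw [he] at hs h1 h2
      rw [Sym2.eq_swap] at h1 h2
      have a1 := (reachable_delete_iff hrk hc i).2.1 h1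
      have a2 := (reachable_delete_iff hrk hc j).1.1 h2
      refine key _ hc ?_ (by tauto)
      rwa [HGraph.sep, inter_comm] at hs

theorem graph_eq : R.graph = H.unionJoinGraph := by
  ext i j
  rw [graph, SimpleGraph.fromEdgeSet_adj, Set.mem_ofPred_eq, R.mem_added_iff]
  exact ⟨fun h => h.1, fun h => ⟨h, h.ne⟩⟩

/-- Each separator adds a pair at most once. All separators that add the same pair are siblings, so
their subtrees are disjoint, and each subtree contains exactly one of the two ends. -/
theorem count_added_le_two (e : Sym2 (Fin m)) : Multiset.count e R.added ≤ 2 := by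
  classical
  have hrk := R.isRun.rank
  have h1 : Multiset.count e R.added ≤
      ((Finset.univ.erase R.root).filter fun c => e ∈ R.addedFor c).card := by
    rw [added_eq_sum, Multiset.count_sum', card_filter]
    refine sum_le_sum fun c hc => ?_
    split_ifs with h
    · exact Multiset.nodup_iff_count_le_one.1 (R.addedFor_nodup (ne_of_mem_erase hc)) e
    · rw [Multiset.count_eq_zero_of_notMem h]
  refine h1.trans ?_
  by_contra! hlt
  rw [Finset.two_lt_card] at hlt
  obtain ⟨a, ha, b, hb, c, hc, hab, hac, hbc⟩ := hlt
  induction e with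
  | _ i j =>
    simp only [mem_filter, mem_erase, mem_univ, and_true] at ha hb hc
    -- Both separators equal the intersection of `i` and `j`, and the position of the parent depends
    -- only on the separator as a set.
    have par : ∀ {x y}, x ≠ R.root ∧ s(i, j) ∈ R.addedFor x → y ≠ R.root ∧ s(i, j) ∈ R.addedFor y →
        R.parent x = R.parent y := by
      intro x y hx hy
      have e := (R.up_eq_sep_of_mem_addedFor hx.1 hx.2).trans
        (R.up_eq_sep_of_mem_addedFor hy.1 hy.2).symm
      rw [up, up] at e
      rw [← perm_val_inj (pos := R.pos), R.pos_parent x hx.1, R.pos_parent y hy.1, e]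
    have disj : ∀ {x y z}, x ≠ R.root ∧ s(i, j) ∈ R.addedFor x →
        y ≠ R.root ∧ s(i, j) ∈ R.addedFor y → x ≠ y → Desc R.root R.parent x z →
        ¬ Desc R.root R.parent y z := by
      have half : ∀ {x y}, x ≠ R.root ∧ s(i, j) ∈ R.addedFor x →
          y ≠ R.root ∧ s(i, j) ∈ R.addedFor y → Desc R.root R.parent x y → x = y := by
        intro x y hx hy h
        rcases h.eq_or with h | ⟨_, h⟩
        · exact h.symm
        · rw [par hy hx] at h
          exact absurd h (not_desc_parent hrk hx.1)
      intro x y z hx hy hne h h'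
      rcases h.total h' with h | h
      · exact hne (half hx hy h)
      · exact hne (half hy hx h).symm
    have A := ((R.mem_addedFor ha.1).1 ha.2).2
    have B := ((R.mem_addedFor hb.1).1 hb.2).2
    have C := ((R.mem_addedFor hc.1).1 hc.2).2
    have ab := fun z => disj (z := z) ha hb hab
    have ac := fun z => disj (z := z) ha hc hac
    have bc := fun z => disj (z := z) hb hc hbc
    have := ab i; have := ab j; have := ac i; have := ac j; have := bc i; have := bc j
    clear ab ac bc disj par ha hb hc
    generalize Desc R.root R.parent a i = ai, Desc R.root R.parent a j = aj,
      Desc R.root R.parent b i = bi, Desc R.root R.parent b j = bj,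
      Desc R.root R.parent c i = ci, Desc R.root R.parent c j = cj at *
    -- Pigeonhole: three disjoint subtrees cannot each contain one of only two nodes.
    grind

/-- The number of additions is at most twice the number of edges. -/
theorem card_added_le : Multiset.card R.added ≤ 2 * H.unionJoinGraph.edgeSet.ncard := by
  classical
  have hs : H.unionJoinGraph.edgeSet = (R.added.toFinset : Set (Sym2 (Fin m))) := by
    ext e
    induction e with
    | _ i j => simp [R.mem_added_iff]
  rw [hs, Set.ncard_coe_finset, ← Multiset.toFinset_sum_count_eq]
  refine (sum_le_card_nsmul _ _ 2 fun e _ => R.count_added_le_two e).trans ?_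
  rw [smul_eq_mul, mul_comm]

end TreeRun

/-! ### Maximum cardinality orders grow along a join tree -/

section MaximumCardinality

variable {n m : ℕ} {H : HGraph n m}

/-- The vertices of the hyperedges in a list. -/
def HGraph.covered (H : HGraph n m) (l : List (Fin m)) : Finset (Fin n) := l.toFinset.biUnion H.edge

theorem HGraph.mem_covered {l : List (Fin m)} {v : Fin n} :
    v ∈ H.covered l ↔ ∃ x ∈ l, v ∈ H.edge x := by simp [covered]

/-- Each member of the list maximises the number of covered vertices at the time it is chosen. -/
def HGraph.IsMaxCard (H : HGraph n m) (l : List (Fin m)) : Prop :=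
  ∀ l₁ e l₂, l = l₁ ++ e :: l₂ → ∀ x, x ∉ l₁ →
    (H.edge x ∩ H.covered l₁).card ≤ (H.edge e ∩ H.covered l₁).card

theorem append_singleton_eq_split {α : Type*} {l l₁ l₂ : List α} {e x : α}
    (h : l ++ [x] = l₁ ++ e :: l₂) : (l₁ = l ∧ e = x) ∨ ∃ l₃, l = l₁ ++ e :: l₃ := by
  rcases List.eq_nil_or_concat l₂ with rfl | ⟨l₃, y, rfl⟩
  · have := List.append_inj' h rfl
    simp only [List.cons.injEq, and_true] at this
    exact .inl ⟨this.1.symm, this.2.symm⟩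
  · right
    rw [List.concat_eq_append, ← List.cons_append, ← List.append_assoc] at h
    exact ⟨l₃, (List.append_inj' h rfl).1⟩

theorem HGraph.IsMaxCard.of_append {l l' : List (Fin m)} (h : H.IsMaxCard (l ++ l')) :
    H.IsMaxCard l := fun l₁ e l₂ hl => h l₁ e (l₂ ++ l') (by rw [hl]; simp)

theorem HGraph.IsMaxCard.append_singleton {l : List (Fin m)} {e : Fin m} (h : H.IsMaxCard l)
    (he : ∀ x, x ∉ l → (H.edge x ∩ H.covered l).card ≤ (H.edge e ∩ H.covered l).card) :
    H.IsMaxCard (l ++ [e]) := by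
  intro l₁ e' l₂ hl
  rcases append_singleton_eq_split hl with ⟨rfl, rfl⟩ | ⟨l₃, hl⟩
  · exact he
  · exact h l₁ e' l₃ hl

/-- Every member of the list but the first is adjacent in `T` to an earlier one. -/
def GrownIn (T : SimpleGraph (Fin m)) (l : List (Fin m)) : Prop :=
  ∀ l₁ e l₂, l = l₁ ++ e :: l₂ → l₁ ≠ [] → ∃ f ∈ l₁, T.Adj e f

/-- A new member is adjacent to an earlier `f`. If `f` is its parent the claim is clear; if `f` is
its child, then the new member was in the list before, by induction, and so was its parent. -/
theorem GrownIn.closed {r : Fin m} {p : Fin m → Fin m} {rk : Fin m → ℕ}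
    (hrk : RankDecreases r p rk) {l : List (Fin m)} (h : GrownIn (parentGraph r p) l)
    (hl : ∀ a ∈ l.head?, a = r) : ∀ a ∈ l, a ≠ r → p a ∈ l := by
  induction l using List.reverseRecOn with
  | nil => simp
  | append_singleton l x ih =>
    have h' : GrownIn (parentGraph r p) l := fun l₁ e l₂ he => h l₁ e (l₂ ++ [x]) (by rw [he]; simp)
    by_cases hnil : l = []
    · subst hnil
      intro a ha har
      simp only [List.nil_append, List.mem_singleton] at ha
      exact absurd (hl a (by simp [ha])) har
    · have ih := ih h' fun a ha => hl a (by
        cases l with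
        | nil => exact absurd rfl hnil
        | cons => exact ha)
      intro a ha har
      rw [List.mem_append] at ha ⊢
      rcases ha with ha | ha
      · exact .inl (ih a ha har)
      · rw [List.mem_singleton] at ha
        subst ha
        obtain ⟨f, hf, hadj⟩ := h l a [] rfl hnil
        rcases (parentGraph_adj hrk).1 hadj with ⟨_, rfl⟩ | ⟨hfr, rfl⟩
        · exact .inl hf
        · exact .inl (ih _ (ih f hf hfr) har)

/-- The tree is corrected whenever a member `e` is appended. Let `X` be the last node outside `l` on
the way from `e` to `l`, and let `p X` be its parent in `l`. By the join property the covered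
vertices of `e` lie in `X`; as `e` covers a maximal number, the two sets are equal. So the separator
of `X` and `p X` lies in `e`, and that edge may be exchanged for one between `e` and `p X`. -/
theorem HGraph.IsMaxCard.exists_grownIn (hH : H.IsAcyclic) {l : List (Fin m)}
    (hl : H.IsMaxCard l) (hnd : l.Nodup) : ∃ T, H.IsJoinTree T ∧ GrownIn T l := by
  induction l using List.reverseRecOn with
  | nil =>
    obtain ⟨T, hT⟩ := hH
    exact ⟨T, hT, fun l₁ e l₂ h => by simp at h⟩
  | append_singleton l e ih =>
    have hmax := hl l e [] rfl
    obtain ⟨T, hT, hg⟩ := ih hl.of_append (List.nodup_append.1 hnd).1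
    have hel : e ∉ l := fun h => (List.nodup_append.1 hnd).2.2 e h e (by simp) rfl
    cases hl0 : l with
    | nil =>
      refine ⟨T, hT, fun l₁ x l₂ h hne => ?_⟩
      rcases append_singleton_eq_split h with ⟨rfl, _⟩ | ⟨l₃, h⟩
      · exact absurd rfl hne
      · simp at h
    | cons r l' =>
      rw [← hl0]
      obtain ⟨p, rk, hrk, rfl⟩ := exists_eq_parentGraph hT.1 r
      have hcl := hg.closed hrk (by simp [hl0])
      have hrl : r ∈ l := by simp [hl0]
      have gate : ∀ x, x ∉ l → ∃ X, Desc r p X x ∧ X ∉ l ∧ X ≠ r ∧ p X ∈ l := by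
        refine rank_induction hrk (fun h => absurd hrl h) (fun x hx ih h => ?_)
        by_cases hp : p x ∈ l
        · exact ⟨x, .refl, h, hx, hp⟩
        · obtain ⟨X, h1, h2⟩ := ih hp
          exact ⟨X, .step hx h1, h2⟩
      obtain ⟨X, hXe, hXl, hXr, hY⟩ := gate e hel
      have hout : ∀ a, a ∈ l → ¬ Desc r p X a := by
        intro a ha hd
        induction hd with
        | refl => exact hXl ha
        | step hy _ ih => exact ih (hcl _ ha hy)
      have hsub : H.edge e ∩ H.covered l ⊆ H.edge X ∩ H.covered l := by
        intro v hv
        obtain ⟨h1, h2⟩ := mem_inter.1 hv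
        obtain ⟨a, ha, hva⟩ := mem_covered.1 h2
        exact mem_inter.2 ⟨(hT.mem_of_desc hrk h1 hva hXe (hout a ha)).1, h2⟩
      have heq := eq_of_subset_of_card_le hsub (hmax X hXl)
      have side := reachable_delete_iff hrk hXr
      have hsep : H.sep X (p X) ⊆ H.sep e (p X) := by
        intro v hv
        obtain ⟨h1, h2⟩ := mem_inter.1 hv
        have : v ∈ H.edge X ∩ H.covered l := mem_inter.2 ⟨h1, mem_covered.2 ⟨_, hY, h2⟩⟩
        rw [← heq] at this
        exact mem_inter.2 ⟨(mem_inter.1 this).1, h2⟩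
      refine ⟨_, hT.exchange (parentGraph_adj_parent hrk hXr) ((side e).1.2 hXe) .rfl hsep, ?_⟩
      intro l₁ x l₂ h hne
      rcases append_singleton_eq_split h with ⟨rfl, rfl⟩ | ⟨l₃, h⟩
      · refine ⟨p X, hY, .inr ?_⟩
        rw [SimpleGraph.edge_adj]
        exact ⟨.inl ⟨rfl, rfl⟩, fun h => hel (h ▸ hY)⟩
      · obtain ⟨f, hf, hadj⟩ := hg l₁ x l₃ h hne
        -- The removed edge has the end `X` outside `l`, so the edges by which `l` has grown
        -- survive.
        refine ⟨f, hf, .inl ((SimpleGraph.deleteEdges_adj ..).2 ⟨hadj, fun he => hXl ?_⟩)⟩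
        rw [Set.mem_singleton_iff, Sym2.eq_iff] at he
        rw [h]
        rcases he with ⟨rfl, _⟩ | ⟨_, rfl⟩
        · simp
        · simp [hf]

theorem getElem?_eq_some_split {α : Type*} {l : List α} {k : ℕ} {x : α} (h : l[k]? = some x) :
    l = l.take k ++ x :: l.drop (k + 1) := by
  obtain ⟨hk, rfl⟩ := List.getElem?_eq_some_iff.1 h
  rw [← List.drop_eq_getElem_cons hk, List.take_append_drop]

/-- A complete maximum cardinality order is the order of a run. -/
theorem HGraph.IsMaxCard.exists_isRun (hH : H.IsAcyclic) {l : List (Fin m)}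
    (hl : H.IsMaxCard l) (hnd : l.Nodup) (hlen : l.length = m) :
    ∃ root pos parent, H.IsRun root pos parent ∧ ∀ x : Fin m, l[(pos x : ℕ)]? = some x := by
  obtain ⟨T, hT, hg⟩ := hl.exists_grownIn hH hnd
  obtain ⟨r₀⟩ := hT.1.connected.nonempty
  have hm : 0 < m := r₀.pos
  let f : Fin m → Fin m := fun k => l[(k : ℕ)]'(by rw [hlen]; exact k.2)
  have hf : Function.Injective f := fun a b h => Fin.ext ((hnd.getElem_inj_iff).1 h)
  let e : Equiv.Perm (Fin m) := Equiv.ofBijective f (Finite.injective_iff_bijective.1 hf)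
  have hget : ∀ x : Fin m, l[(e.symm x : ℕ)]? = some x := by
    intro x
    rw [List.getElem?_eq_some_iff]
    exact ⟨by rw [hlen]; exact (e.symm x).2, e.apply_symm_apply x⟩
  let root := e ⟨0, hm⟩
  -- The fallback `x` is never taken: all first positions in an up-separator are smaller than `m`.
  let parent : Fin m → Fin m := fun x =>
    if h : (H.upSep e.symm x).sup (H.firstPos e.symm) < m then e ⟨_, h⟩ else x
  obtain ⟨p, rk, hrk, rfl⟩ := exists_eq_parentGraph hT.1 root
  refine ⟨root, e.symm, parent, isRun_of_linear_extension hT ?_ ?_, hget⟩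
  · intro x hx
    have hsplit := getElem?_eq_some_split (hget x)
    set k := (e.symm x : ℕ) with hk
    -- The initial segment that ends with `x` has itself grown in the tree, starting at the root.
    -- Being closed under parents, it contains the parent of `x`, which therefore comes before `x`.
    have hg' : GrownIn (parentGraph root p) (l.take k ++ [x]) := by
      intro l₁ a l₂ ha
      refine hg l₁ a (l₂ ++ l.drop (k + 1)) ?_
      calc l = (l.take k ++ [x]) ++ l.drop (k + 1) := by simpa using hsplit
        _ = _ := by rw [ha]; simp
    have hmem : p x ∈ l.take k ++ [x] := by
      refine hg'.closed hrk (fun a ha => ?_) x (by simp) hx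
      have hk0 : 0 < k := pos_pos_of_ne (root := root) (by simp [root]) hx
      cases hl0 : l with
      | nil => simp [hl0] at hlen; omega
      | cons b l' =>
        obtain ⟨k', hk'⟩ := Nat.exists_eq_succ_of_ne_zero hk0.ne'
        rw [hl0, hk'] at ha
        simp only [Nat.succ_eq_add_one, List.take_succ_cons, List.cons_append, List.head?_cons,
          Option.mem_some_iff] at ha
        rw [← ha]
        simp [root, e, f, hl0]
    rw [List.mem_append, List.mem_singleton] at hmem
    rcases hmem with hmem | hmem
    · show (e.symm (p x) : ℕ) < k
      obtain ⟨i, hi, hix⟩ := List.mem_iff_getElem.1 hmem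
      rw [List.getElem_take] at hix
      have h2 := List.getElem?_eq_some_iff.1 (hget (p x))
      obtain ⟨h3, h4⟩ := h2
      have h5 := hnd.getElem_inj_iff.1 (h4.trans hix.symm)
      rw [List.length_take] at hi
      rw [h5]
      omega
    · have := hrk x hx
      rw [hmem] at this
      exact absurd this (lt_irrefl _)
  · intro x hx
    have h : (H.upSep e.symm x).sup (H.firstPos e.symm) < m := by
      rw [Finset.sup_lt_iff hm]
      exact fun v hv => (mem_upSep.1 hv).2.trans (e.symm x).2
    simp only [parent, dif_pos h, Equiv.symm_apply_apply]

end MaximumCardinality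

/-! ### Pre-order numbers from subtree sizes -/

section Preorder

variable {m : ℕ} {r : Fin m} {p : Fin m → Fin m} {pos : Equiv.Perm (Fin m)}

open Classical in
/-- The number of descendants of `x`, including `x`. -/
noncomputable def descCard (r : Fin m) (p : Fin m → Fin m) (x : Fin m) : ℕ :=
  (univ.filter fun y => Desc r p x y).card

open Classical in
/-- The total size of the subtrees of the siblings of `x` that come before `x`. -/
noncomputable def siblingOffset (r : Fin m) (p : Fin m → Fin m) (pos : Equiv.Perm (Fin m))
    (x : Fin m) : ℕ :=
  ∑ z ∈ univ.filter fun z => z ≠ r ∧ p z = p x ∧ pos z < pos x, descCard r p z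

open Classical in
/-- The number of a node in the pre-order that visits siblings in the order of `pos`. -/
noncomputable def preNum (r : Fin m) (p : Fin m → Fin m) (pos : Equiv.Perm (Fin m))
    (x : Fin m) : ℕ :=
  ∑ a ∈ univ.filter fun a => a ≠ r ∧ Desc r p a x, (1 + siblingOffset r p pos a)

theorem descCard_pos (x : Fin m) : 0 < descCard r p x := by
  classical
  exact card_pos.2 ⟨x, mem_filter.2 ⟨mem_univ _, .refl⟩⟩

theorem Desc.exists_child {x y : Fin m} (h : Desc r p x y) (hne : y ≠ x) :
    ∃ z, z ≠ r ∧ p z = x ∧ Desc r p z y := by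
  induction h with
  | refl => exact absurd rfl hne
  | @step y hy _ ih =>
    by_cases hpy : p y = x
    · exact ⟨y, hy, hpy, .refl⟩
    · obtain ⟨z, h1, h2, h3⟩ := ih hpy
      exact ⟨z, h1, h2, .step hy h3⟩

theorem preNum_root : preNum r p pos r = 0 := by
  classical
  rw [preNum, filter_eq_empty_iff.2, sum_empty]
  exact fun a _ h => h.1 h.2.eq_of_root

/-- The subtree of `x` is one of the blocks counted in the offset of a later sibling. -/
theorem siblingOffset_add_le_of_lt {x y : Fin m} (hx : x ≠ r) (he : p x = p y)
    (hlt : pos x < pos y) :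
    siblingOffset r p pos x + descCard r p x ≤ siblingOffset r p pos y := by
  classical
  rw [siblingOffset, siblingOffset, add_comm,
    ← sum_insert (f := fun z => descCard r p z) (by simp)]
  refine sum_le_sum_of_subset fun z => ?_
  simp only [mem_insert, mem_filter, mem_univ, true_and]
  rintro (rfl | h)
  exacts [⟨hx, he, hlt⟩, ⟨h.1, h.2.1.trans he, h.2.2.trans hlt⟩]

section

variable (hrk : RankDecreases r p fun x => (pos x : ℕ))
include hrk

theorem Desc.eq_of_siblings {z z' : Fin m} (h : Desc r p z z') (hz : z ≠ r) (he : p z = p z') :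
    z = z' := by
  rcases h.eq_or with rfl | ⟨_, h⟩
  · rfl
  · rw [← he] at h
    exact absurd h (not_desc_parent hrk hz)

-- Subtrees of distinct children are disjoint: if they met, one child would be a descendant of its
-- sibling.
open Classical in
theorem descCard_eq (x : Fin m) :
    descCard r p x = 1 + ∑ z ∈ univ.filter fun z => z ≠ r ∧ p z = x, descCard r p z := by
  have h1 : (univ.filter fun y => Desc r p x y) = insert x
      ((univ.filter fun z => z ≠ r ∧ p z = x).biUnion fun z => univ.filter fun y => Desc r p z y) := by
    ext y
    simp only [mem_filter, mem_univ, true_and, mem_insert, mem_biUnion]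
    constructor
    · intro h
      by_cases hne : y = x
      · exact .inl hne
      · obtain ⟨z, h1, h2, h3⟩ := h.exists_child hne
        exact .inr ⟨z, ⟨h1, h2⟩, h3⟩
    · rintro (rfl | ⟨z, ⟨h1, rfl⟩, h3⟩)
      · exact .refl
      · exact (Desc.parent h1).trans h3
  rw [descCard, h1, card_insert_of_notMem, card_biUnion, add_comm]
  · rfl
  · intro z hz z' hz' hne
    rw [Function.onFun, disjoint_left]
    intro y hy hy'
    simp only [mem_coe, mem_filter, mem_univ, true_and] at hz hz' hy hy'
    rcases hy.total hy' with h | h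
    · exact hne (h.eq_of_siblings hrk hz.1 (hz.2.trans hz'.2.symm))
    · exact hne (h.eq_of_siblings hrk hz'.1 (hz'.2.trans hz.2.symm)).symm
  · simp only [mem_biUnion, mem_filter, mem_univ, true_and, not_exists, not_and, and_imp]
    rintro z hz rfl
    exact not_desc_parent hrk hz

theorem preNum_eq {x : Fin m} (hx : x ≠ r) :
    preNum r p pos x = preNum r p pos (p x) + 1 + siblingOffset r p pos x := by
  classical
  have h1 : (univ.filter fun a => a ≠ r ∧ Desc r p a x) =
      insert x (univ.filter fun a => a ≠ r ∧ Desc r p a (p x)) := by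
    ext a
    simp only [mem_filter, mem_univ, true_and, mem_insert]
    constructor
    · rintro ⟨h, h'⟩
      rcases h'.eq_or with rfl | ⟨_, h'⟩
      exacts [.inl rfl, .inr ⟨h, h'⟩]
    · rintro (rfl | ⟨h, h'⟩)
      exacts [⟨hx, .refl⟩, ⟨h, .step hx h'⟩]
  rw [preNum, h1, sum_insert, ← preNum]
  · omega
  · rw [mem_filter]
    exact fun h => not_desc_parent hrk hx h.2.2

theorem siblingOffset_add_le {x : Fin m} (hx : x ≠ r) :
    siblingOffset r p pos x + descCard r p x + 1 ≤ descCard r p (p x) := by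
  classical
  rw [descCard_eq hrk (p x), siblingOffset, add_comm 1, add_le_add_iff_right, add_comm,
    ← sum_insert (f := fun z => descCard r p z) (by simp)]
  refine sum_le_sum_of_subset fun z => ?_
  simp only [mem_insert, mem_filter, mem_univ, true_and]
  rintro (rfl | h)
  exacts [⟨hx, rfl⟩, ⟨h.1, h.2.1⟩]

/-- Each node owns the interval that starts at its number and has the length of its subtree;
intervals of descendants are nested. -/
theorem Desc.preNum_nested {x y : Fin m} (h : Desc r p x y) :
    preNum r p pos x ≤ preNum r p pos y ∧ (y ≠ x → preNum r p pos x < preNum r p pos y) ∧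
      preNum r p pos y + descCard r p y ≤ preNum r p pos x + descCard r p x := by
  induction h with
  | refl => exact ⟨le_rfl, fun h => absurd rfl h, le_rfl⟩
  | @step y hy _ ih =>
    have h1 := preNum_eq hrk hy
    have h2 := siblingOffset_add_le hrk hy
    have h3 := ih.1
    have h4 := ih.2.2
    refine ⟨by omega, fun _ => by omega, by omega⟩

/-- Climb from `x` until the parent is an ancestor of `y`. Then `y` lies below a sibling of the node
reached, and intervals of siblings are disjoint by the choice of the offsets. -/
theorem preNum_disjoint (x y : Fin m) : ¬ Desc r p x y → ¬ Desc r p y x →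
    preNum r p pos x + descCard r p x ≤ preNum r p pos y ∨
      preNum r p pos y + descCard r p y ≤ preNum r p pos x := by
  refine rank_induction hrk (P := fun x => ¬ Desc r p x y → ¬ Desc r p y x →
    preNum r p pos x + descCard r p x ≤ preNum r p pos y ∨
      preNum r p pos y + descCard r p y ≤ preNum r p pos x)
    (fun h => absurd (Desc.root hrk y) h) (fun x hx ih h h' => ?_) x
  by_cases hd : Desc r p (p x) y
  · have hne : y ≠ p x := by
      rintro rfl
      exact h' (.parent hx)
    obtain ⟨z, hz, hzx, hzy⟩ := hd.exists_child hne
    have h1 := hzy.preNum_nested hrk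
    have h2 := preNum_eq hrk hz
    have h3 := preNum_eq hrk hx
    have hzne : z ≠ x := by rintro rfl; exact h hzy
    rw [hzx] at h2
    rcases lt_or_gt_of_ne (pos.injective.ne hzne) with hlt | hlt
    · have := siblingOffset_add_le_of_lt hz hzx hlt
      right; omega
    · have := siblingOffset_add_le_of_lt hx hzx.symm hlt
      left; omega
  · have h1 := (Desc.parent (p := p) hx).preNum_nested hrk
    rcases ih hd (fun h2 => h' (.step hx h2)) with h2 | h2
    · left; omega
    · right; omega

/-- Descent can be read off the numbers. -/
theorem desc_iff_preNum (x y : Fin m) : Desc r p x y ↔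
    preNum r p pos x ≤ preNum r p pos y ∧ preNum r p pos y < preNum r p pos x + descCard r p x := by
  have hy := descCard_pos (r := r) (p := p) y
  have hx := descCard_pos (r := r) (p := p) x
  constructor
  · intro h
    have := h.preNum_nested hrk
    omega
  · rintro ⟨h1, h2⟩
    by_contra hd
    by_cases hd' : Desc r p y x
    · by_cases hne : x = y
      · exact hd (hne ▸ .refl)
      · have := (hd'.preNum_nested hrk).2.1 hne
        omega
    · have := preNum_disjoint hrk x y hd hd'
      omega

theorem preNum_lt (x : Fin m) : preNum r p pos x < m := by
  classical
  have h1 := ((Desc.root hrk x).preNum_nested hrk).2.2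
  have h2 : descCard r p r = m := by
    rw [descCard, filter_true_of_mem fun y _ => Desc.root hrk y, card_univ, Fintype.card_fin]
  have h3 := descCard_pos (r := r) (p := p) x
  rw [preNum_root] at h1
  omega

theorem preNum_injective : Function.Injective (preNum r p pos) := by
  intro x y h
  have hd := (desc_iff_preNum hrk x y).2 ⟨h.le, by
    have := descCard_pos (r := r) (p := p) x; omega⟩
  by_contra hne
  have := (hd.preNum_nested hrk).2.1 (Ne.symm hne)
  omega

/-- Membership in a subtree is membership in an interval, which is just the consecutiveness that a
pre-order requires. -/
theorem exists_isPreorder : ∃ pre : Equiv.Perm (Fin m),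
    IsPreorder (parentGraph r p) r pre ∧ RankDecreases r p fun x => (pre x : ℕ) := by
  let f : Fin m → Fin m := fun x => ⟨preNum r p pos x, preNum_lt hrk x⟩
  have hf : Function.Injective f := fun x y h => preNum_injective hrk (Fin.mk.inj_iff.1 h)
  refine ⟨Equiv.ofBijective f (Finite.injective_iff_bijective.1 hf), ⟨fun x y h => ?_,
    fun x y z hxy hyz h => ?_⟩, fun x hx => ?_⟩
  · rw [isAncestor_iff_desc hrk] at h
    exact Fin.mk_le_mk.2 (h.preNum_nested hrk).1
  · rw [isAncestor_iff_desc hrk, desc_iff_preNum hrk] at h ⊢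
    exact ⟨Fin.mk_le_mk.1 hxy, lt_of_le_of_lt (Fin.mk_le_mk.1 hyz) h.2⟩
  · have := preNum_eq hrk hx
    show preNum r p pos (p x) < preNum r p pos x
    omega

end

end Preorder

/-! ### Independence of the result from the numbering -/

section

variable {n m : ℕ} {H : HGraph n m} {root : Fin m} {pos pos' : Equiv.Perm (Fin m)}
  {parent : Fin m → Fin m}

/-- Any other numbering that is compatible with the tree leads to the same tree. -/
theorem HGraph.IsRun.upSep_eq_and_pos_parent (hR : H.IsRun root pos parent)
    (hrk : RankDecreases root parent fun x => (pos' x : ℕ)) :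
    (∀ x, H.upSep pos' x = H.upSep pos x) ∧
      ∀ x, x ≠ root → (pos' (parent x) : ℕ) = (H.upSep pos' x).sup (H.firstPos pos') := by
  have top := fun {v x t} => desc_of_firstPos (v := v) (x := x) (t := t) hR.isJoinTree hR.rank
  have first : ∀ {v t}, v ∈ H.edge t → H.firstPos pos v = pos t → H.firstPos pos' v = pos' t := by
    intro v t ht he
    refine le_antisymm (H.firstPos_le ht) ?_
    obtain ⟨y, hy, e⟩ := H.exists_firstPos (pos := pos') ht
    rw [e]
    exact (top hy ht he).rank_le hrk
  have hup : ∀ x, H.upSep pos' x = H.upSep pos x := by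
    intro x
    ext v
    rw [mem_upSep, mem_upSep]
    refine and_congr_right fun hv => ?_
    obtain ⟨t, ht, e⟩ := H.exists_firstPos (pos := pos) hv
    rw [e, first ht e]
    rcases (top hv ht e).eq_or_lt hR.rank with rfl | h
    · simp
    · refine iff_of_true ?_ h
      refine ((top hv ht e).eq_or_lt hrk).resolve_left ?_
      rintro rfl
      exact lt_irrefl _ h
  refine ⟨hup, fun x hx => ?_⟩
  rw [hup]
  refine le_antisymm ?_ (Finset.sup_le fun v hv => H.firstPos_le (hR.upSep_subset x hx hv))
  -- For an empty separator the supremum is `0`, so the parent is the root, which has position `0`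
  -- in both numberings.
  rcases (H.upSep pos x).eq_empty_or_nonempty with he | he
  · have h1 := hR.pos_parent x hx
    rw [he, sup_empty, Nat.bot_eq_zero, ← hR.pos_root, perm_val_inj] at h1
    rw [he, sup_empty, h1]
    have h := (Desc.root hrk (pos'.symm ⟨0, root.pos⟩)).rank_le hrk
    simpa using h
  · obtain ⟨v, hv, hs⟩ := exists_mem_eq_sup _ he (H.firstPos pos)
    rw [← first (hR.upSep_subset x hx hv) (by rw [hR.pos_parent x hx, hs])]
    exact le_sup (f := H.firstPos pos') hv

/-- A search order need not be a pre-order of its tree. But the tree it yields, taken as input with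
one of its own pre-orders, is reproduced by Algorithm 1 with the same separators. -/
theorem HGraph.IsRun.exists_treeRun (hR : H.IsRun root pos parent) : ∃ R : TreeRun H,
    R.root = root ∧ R.parent = parent ∧ ∀ c, R.up c = H.upSep pos c := by
  obtain ⟨pre, hpre, hrk⟩ := exists_isPreorder hR.rank
  obtain ⟨h1, h2⟩ := hR.upSep_eq_and_pos_parent hrk
  exact ⟨⟨parentGraph root parent, hR.isJoinTree, root, pre, hpre, parent, h2⟩, rfl, rfl, h1⟩

end

/-! ### A program logic with running times -/

section Programs

/-- Assignment to a register. -/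
def Mem.setReg (s : Mem) (r v : ℕ) : Mem := { s with reg := Function.update s.reg r v }

/-- Assignment to an array entry. -/
def Mem.setArr (s : Mem) (a i v : ℕ) : Mem :=
  { s with arr := Function.update s.arr a (Function.update (s.arr a) i v) }

section

variable (s : Mem) (r r' a a' i v : ℕ)

@[simp] theorem Mem.setReg_reg : (s.setReg r v).reg r' = if r' = r then v else s.reg r' :=
  Function.update_apply ..

@[simp] theorem Mem.setReg_arr : (s.setReg r v).arr = s.arr := rfl

@[simp] theorem Mem.setReg_queries : (s.setReg r v).queries = s.queries := rfl

@[simp] theorem Mem.setArr_reg : (s.setArr a i v).reg = s.reg := rfl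

@[simp] theorem Mem.setArr_arr :
    (s.setArr a i v).arr a' = if a' = a then Function.update (s.arr a) i v else s.arr a' :=
  Function.update_apply ..

@[simp] theorem Mem.setArr_queries : (s.setArr a i v).queries = s.queries := rfl

end

/-- `Wp A p Q t s`: the program `p`, started in `s` at time `t`, halts at a time and in a memory that
satisfy `Q`. -/
def Wp (A : SubsetAlg) (p : Prog) (Q : ℕ → Mem → Prop) (t : ℕ) (s : Mem) : Prop :=
  ∃ k s', Exec A p s k s' ∧ Q (t + k) s'

variable {A : SubsetAlg} {p q : Prog} {Q Q' : ℕ → Mem → Prop} {t : ℕ} {s : Mem} {b : Test}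

theorem wp_instr {i : Instr} (h : Q (t + 1) (i.run s)) : Wp A (.instr i) Q t s :=
  ⟨1, _, .instr i s, h⟩

theorem wp_instr_iff {i : Instr} : Wp A (.instr i) Q t s ↔ Q (t + 1) (i.run s) := by
  refine ⟨?_, wp_instr⟩
  rintro ⟨k, s', h, hQ⟩
  cases h
  exact hQ

@[simp] theorem Instr.run_const {r k : ℕ} : (const r k).run s = s.setReg r k := rfl

@[simp] theorem Instr.run_move {r x : ℕ} : (move r x).run s = s.setReg r (s.reg x) := rfl

@[simp] theorem Instr.run_add {r x y : ℕ} :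
    (add r x y).run s = s.setReg r (s.reg x + s.reg y) := rfl

@[simp] theorem Instr.run_sub {r x y : ℕ} :
    (sub r x y).run s = s.setReg r (s.reg x - s.reg y) := rfl

@[simp] theorem Instr.run_load {r a x : ℕ} :
    (load r a x).run s = s.setReg r (s.arr a (s.reg x)) := rfl

@[simp] theorem Instr.run_store {r a x : ℕ} :
    (store a x r).run s = s.setArr a (s.reg x) (s.reg r) := rfl

@[simp] theorem wp_skip : Wp A .skip Q t s ↔ Q (t + 1) s := by
  refine ⟨?_, fun h => ⟨1, s, .skip s, h⟩⟩
  rintro ⟨k, s', h, hQ⟩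
  cases h
  exact hQ

@[simp] theorem wp_seq : Wp A (.seq p q) Q t s ↔ Wp A p (fun t s => Wp A q Q t s) t s := by
  constructor
  · rintro ⟨k, s', h, hQ⟩
    cases h with
    | seq h₁ h₂ => exact ⟨_, _, h₁, _, _, h₂, by rwa [add_assoc]⟩
  · rintro ⟨k₁, s₁, h₁, k₂, s₂, h₂, hQ⟩
    exact ⟨_, _, .seq h₁ h₂, by rwa [← add_assoc]⟩

@[simp] theorem wp_ite : Wp A (.ite b p q) Q t s ↔
    (b.Holds s → Wp A p Q (t + 1) s) ∧ (¬ b.Holds s → Wp A q Q (t + 1) s) := by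
  constructor
  · rintro ⟨k, s', h, hQ⟩
    cases h with
    | @iteTrue _ _ _ _ t' _ hb h =>
      exact ⟨fun _ => ⟨t', s', h, by rwa [add_assoc, add_comm 1]⟩, fun hn => absurd hb hn⟩
    | @iteFalse _ _ _ _ t' _ hb h =>
      exact ⟨fun hn => absurd hn hb, fun _ => ⟨t', s', h, by rwa [add_assoc, add_comm 1]⟩⟩
  · rintro ⟨h₁, h₂⟩
    by_cases hb : b.Holds s
    · obtain ⟨k, s', h, hQ⟩ := h₁ hb
      exact ⟨k + 1, s', .iteTrue hb h, by rwa [add_comm k, ← add_assoc]⟩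
    · obtain ⟨k, s', h, hQ⟩ := h₂ hb
      exact ⟨k + 1, s', .iteFalse hb h, by rwa [add_comm k, ← add_assoc]⟩

@[simp] theorem Test.holds_lt {x y : ℕ} : (Test.lt x y).Holds s ↔ s.reg x < s.reg y := Iff.rfl

@[simp] theorem Test.holds_eq {x y : ℕ} : (Test.eq x y).Holds s ↔ s.reg x = s.reg y := Iff.rfl

/-- A list of elementary instructions, followed by a program. -/
def block (l : List Instr) (p : Prog) : Prog := l.foldr (fun i p => .seq (.instr i) p) p

@[simp] theorem wp_block_nil : Wp A (block [] p) Q t s ↔ Wp A p Q t s := Iff.rfl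

@[simp] theorem wp_block_cons {i : Instr} {l : List Instr} :
    Wp A (block (i :: l) p) Q t s ↔ Wp A (block l p) Q (t + 1) (i.run s) := by
  rw [block, List.foldr_cons, wp_seq, wp_instr_iff]
  rfl

theorem Wp.mono (h : Wp A p Q t s) (hQ : ∀ t' s', Q t' s' → Q' t' s') : Wp A p Q' t s := by
  obtain ⟨k, s', h, h'⟩ := h
  exact ⟨k, s', h, hQ _ _ h'⟩

/-- The registers that a program may change. -/
def Prog.regs : Prog → List ℕ
  | skip => []
  | instr (.const r _) => [r]
  | instr (.move r _) => [r]
  | instr (.add r _ _) => [r]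
  | instr (.sub r _ _) => [r]
  | instr (.load r _ _) => [r]
  | instr (.store _ _ _) => []
  | seq p q => p.regs ++ q.regs
  | ite _ p q => p.regs ++ q.regs
  | loop _ p => p.regs
  | call _ _ _ _ _ l' _ _ => [l']

/-- The arrays that a program may change. -/
def Prog.arrs : Prog → List ℕ
  | skip => []
  | instr (.store a _ _) => [a]
  | instr _ => []
  | seq p q => p.arrs ++ q.arrs
  | ite _ p q => p.arrs ++ q.arrs
  | loop _ p => p.arrs
  | call _ _ _ _ _ _ a' b' => [a', b']

def Prog.callFree : Prog → Bool
  | skip => true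
  | instr _ => true
  | seq p q => p.callFree && q.callFree
  | ite _ p q => p.callFree && q.callFree
  | loop _ p => p.callFree
  | call _ _ _ _ _ _ _ _ => false

/-- The memories agree apart from what `p` may change. -/
structure Same (p : Prog) (s s' : Mem) : Prop where
  reg : ∀ r, r ∉ p.regs → s'.reg r = s.reg r
  arr : ∀ a, a ∉ p.arrs → s'.arr a = s.arr a
  queries : p.callFree = true → s'.queries = s.queries

theorem Same.refl (p : Prog) (s : Mem) : Same p s s := ⟨fun _ _ => rfl, fun _ _ => rfl, fun _ => rfl⟩

theorem Same.trans {s₁ s₂ s₃ : Mem} (h : Same p s₁ s₂) (h' : Same p s₂ s₃) : Same p s₁ s₃ :=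
  ⟨fun r hr => (h'.reg r hr).trans (h.reg r hr), fun a ha => (h'.arr a ha).trans (h.arr a ha),
    fun hc => (h'.queries hc).trans (h.queries hc)⟩

theorem Same.weaken {s s' : Mem} (h : Same p s s') (hr : p.regs ⊆ q.regs) (ha : p.arrs ⊆ q.arrs)
    (hq : q.callFree = true → p.callFree = true) : Same q s s' :=
  ⟨fun r h' => h.reg r fun h'' => h' (hr h''), fun a h' => h.arr a fun h'' => h' (ha h''),
    fun h' => h.queries (hq h')⟩

/-- The frame rule. Whether a register or an array is untouched can be read off the program, so such
facts are settled by `decide`. -/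
theorem Exec.same {k : ℕ} {s' : Mem} (h : Exec A p s k s') : Same p s s' := by
  induction h with
  | skip s => exact .refl _ _
  | instr i s =>
    cases i <;>
    exact ⟨fun r hr => by simp_all [Prog.regs, Instr.run],
      fun a ha => by simp_all [Prog.arrs, Instr.run], fun _ => rfl⟩
  | seq _ _ ih₁ ih₂ =>
    refine (ih₁.weaken ?_ ?_ ?_).trans (ih₂.weaken ?_ ?_ ?_) <;>
    simp +contextual [Prog.regs, Prog.arrs, Prog.callFree]
  | iteTrue _ _ ih =>
    refine ih.weaken ?_ ?_ ?_ <;>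
    simp +contextual [Prog.regs, Prog.arrs, Prog.callFree]
  | iteFalse _ _ ih =>
    refine ih.weaken ?_ ?_ ?_ <;>
    simp +contextual [Prog.regs, Prog.arrs, Prog.callFree]
  | loopDone _ => exact .refl _ _
  | @loopStep b p _ _ _ _ _ _ _ _ ih₁ ih₂ =>
    exact (ih₁.weaken (q := .loop b p) (List.Subset.refl _) (List.Subset.refl _) id).trans ih₂
  | call v k l a b l' a' b' s =>
    refine ⟨fun r hr => ?_, fun c hc => ?_, fun h => by simp [Prog.callFree] at h⟩
    · simp only [Prog.regs, List.mem_singleton] at hr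
      simp [Mem.putPairs, hr]
    · simp only [Prog.arrs, List.mem_cons, List.not_mem_nil, or_false, not_or] at hc
      simp [Mem.putPairs, hc.1, hc.2]

theorem Wp.same (h : Wp A p Q t s) : Wp A p (fun t' s' => Q t' s' ∧ Same p s s') t s := by
  obtain ⟨k, s', h, hQ⟩ := h
  exact ⟨k, s', h, hQ, h.same⟩

/-- Loops with an invariant that bounds the time. -/
theorem wp_loop (Inv : ℕ → Mem → Prop) (B : ℕ) (h : Inv t s) (hB : ∀ t' s', Inv t' s' → t' ≤ B)
    (step : ∀ t' s', Inv t' s' → Same p s s' → b.Holds s' → Wp A p Inv (t' + 1) s')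
    (post : ∀ t' s', Inv t' s' → Same p s s' → ¬ b.Holds s' → Q (t' + 1) s') :
    Wp A (.loop b p) Q t s := by
  -- Induction on the remaining time: every iteration spends at least the step of its test, so the
  -- bound `B` also proves termination.
  have key : ∀ d t' s', B - t' ≤ d → Inv t' s' → Same p s s' → Wp A (.loop b p) Q t' s' := by
    intro d
    induction d with
    | zero =>
      intro t' s' hd h hs
      by_cases hb : b.Holds s'
      · obtain ⟨k, s₁, _, h₁⟩ := step t' s' h hs hb
        have := hB _ _ h₁
        omega
      · exact ⟨1, s', .loopDone hb, post t' s' h hs hb⟩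
    | succ d ih =>
      intro t' s' hd h hs
      by_cases hb : b.Holds s'
      · obtain ⟨k, s₁, e₁, h₁⟩ := step t' s' h hs hb
        obtain ⟨k₂, s₂, e₂, h₂⟩ := ih (t' + 1 + k) s₁ (by omega) h₁ (hs.trans e₁.same)
        refine ⟨k + k₂ + 1, s₂, .loopStep hb e₁ e₂, ?_⟩
        have e : t' + (k + k₂ + 1) = t' + 1 + k + k₂ := by omega
        rwa [e]
      · exact ⟨1, s', .loopDone hb, post t' s' h hs hb⟩
  exact key _ t s le_rfl h (.refl _ _)

/-- The loop `while reg i < reg n do body; reg i := reg i + 1`; the register `4` holds `1`. -/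
def forUp (i n : ℕ) (body : Prog) : Prog := .loop (.lt i n) (.seq body (.instr (.add i i 4)))

/-- The clock is advanced by one for the test before the body and by one for the increment after it,
so `step` accounts for a whole iteration; `post` adds the last, failing test. -/
theorem wp_forUp {i n k₀ N : ℕ} {body : Prog} (Inv : ℕ → ℕ → Mem → Prop)
    (hreg : i ∉ body.regs ∧ n ∉ body.regs ∧ 4 ∉ body.regs ∧ i ≠ n ∧ i ≠ 4)
    (hn : s.reg n = N) (h4 : s.reg 4 = 1) (hi : s.reg i = k₀) (hk : k₀ ≤ N) (h0 : Inv k₀ t s)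
    (step : ∀ k t' s', k₀ ≤ k → k < N → s'.reg i = k → Same (forUp i n body) s s' → Inv k t' s' →
      Wp A body (fun t'' s'' => Inv (k + 1) (t'' + 1) (s''.setReg i (k + 1))) (t' + 1) s')
    (post : ∀ t' s', s'.reg i = N → Same (forUp i n body) s s' → Inv N t' s' → Q (t' + 1) s') :
    Wp A (forUp i n body) Q t s := by
  obtain ⟨h₁, h₂, h₃, h₄, h₅⟩ := hreg
  have key : ∀ d k t' s', N - k = d → k₀ ≤ k → k ≤ N → s'.reg i = k → Inv k t' s' →
      Same (forUp i n body) s s' → Wp A (forUp i n body) Q t' s' := by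
    intro d
    induction d with
    | zero =>
      intro k t' s' hd hk0 hkN hik hinv hs
      obtain rfl : k = N := by omega
      have hnn : s'.reg n = k := by
        rw [hs.reg n (by simp [forUp, Prog.regs, h₂, Ne.symm h₄]), hn]
      exact ⟨1, s', .loopDone (by simp [hik, hnn]), post t' s' hik hs hinv⟩
    | succ d ih =>
      intro k t' s' hd hk0 hkN hik hinv hs
      have hnn : s'.reg n = N := by
        rw [hs.reg n (by simp [forUp, Prog.regs, h₂, Ne.symm h₄]), hn]
      have h44 : s'.reg 4 = 1 := by
        rw [hs.reg 4 (by simp [forUp, Prog.regs, h₃, Ne.symm h₅]), h4]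
      have hb : (Test.lt i n).Holds s' := by
        rw [Test.holds_lt, hik, hnn]
        omega
      obtain ⟨c, s₁, e₁, inv₁⟩ := step k t' s' hk0 (by omega) hik hs hinv
      have hi1 : s₁.reg i = k := by rw [e₁.same.reg i h₁, hik]
      have h41 : s₁.reg 4 = 1 := by rw [e₁.same.reg 4 h₃, h44]
      have e₂ : Exec A (.seq body (.instr (.add i i 4))) s' (c + 1) (s₁.setReg i (k + 1)) := by
        refine .seq e₁ ?_
        have := Exec.instr (A := A) (.add i i 4) s₁
        rwa [Instr.run, hi1, h41] at this
      obtain ⟨c', s₂, e₃, hQ⟩ := ih (k + 1) (t' + 1 + c + 1) (s₁.setReg i (k + 1)) (by omega)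
        (by omega) (by omega) (by simp) inv₁ (hs.trans (e₂.same.weaken (List.Subset.refl _)
          (List.Subset.refl _) id))
      refine ⟨c + 1 + c' + 1, s₂, .loopStep hb e₂ e₃, ?_⟩
      have e : t' + (c + 1 + c' + 1) = t' + 1 + c + 1 + c' := by omega
      rwa [e]
  exact key _ k₀ t s rfl le_rfl hk hi h0 (.refl _ _)

end Programs

/-! ### Tables of lists in arrays -/

section Tables

/-- The arrays `cnt` and `dat` hold a table of lists: the list of `v` has length `cnt v` and occupies
the cells of `dat` from `v * K` on. -/
structure IsTable {ι α : Type*} (K : ℕ) (f : ι → ℕ) (g : α → ℕ) (cnt dat : ℕ → ℕ)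
    (tab : ι → List α) : Prop where
  cnt_eq : ∀ v, cnt (f v) = (tab v).length
  dat_eq : ∀ v i x, (tab v)[i]? = some x → dat (f v * K + i) = g x
  length_le : ∀ v, (tab v).length ≤ K

theorem mul_add_inj {K a b i j : ℕ} (hi : i < K) (hj : j < K) (h : a * K + i = b * K + j) :
    a = b ∧ i = j := by
  have h1 : (a * K + i) / K = a := by
    rw [mul_comm, Nat.mul_add_div (by omega), Nat.div_eq_of_lt hi, add_zero]
  have h2 : (b * K + j) / K = b := by
    rw [mul_comm, Nat.mul_add_div (by omega), Nat.div_eq_of_lt hj, add_zero]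
  have h3 : a = b := by rw [← h1, h, h2]
  subst h3
  exact ⟨rfl, by omega⟩

variable {ι α : Type*} {K : ℕ} {f : ι → ℕ} {g : α → ℕ} {cnt dat : ℕ → ℕ}
  {tab : ι → List α}

theorem IsTable.empty (h : ∀ v, cnt (f v) = 0) : IsTable K f g cnt dat fun _ => ([] : List α) :=
  ⟨fun v => by simp [h], fun v i x hx => by simp at hx, fun v => by simp⟩

theorem IsTable.get (h : IsTable K f g cnt dat tab) {v : ι} {i : ℕ} (hi : i < (tab v).length) :
    dat (f v * K + i) = g (tab v)[i] := h.dat_eq v i _ (List.getElem?_eq_getElem hi)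

variable [DecidableEq ι]

theorem IsTable.push (h : IsTable K f g cnt dat tab) (hf : Function.Injective f) {v : ι} {x : α}
    (hlen : (tab v).length < K) :
    IsTable K f g (Function.update cnt (f v) ((tab v).length + 1))
      (Function.update dat (f v * K + (tab v).length) (g x))
      (Function.update tab v (tab v ++ [x])) := by
  refine ⟨fun w => ?_, fun w i y hy => ?_, fun w => ?_⟩
  · by_cases hw : w = v
    · subst hw; simp
    · rw [Function.update_of_ne hw, Function.update_of_ne (hf.ne hw), h.cnt_eq]
  · by_cases hw : w = v
    · subst hw
      rw [Function.update_self] at hy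
      by_cases hi : i < (tab w).length
      · rw [List.getElem?_append_left hi] at hy
        rw [Function.update_of_ne (by omega)]
        exact h.dat_eq w i y hy
      · rw [List.getElem?_append_right (not_lt.1 hi)] at hy
        obtain ⟨h1, h2⟩ := List.getElem?_eq_some_iff.1 hy
        simp only [List.length_singleton, Nat.lt_one_iff] at h1
        have : i = (tab w).length := by omega
        subst this
        simp only [Nat.sub_self, List.getElem_cons_zero] at h2
        rw [Function.update_self, h2]
    · rw [Function.update_of_ne hw] at hy
      have hi := (List.getElem?_eq_some_iff.1 hy).1
      -- Rows have width `K` and are never longer, so different rows share no cell.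
      have hne : f w * K + i ≠ f v * K + (tab v).length := fun he =>
        hw (hf (mul_add_inj (hi.trans_le (h.length_le w)) hlen he).1)
      rw [Function.update_of_ne hne]
      exact h.dat_eq w i y hy
  · by_cases hw : w = v
    · subst hw; simp; omega
    · rw [Function.update_of_ne hw]
      exact h.length_le w

/-- Only the count is lowered; the old cell may keep its content, which is the value returned. -/
theorem IsTable.pop (h : IsTable K f g cnt dat tab) (hf : Function.Injective f) {v : ι} {l : List α}
    {x : α} (hv : tab v = l ++ [x]) :
    IsTable K f g (Function.update cnt (f v) l.length) dat (Function.update tab v l) ∧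
      dat (f v * K + l.length) = g x := by
  refine ⟨⟨fun w => ?_, fun w i y hy => ?_, fun w => ?_⟩, h.dat_eq v _ x (by simp [hv])⟩
  · by_cases hw : w = v
    · subst hw; simp
    · rw [Function.update_of_ne hw, Function.update_of_ne (hf.ne hw), h.cnt_eq]
  · refine h.dat_eq w i y ?_
    by_cases hw : w = v
    · subst hw
      rw [Function.update_self] at hy
      rw [hv, List.getElem?_append_left (List.getElem?_eq_some_iff.1 hy).1, hy]
    · rwa [Function.update_of_ne hw] at hy
  · by_cases hw : w = v
    · subst hw
      have := h.length_le w
      simp [hv] at this ⊢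
      omega
    · rw [Function.update_of_ne hw]
      exact h.length_le w

end Tables

/-! ### Constants and adjacency tables -/

section Setup

/-- The code that appends the number in register `x` to the list with number `reg v` of the table in the
arrays `c` and `a`. -/
def pushCode (c a v x : ℕ) : List Instr :=
  [.load 6 5 v, .load 7 c v, .add 6 6 7, .store a 6 x, .add 7 7 4, .store c v 7]

/-- The constants that the program keeps in registers, and the table of multiples of `K`. -/
structure HasBase (n m K : ℕ) (s : Mem) : Prop where
  reg_n : s.reg 0 = n
  reg_m : s.reg 1 = m
  reg_K : s.reg 3 = K
  reg_one : s.reg 4 = 1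
  reg_zero : s.reg 5 = 0
  row : ∀ i, i < K → s.arr 5 i = i * K

/-- The program leaves the constants alone. -/
def Prog.KeepsBase (p : Prog) : Bool :=
  [0, 1, 3, 4, 5].all (fun r => decide (r ∉ p.regs)) && decide (5 ∉ p.arrs)

theorem HasBase.of_same {n m K : ℕ} {p : Prog} {s s' : Mem} (h : HasBase n m K s)
    (hs : Same p s s') (hp : p.KeepsBase = true) : HasBase n m K s' := by
  simp only [Prog.KeepsBase, List.all_cons, List.all_nil, Bool.and_true, Bool.and_eq_true,
    decide_eq_true_eq] at hp
  obtain ⟨⟨h0, h1, h3, h4, h5⟩, h6⟩ := hp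
  exact ⟨by rw [hs.reg _ h0, h.reg_n], by rw [hs.reg _ h1, h.reg_m], by rw [hs.reg _ h3, h.reg_K],
    by rw [hs.reg _ h4, h.reg_one], by rw [hs.reg _ h5, h.reg_zero], by
      rw [hs.arr _ h6]; exact h.row⟩

theorem HasBase.setReg {n m K : ℕ} {s : Mem} (h : HasBase n m K s) (r v : ℕ)
    (hr : r ∉ [0, 1, 3, 4, 5]) : HasBase n m K (s.setReg r v) := by
  simp only [List.mem_cons, List.not_mem_nil, or_false, not_or] at hr
  obtain ⟨h0, h1, h3, h4, h5⟩ := hr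
  exact ⟨by simp [Ne.symm h0, h.reg_n], by simp [Ne.symm h1, h.reg_m], by simp [Ne.symm h3, h.reg_K],
    by simp [Ne.symm h4, h.reg_one], by simp [Ne.symm h5, h.reg_zero], h.row⟩

theorem HasBase.setArr {n m K : ℕ} {s : Mem} (h : HasBase n m K s) (a i v : ℕ)
    (ha : a ≠ 5) : HasBase n m K (s.setArr a i v) :=
  ⟨h.reg_n, h.reg_m, h.reg_K, h.reg_one, h.reg_zero, by simpa [Ne.symm ha] using h.row⟩

/-- Prepare the constants. -/
def setupProg : Prog :=
  block [.const 4 1, .const 5 0, .add 3 0 1, .add 3 3 2, .add 3 3 4, .const 8 0, .const 9 0]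
    (forUp 8 3 (block [.store 5 8 9, .add 9 9 3] .skip))

variable {A : SubsetAlg} {n m : ℕ} {t : ℕ} {s : Mem}

/-- There is no multiplication instruction, so the multiples of `K` are tabulated by repeated
addition, at five steps each. The value of `K` exceeds all vertex and hyperedge numbers and the
length of every table row used. -/
theorem wp_setupProg {len : ℕ} (h0 : s.reg 0 = n) (h1 : s.reg 1 = m) (h2 : s.reg 2 = len) :
    Wp A setupProg (fun t' s' => t' ≤ t + 5 * (n + m + len + 1) + 8 ∧
      HasBase n m (n + m + len + 1) s') t s := by
  simp only [setupProg, wp_block_cons, wp_block_nil, Instr.run_const, Instr.run_add]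
  refine wp_forUp (k₀ := 0) (N := n + m + len + 1) (fun k t' s' => t' = t + 7 + 5 * k ∧
    s'.reg 9 = k * (n + m + len + 1) ∧ ∀ i, i < k → s'.arr 5 i = i * (n + m + len + 1))
    (by decide) (by simp [h0, h1, h2]) (by simp) (by simp) (by simp) (by simp) ?_ ?_
  · rintro k t' s' - hk h8 hs ⟨ht, h9, harr⟩
    have h3 : s'.reg 3 = n + m + len + 1 := by
      rw [hs.reg 3 (by decide)]
      simp [h0, h1, h2]
    simp [h8, h9, h3, ht]
    refine ⟨by ring, by ring, fun i hi => ?_⟩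
    by_cases hik : i = k
    · subst hik; simp
    · rw [Function.update_of_ne hik]
      exact harr i (by omega)
  · rintro t' s' h8 hs ⟨ht, h9, harr⟩
    refine ⟨by omega, ?_, ?_, ?_, ?_, ?_, harr⟩
    · rw [hs.reg 0 (by decide)]; simp [h0]
    · rw [hs.reg 1 (by decide)]; simp [h1]
    · rw [hs.reg 3 (by decide)]; simp [h0, h1, h2]
    · rw [hs.reg 4 (by decide)]; simp
    · rw [hs.reg 5 (by decide)]; simp

/-- The vertices of the hyperedge `e`, in the order of the list of incidences. -/
def vertsOf (L : List (Fin n × Fin m)) (e : Fin m) : List (Fin n) :=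
  (L.filter fun q => q.2 = e).map Prod.fst

/-- The hyperedges that contain the vertex `v`, in the order of the list of incidences. -/
def edgesOf (L : List (Fin n × Fin m)) (v : Fin n) : List (Fin m) :=
  (L.filter fun q => q.1 = v).map Prod.snd

theorem vertsOf_concat (L : List (Fin n × Fin m)) (v : Fin n) (e : Fin m) :
    vertsOf (L ++ [(v, e)]) = Function.update (vertsOf L) e (vertsOf L e ++ [v]) := by
  funext x
  by_cases hx : x = e
  · subst hx; simp [vertsOf]
  · simp [vertsOf, Function.update_of_ne hx, Ne.symm hx]

theorem edgesOf_concat (L : List (Fin n × Fin m)) (v : Fin n) (e : Fin m) :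
    edgesOf (L ++ [(v, e)]) = Function.update (edgesOf L) v (edgesOf L v ++ [e]) := by
  funext x
  by_cases hx : x = v
  · subst hx; simp [edgesOf]
  · simp [edgesOf, Function.update_of_ne hx, Ne.symm hx]

theorem length_vertsOf_le (L : List (Fin n × Fin m)) (e : Fin m) :
    (vertsOf L e).length ≤ L.length := by
  rw [vertsOf, List.length_map]
  exact List.length_filter_le _ _

theorem length_edgesOf_le (L : List (Fin n × Fin m)) (v : Fin n) :
    (edgesOf L v).length ≤ L.length := by
  rw [edgesOf, List.length_map]
  exact List.length_filter_le _ _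

/-- The two adjacency tables of the incidence graph. -/
structure HasAdj (K : ℕ) (L : List (Fin n × Fin m)) (s : Mem) : Prop where
  verts : IsTable K Fin.val Fin.val (s.arr 6) (s.arr 7) (vertsOf L)
  edges : IsTable K Fin.val Fin.val (s.arr 8) (s.arr 9) (edgesOf L)

theorem HasAdj.of_same {K : ℕ} {L : List (Fin n × Fin m)} {p : Prog} {s s' : Mem}
    (h : HasAdj K L s) (hs : Same p s s') (hp : [6, 7, 8, 9].all (fun a => decide (a ∉ p.arrs))) :
    HasAdj K L s' := by
  simp only [List.all_cons, List.all_nil, Bool.and_true, Bool.and_eq_true, decide_eq_true_eq] at hp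
  obtain ⟨h6, h7, h8, h9⟩ := hp
  constructor
  · rw [hs.arr _ h6, hs.arr _ h7]; exact h.verts
  · rw [hs.arr _ h8, hs.arr _ h9]; exact h.edges

/-- Build the adjacency tables. -/
def adjProg : Prog :=
  block [.const 8 0] (forUp 8 2
    (block ([.load 9 0 8, .load 10 1 8] ++ pushCode 6 7 10 9 ++ pushCode 8 9 9 10) .skip))

/-- After `k` rounds the tables are those of the first `k` incidences; a round takes two loads, two
pushes of six steps, and three steps of control. -/
theorem wp_adjProg {K : ℕ} {L : List (Fin n × Fin m)} (hb : HasBase n m K s)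
    (h2 : s.reg 2 = L.length) (hK : n + m + L.length < K)
    (hL : ∀ i q, L[i]? = some q → s.arr 0 i = q.1 ∧ s.arr 1 i = q.2)
    (h6 : ∀ i, s.arr 6 i = 0) (h8 : ∀ i, s.arr 8 i = 0) :
    Wp A adjProg (fun t' s' => t' ≤ t + 17 * L.length + 2 ∧ HasAdj K L s') t s := by
  simp only [adjProg, wp_block_cons, wp_block_nil, Instr.run_const]
  refine wp_forUp (k₀ := 0) (N := L.length) (fun k t' s' => t' = t + 1 + 17 * k ∧
    HasAdj K (L.take k) s') (by decide) (by simp [h2]) (by simp [hb.reg_one]) (by simp) (by simp)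
    ⟨by simp, .empty (by simp [h6]), .empty (by simp [h8])⟩ ?_ ?_
  · rintro k t' s' - hk hk8 hs ⟨ht, hadj⟩
    have hq := hL k L[k] (List.getElem?_eq_getElem hk)
    have e0 : s'.arr 0 k = L[k].1 := by
      rw [hs.arr 0 (by decide)]; exact hq.1
    have e1 : s'.arr 1 k = L[k].2 := by
      rw [hs.arr 1 (by decide)]; exact hq.2
    have hb' := (hb.setReg 8 0 (by decide)).of_same hs (by decide)
    have l1 : (vertsOf (L.take k) L[k].2).length < K :=
      (length_vertsOf_le _ _).trans_lt (by rw [List.length_take]; omega)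
    have l2 : (edgesOf (L.take k) L[k].1).length < K :=
      (length_edgesOf_le _ _).trans_lt (by rw [List.length_take]; omega)
    have r1 := hb'.row L[k].1 (by have := L[k].1.2; omega)
    have r2 := hb'.row L[k].2 (by have := L[k].2.2; omega)
    have p1 := hadj.verts.push Fin.val_injective (x := L[k].1) l1
    have p2 := hadj.edges.push Fin.val_injective (x := L[k].2) l2
    rw [← vertsOf_concat, ← List.take_succ_eq_append_getElem hk] at p1
    rw [← edgesOf_concat, ← List.take_succ_eq_append_getElem hk] at p2
    simp [pushCode, hk8, e0, e1, r1, r2, hadj.verts.cnt_eq, hadj.edges.cnt_eq, hb'.reg_one, ht]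
    exact ⟨by ring, by simpa using p1, by simpa using p2⟩
  · rintro t' s' - hs ⟨ht, hadj⟩
    rw [List.take_length] at hadj
    exact ⟨by omega, hadj⟩

end Setup

/-! ### Degrees and sizes counted by the incidence list -/

section Incidences

variable {n m : ℕ} {H : HGraph n m} {L : List (Fin n × Fin m)}

theorem mem_vertsOf (hL : ListsIncidences H.edge L) {v : Fin n} {e : Fin m} :
    v ∈ vertsOf L e ↔ v ∈ H.edge e := by
  rw [← hL.2]
  simp only [vertsOf, List.mem_map, List.mem_filter, decide_eq_true_eq, Prod.exists, exists_and_right,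
    exists_eq_right]

theorem mem_edgesOf (hL : ListsIncidences H.edge L) {v : Fin n} {e : Fin m} :
    e ∈ edgesOf L v ↔ v ∈ H.edge e := by
  rw [← hL.2]
  simp only [edgesOf, List.mem_map, List.mem_filter, decide_eq_true_eq, Prod.exists,
    exists_eq_right]

theorem nodup_vertsOf (hL : L.Nodup) (e : Fin m) : (vertsOf L e).Nodup := by
  refine List.Nodup.map_on ?_ (hL.filter _)
  rintro ⟨a, b⟩ h ⟨a', b'⟩ h' he
  simp only [List.mem_filter, decide_eq_true_eq] at h h' he
  rw [he, h.2, h'.2]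

theorem nodup_edgesOf (hL : L.Nodup) (v : Fin n) : (edgesOf L v).Nodup := by
  refine List.Nodup.map_on ?_ (hL.filter _)
  rintro ⟨a, b⟩ h ⟨a', b'⟩ h' he
  simp only [List.mem_filter, decide_eq_true_eq] at h h' he
  rw [he, h.2, h'.2]

theorem sum_length_vertsOf (L : List (Fin n × Fin m)) :
    ∑ e, (vertsOf L e).length = L.length := by
  induction L with
  | nil => simp [vertsOf]
  | cons q L ih =>
    have : ∀ e, (vertsOf (q :: L) e).length = (if q.2 = e then 1 else 0) + (vertsOf L e).length := by
      intro e
      by_cases h : q.2 = e <;> simp [vertsOf, h, add_comm]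
    simp [this, sum_add_distrib, ih, add_comm]

theorem sum_length_edgesOf (L : List (Fin n × Fin m)) :
    ∑ v, (edgesOf L v).length = L.length := by
  induction L with
  | nil => simp [edgesOf]
  | cons q L ih =>
    have : ∀ e, (edgesOf (q :: L) e).length = (if q.1 = e then 1 else 0) + (edgesOf L e).length := by
      intro e
      by_cases h : q.1 = e <;> simp [edgesOf, h, add_comm]
    simp [this, sum_add_distrib, ih, add_comm]

/-- The number of incidences with a vertex in `M`. -/
def degSum (L : List (Fin n × Fin m)) (M : Finset (Fin n)) : ℕ := ∑ v ∈ M, (edgesOf L v).length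

theorem degSum_le (L : List (Fin n × Fin m)) (M : Finset (Fin n)) : degSum L M ≤ L.length :=
  (sum_le_univ_sum_of_nonneg fun _ => Nat.zero_le _).trans_eq (sum_length_edgesOf L)

/-- The number of incidences with a hyperedge in `l`. -/
def sizeSum (L : List (Fin n × Fin m)) (l : List (Fin m)) : ℕ :=
  (l.map fun e => (vertsOf L e).length).sum

theorem sizeSum_le (L : List (Fin n × Fin m)) {l : List (Fin m)} (h : l.Nodup) :
    sizeSum L l ≤ L.length := by
  rw [sizeSum, ← List.sum_toFinset _ h]
  exact (sum_le_univ_sum_of_nonneg fun _ => Nat.zero_le _).trans_eq (sum_length_vertsOf L)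

end Incidences

/-! ### Maximum cardinality search in linear time -/

section Buckets

variable {n m : ℕ}

theorem sum_length_update {α : Type*} {K q : ℕ} (hq : q < K) (tab : ℕ → List α) (l : List α) :
    ∑ x ∈ range K, (Function.update tab q l x).length + (tab q).length =
      ∑ x ∈ range K, (tab x).length + l.length := by
  rw [← add_sum_erase _ _ (mem_range.2 hq), ← add_sum_erase (range K) (fun x => (tab x).length)
    (mem_range.2 hq), Function.update_self]
  have : ∑ x ∈ (range K).erase q, (Function.update tab q l x).length =
      ∑ x ∈ (range K).erase q, (tab x).length :=
    sum_congr rfl fun x hx => by rw [Function.update_of_ne (ne_of_mem_erase hx)]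
  rw [this]
  omega

/-- The priority queue: the hyperedges outside `l`, with weight `W`, occur in the stack of their weight;
entries that are out of date are allowed. -/
structure IsQueue (n K : ℕ) (l : List (Fin m)) (W : Fin m → ℕ) (tab : ℕ → List (Fin m)) (j : ℕ)
    (s : Mem) : Prop where
  weight : ∀ e : Fin m, s.arr 15 e = W e
  table : IsTable K id Fin.val (s.arr 10) (s.arr 11) tab
  top_eq : s.reg 17 = j
  top_le : j ≤ n
  mem : ∀ e, e ∉ l → W e ≤ j ∧ e ∈ tab (W e)
  le : ∀ q, ∀ e ∈ tab q, q ≤ W e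
  nodup : ∀ q, (tab q).Nodup

/-- The priority queue, with a bound on the time in which its size is charged. -/
def QueueInv (n K : ℕ) (l : List (Fin m)) (W : Fin m → ℕ) (T t : ℕ) (s : Mem) : Prop :=
  ∃ tab j, IsQueue n K l W tab j s ∧ t + 12 * (∑ q ∈ range K, (tab q).length + j) ≤ T

variable {K : ℕ} {l : List (Fin m)} {W : Fin m → ℕ} {T t : ℕ} {s : Mem}

theorem QueueInv.congr {T' t' : ℕ} {s' : Mem} (h : QueueInv n K l W T t s)
    (h15 : s'.arr 15 = s.arr 15) (h10 : s'.arr 10 = s.arr 10) (h11 : s'.arr 11 = s.arr 11)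
    (h17 : s'.reg 17 = s.reg 17) (ht : t' + T ≤ T' + t) : QueueInv n K l W T' t' s' := by
  obtain ⟨tab, j, hq, hT⟩ := h
  refine ⟨tab, j, ⟨?_, ?_, ?_, hq.top_le, hq.mem, hq.le, hq.nodup⟩, by omega⟩
  · rw [h15]; exact hq.weight
  · rw [h10, h11]; exact hq.table
  · rw [h17]; exact hq.top_eq

/-- Increase the weight of the hyperedge number `reg 12` of a vertex. -/
def bumpProg : Prog :=
  block ([.add 15 14 12, .load 15 9 15, .load 16 15 15, .add 16 16 4, .store 15 15 16] ++
    pushCode 10 11 16 15) (.ite (.lt 17 16) (block [.add 17 17 4] .skip) .skip)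

variable {A : SubsetAlg} {L : List (Fin n × Fin m)}

/-- The code takes at most 14 steps. It creates one stack entry and raises the pointer by at most
one, and each of these prepays 12 steps for its later removal: 14 + 24 = 38. The old entry of `e`
stays behind as an outdated one. -/
theorem wp_bumpProg (hb : HasBase n m K s) (hadj : HasAdj K L s) (hK : n + m < K) {v : Fin n}
    {e : Fin m} {b : ℕ} (h14 : s.reg 14 = v * K) (h12 : s.reg 12 = b)
    (he : (edgesOf L v)[b]? = some e) (hW : W e + 1 ≤ n) (hq : QueueInv n K l W T t s) :
    Wp A bumpProg (QueueInv n K l (Function.update W e (W e + 1)) (T + 38)) t s := by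
  obtain ⟨tab, j, hq, hT⟩ := hq
  have e1 := hadj.edges.dat_eq v b e he
  have e2 := hq.weight e
  have e3 := hb.row (W e + 1) (by omega)
  have e4 := hq.table.cnt_eq (W e + 1)
  -- Weights never decrease, so an entry in a stack above the current weight is impossible.
  have hnot : e ∉ tab (W e + 1) := fun h => by have := hq.le _ _ h; omega
  have hlen : (tab (W e + 1)).length < K := by
    have := (hq.nodup (W e + 1)).length_le_card
    rw [Fintype.card_fin] at this
    omega
  have hpush := hq.table.push Function.injective_id (x := e) hlen
  have hsum := sum_length_update (by omega : W e + 1 < K) tab (tab (W e + 1) ++ [e])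
  rw [List.length_append, List.length_singleton] at hsum
  rw [id] at hpush e4
  have main : ∀ j' s', (s'.arr 15 = Function.update (s.arr 15) e (W e + 1)) →
      s'.arr 10 = Function.update (s.arr 10) (W e + 1) ((tab (W e + 1)).length + 1) →
      s'.arr 11 = Function.update (s.arr 11) ((W e + 1) * K + (tab (W e + 1)).length) e →
      s'.reg 17 = j' → j' ≤ n → j ≤ j' → W e + 1 ≤ j' ∨ e ∈ l →
      IsQueue n K l (Function.update W e (W e + 1))
        (Function.update tab (W e + 1) (tab (W e + 1) ++ [e])) j' s' := by
    intro j' s' h15 h10 h11 h17 hn hj hl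
    refine ⟨fun x => ?_, by rw [h10, h11]; exact hpush, h17, hn, fun x hx => ?_, fun q x hx => ?_,
      fun q => ?_⟩
    · rw [h15]
      by_cases hxe : x = e
      · subst hxe; simp
      · rw [Function.update_of_ne hxe, Function.update_of_ne (Fin.val_injective.ne hxe), hq.weight]
    · by_cases hxe : x = e
      · subst hxe
        rw [Function.update_self, Function.update_self]
        exact ⟨hl.resolve_right hx, by simp⟩
      · rw [Function.update_of_ne hxe]
        obtain ⟨h1, h2⟩ := hq.mem x hx
        refine ⟨h1.trans hj, ?_⟩
        by_cases hw : W x = W e + 1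
        · rw [hw] at h2 ⊢
          rw [Function.update_self]
          exact List.mem_append_left _ h2
        · rwa [Function.update_of_ne hw]
    · by_cases hw : q = W e + 1
      · subst hw
        rw [Function.update_self, List.mem_append, List.mem_singleton] at hx
        by_cases hxe : x = e
        · subst hxe; simp
        · rw [Function.update_of_ne hxe]
          exact hq.le _ _ (hx.resolve_right hxe)
      · rw [Function.update_of_ne hw] at hx
        have := hq.le _ _ hx
        by_cases hxe : x = e
        · subst hxe; simp; omega
        · rwa [Function.update_of_ne hxe]
    · by_cases hw : q = W e + 1
      · subst hw
        rw [Function.update_self]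
        exact List.Nodup.append (hq.nodup _) (List.nodup_singleton e) (by simpa using hnot)
      · rw [Function.update_of_ne hw]
        exact hq.nodup q
  have hj := hq.top_eq
  simp [bumpProg, pushCode, h14, h12, e1, e2, e3, e4, hb.reg_one, hj]
  refine ⟨fun hlt => ?_, fun hge => ?_⟩
  · refine ⟨_, j + 1, main (j + 1) _ ?_ ?_ ?_ ?_ (by omega) (by omega) ?_, by omega⟩
    · simp
    · simp
    · simp
    · simp
    -- One increment of the pointer suffices: outside `l` the old weight was at most `j`.
    · by_cases hel : e ∈ l
      · exact .inr hel
      · have := (hq.mem e hel).1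
        left; omega
  · refine ⟨_, j, main j _ ?_ ?_ ?_ ?_ hq.top_le le_rfl (.inl (by omega)), by omega⟩
    · simp
    · simp
    · simp
    · simpa using hj

/-- Mark the vertex `reg 21` and increase the weights of its hyperedges. -/
def markProg : Prog :=
  block [.store 14 21 4, .load 14 5 21, .load 13 8 21, .const 12 0] (forUp 12 13 bumpProg)

/-- Midway, exactly the hyperedges of `v` already handled have the vertex counted in their weight.
The 40 steps per hyperedge are the 38 of the bump and 2 of the loop. -/
theorem wp_markProg {H : HGraph n m} (hL : ListsIncidences H.edge L) (hb : HasBase n m K s)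
    (hadj : HasAdj K L s) (hK : n + m < K) {M : Finset (Fin n)} {v : Fin n} (hv : v ∉ M)
    (h21 : s.reg 21 = v) (hq : QueueInv n K l (fun x => (H.edge x ∩ M).card) T t s) :
    Wp A markProg (fun t' s' => QueueInv n K l (fun x => (H.edge x ∩ insert v M).card)
      (T + 40 * (edgesOf L v).length + 5) t' s' ∧ s'.arr 14 = Function.update (s.arr 14) v 1) t s := by
  have h8 := hadj.edges.cnt_eq v
  have h5 := hb.row v (by have := v.2; omega)
  have hcard : ∀ x, v ∈ H.edge x → (H.edge x ∩ insert v M).card = (H.edge x ∩ M).card + 1 := by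
    intro x hx
    rw [inter_insert_of_mem hx, card_insert_of_notMem (by simp [hv])]
  have hnd := nodup_edgesOf hL.1 v
  have hinit : QueueInv n K l (fun x => (H.edge x ∩ M).card +
      if x ∈ (edgesOf L v).take 0 then 1 else 0) (T + 4 + 40 * 0) (t + 4)
      ((((s.setArr 14 v 1).setReg 14 (v * K)).setReg 13 (edgesOf L v).length).setReg 12 0) := by
    simp only [List.take_zero, List.not_mem_nil, if_false, add_zero]
    exact hq.congr (by simp) (by simp) (by simp) (by simp) (by omega)
  simp [markProg, h21, h8, h5, hb.reg_one]
  refine wp_forUp (k₀ := 0) (N := (edgesOf L v).length) (fun k t' s' =>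
    QueueInv n K l (fun x => (H.edge x ∩ M).card + if x ∈ (edgesOf L v).take k then 1 else 0)
      (T + 4 + 40 * k) t' s') (by decide) (by simp) (by simp [hb.reg_one]) (by simp) (by simp)
    hinit ?_ ?_
  · rintro k t' s' - hk h12 hs hq
    have hb' := ((((hb.setArr 14 v 1 (by decide)).setReg 14 (v * K) (by decide)).setReg 13
      (edgesOf L v).length (by decide)).setReg 12 0 (by decide)).of_same hs (by decide)
    have hadj' : HasAdj K L s' := by
      refine HasAdj.of_same ⟨?_, ?_⟩ hs (by decide)
      · simpa using hadj.verts
      · simpa using hadj.edges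
    set e := (edgesOf L v)[k] with he
    have hev : v ∈ H.edge e := (mem_edgesOf hL).1 (List.getElem_mem hk)
    have hnot : e ∉ (edgesOf L v).take k := by
      intro h
      obtain ⟨i, hi, hie⟩ := List.mem_iff_getElem.1 h
      rw [List.getElem_take, he, hnd.getElem_inj_iff] at hie
      rw [List.length_take] at hi
      omega
    have h14 : s'.reg 14 = v * K := by rw [hs.reg 14 (by decide)]; simp
    have hW : (H.edge e ∩ M).card + 1 ≤ n := by
      rw [← hcard e hev]
      exact (card_le_univ _).trans_eq (Fintype.card_fin n)
    refine (wp_bumpProg (e := e) hb' hadj' hK h14 h12 (List.getElem?_eq_getElem hk)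
      (by rw [if_neg hnot]; omega)
      (hq.congr rfl rfl rfl rfl (T' := T + 4 + 40 * k + 1) (by omega))).mono fun t'' s'' h => ?_
    have hfun : Function.update (fun x => (H.edge x ∩ M).card +
        if x ∈ (edgesOf L v).take k then 1 else 0) e ((H.edge e ∩ M).card +
          (if e ∈ (edgesOf L v).take k then 1 else 0) + 1) = fun x => (H.edge x ∩ M).card +
        if x ∈ (edgesOf L v).take (k + 1) then 1 else 0 := by
      funext x
      rw [List.take_succ_eq_append_getElem hk, ← he]
      by_cases hx : x = e
      · subst hx; simp [hnot]
      · simp [hx]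
    rw [hfun] at h
    exact h.congr (by simp) (by simp) (by simp) (by simp) (by omega)
  · rintro t' s' - hs hq
    rw [List.take_length] at hq
    refine ⟨?_, by rw [hs.arr 14 (by decide)]; simp⟩
    have hfun : (fun x => (H.edge x ∩ M).card + if x ∈ edgesOf L v then 1 else 0) =
        fun x => (H.edge x ∩ insert v M).card := by
      funext x
      simp only [mem_edgesOf hL]
      by_cases hx : v ∈ H.edge x
      · rw [if_pos hx, hcard x hx]
      · rw [if_neg hx, inter_insert_of_notMem hx, add_zero]
    rw [hfun] at hq
    exact hq.congr rfl rfl rfl rfl (by omega)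

/-- Marks and weights for the set `M` of covered vertices; the time is charged to the incidences with
vertices in `M`. -/
def MarkInv (H : HGraph n m) (L : List (Fin n × Fin m)) (K : ℕ) (l : List (Fin m))
    (M : Finset (Fin n)) (T t : ℕ) (s : Mem) : Prop :=
  QueueInv n K l (fun x => (H.edge x ∩ M).card) (T + 40 * degSum L M) t s ∧
    ∀ v : Fin n, s.arr 14 v = if v ∈ M then 1 else 0

theorem MarkInv.congr {H : HGraph n m} {M : Finset (Fin n)} {T' t' : ℕ} {s' : Mem}
    (h : MarkInv H L K l M T t s)
    (h15 : s'.arr 15 = s.arr 15) (h10 : s'.arr 10 = s.arr 10) (h11 : s'.arr 11 = s.arr 11)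
    (h14 : s'.arr 14 = s.arr 14) (h17 : s'.reg 17 = s.reg 17) (ht : t' + T ≤ T' + t) :
    MarkInv H L K l M T' t' s' :=
  ⟨h.1.congr h15 h10 h11 h17 (by omega), by rw [h14]; exact h.2⟩

/-- Visit the vertex number `reg 18` of a hyperedge. -/
def visitProg : Prog :=
  block [.add 21 20 18, .load 21 7 21, .load 22 14 21] (.ite (.eq 22 5) markProg .skip)

/-- The work proportional to the degree of `v` arises only when `v` is new, and then it is covered
by the growth of `degSum`; 9 further steps suffice in every case. -/
theorem wp_visitProg {H : HGraph n m} (hL : ListsIncidences H.edge L) (hb : HasBase n m K s)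
    (hadj : HasAdj K L s) (hK : n + m < K) {M : Finset (Fin n)} {v : Fin n} {e : Fin m} {a : ℕ}
    (h20 : s.reg 20 = e * K) (h18 : s.reg 18 = a) (hv : (vertsOf L e)[a]? = some v)
    (hq : MarkInv H L K l M T t s) :
    Wp A visitProg (MarkInv H L K l (insert v M) (T + 9)) t s := by
  have e1 := hadj.verts.dat_eq e a v hv
  have e2 := hq.2 v
  simp only [visitProg, wp_block_cons, wp_block_nil, wp_ite]
  simp only [Instr.run_add, Instr.run_load, Mem.setReg_reg, Mem.setReg_arr, Test.holds_eq]
  simp only [Nat.reduceEqDiff, if_true, if_false, h20, h18, e1, e2, hb.reg_zero]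
  constructor
  · intro h
    have hvM : v ∉ M := by
      intro hvM
      simp [hvM] at h
    rw [if_neg hvM]
    refine (wp_markProg hL (((hb.setReg 21 _ (by decide)).setReg 21 _ (by decide)).setReg 22 _
      (by decide)) ⟨?_, ?_⟩ hK hvM ?_ (hq.1.congr (T' := T + 4 + 40 * degSum L M) ?_ ?_ ?_ ?_ ?_)).mono
        fun t' s' h => ?_
    · simpa using hadj.verts
    · simpa using hadj.edges
    · simp
    · simp
    · simp
    · simp
    · simp
    · omega
    · have hsum : degSum L (insert v M) = (edgesOf L v).length + degSum L M := sum_insert hvM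
      refine ⟨h.1.congr rfl rfl rfl rfl (by rw [hsum]; omega), fun w => ?_⟩
      rw [h.2]
      by_cases hw : w = v
      · subst hw; simp
      · rw [Function.update_of_ne (Fin.val_injective.ne hw)]
        simp [hq.2, hw]
  · intro h
    have hvM : v ∈ M := by
      by_contra hvM
      simp [hvM] at h
    rw [insert_eq_of_mem hvM, wp_skip]
    exact hq.congr (by simp) (by simp) (by simp) (by simp) (by simp) (by omega)

/-- Select the hyperedge `reg 11`. -/
def selectProg : Prog :=
  block [.store 12 11 4, .store 13 8 11, .add 8 8 4, .load 20 5 11, .load 19 6 11, .const 18 0]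
    (forUp 18 19 visitProg)

/-- The list `l` of the selected hyperedges is recorded in the memory. -/
structure OrderInv (H : HGraph n m) (l : List (Fin m)) (s : Mem) : Prop where
  nodup : l.Nodup
  isMaxCard : H.IsMaxCard l
  count : s.reg 8 = l.length
  selected : ∀ e : Fin m, s.arr 12 e = if e ∈ l then 1 else 0
  order : ∀ (k : ℕ) (e : Fin m), l[k]? = some e → s.arr 13 k = e

theorem OrderInv.congr {H : HGraph n m} {s' : Mem} (h : OrderInv H l s)
    (h8 : s'.reg 8 = s.reg 8) (h12 : s'.arr 12 = s.arr 12) (h13 : s'.arr 13 = s.arr 13) :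
    OrderInv H l s' :=
  ⟨h.nodup, h.isMaxCard, by rw [h8, h.count], by rw [h12]; exact h.selected,
    by rw [h13]; exact h.order⟩

/-- The invariant of the search. -/
def SearchInv (H : HGraph n m) (L : List (Fin n × Fin m)) (K T : ℕ) (l : List (Fin m))
    (t : ℕ) (s : Mem) : Prop :=
  OrderInv H l s ∧ MarkInv H L K l (H.covered l) (T + 11 * sizeSum L l + 10 * l.length) t s

theorem HGraph.covered_concat (H : HGraph n m) (l : List (Fin m)) (e : Fin m) :
    H.covered (l ++ [e]) = H.covered l ∪ H.edge e := by
  ext v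
  simp [HGraph.mem_covered, or_and_right, exists_or]

/-- The queue may already ignore `e`, which has just been removed from its stack; hence `MarkInv` is
assumed for `l ++ [e]` while the covered set is still that of `l`. Each vertex of `e` costs 9 + 2
steps besides the marking. -/
theorem wp_selectProg {H : HGraph n m} (hL : ListsIncidences H.edge L) (hb : HasBase n m K s)
    (hadj : HasAdj K L s) (hK : n + m < K) {e : Fin m} (h11 : s.reg 11 = e) (he : e ∉ l)
    (hmax : ∀ x, x ∉ l → (H.edge x ∩ H.covered l).card ≤ (H.edge e ∩ H.covered l).card)
    (h : OrderInv H l s)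
    (hmarks : MarkInv H L K (l ++ [e]) (H.covered l) (T + 11 * sizeSum L l + 10 * l.length) t s) :
    Wp A selectProg (SearchInv H L K T (l ++ [e])) t s := by
  have e1 := hadj.verts.cnt_eq e
  have e2 := hb.row e (by have := e.2; omega)
  have h8 := h.count
  simp [selectProg, h11, e1, e2, hb.reg_one, h8]
  have hinit : MarkInv H L K (l ++ [e]) (H.covered l ∪ ((vertsOf L e).take 0).toFinset)
      (T + 11 * sizeSum L l + 10 * l.length + 6 + 11 * 0) (t + 6)
      ((((((s.setArr 12 e 1).setArr 13 l.length e).setReg 8 (l.length + 1)).setReg 20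
        (e * K)).setReg 19 (vertsOf L e).length).setReg 18 0) := by
    simp only [List.take_zero, List.toFinset_nil, union_empty]
    exact hmarks.congr (by simp) (by simp) (by simp) (by simp) (by simp) (by omega)
  refine wp_forUp (k₀ := 0) (N := (vertsOf L e).length) (fun k t' s' =>
    MarkInv H L K (l ++ [e]) (H.covered l ∪ ((vertsOf L e).take k).toFinset)
      (T + 11 * sizeSum L l + 10 * l.length + 6 + 11 * k) t' s')
    (by decide) (by simp) (by simp [hb.reg_one]) (by simp) (by simp) hinit ?_ ?_
  · rintro k t' s' - hk h18 hs hq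
    have hb' := ((((((hb.setArr 12 e 1 (by decide)).setArr 13 l.length e (by decide)).setReg 8
      (l.length + 1) (by decide)).setReg 20 (e * K) (by decide)).setReg 19
      (vertsOf L e).length (by decide)).setReg 18 0 (by decide)).of_same hs (by decide)
    have hadj' : HasAdj K L s' := by
      refine HasAdj.of_same ⟨?_, ?_⟩ hs (by decide)
      · simpa using hadj.verts
      · simpa using hadj.edges
    have h20 : s'.reg 20 = e * K := by rw [hs.reg 20 (by decide)]; simp
    refine (wp_visitProg hL hb' hadj' hK h20 h18 (List.getElem?_eq_getElem hk)
      (hq.congr rfl rfl rfl rfl rfl (T' := T + 11 * sizeSum L l + 10 * l.length + 6 + 11 * k + 1)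
        (by omega))).mono fun t'' s'' h => ?_
    have hset : insert (vertsOf L e)[k] (H.covered l ∪ ((vertsOf L e).take k).toFinset) =
        H.covered l ∪ ((vertsOf L e).take (k + 1)).toFinset := by
      rw [List.take_succ_eq_append_getElem hk, List.toFinset_append, ← union_assoc]
      ext x
      simp [or_comm]
    rw [hset] at h
    exact h.congr (by simp) (by simp) (by simp) (by simp) (by simp) (by omega)
  · rintro t' s' - hs hq
    have hset : H.covered l ∪ ((vertsOf L e).take (vertsOf L e).length).toFinset =
        H.covered (l ++ [e]) := by
      rw [List.take_length, H.covered_concat]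
      ext x
      simp [mem_vertsOf hL]
    rw [hset] at hq
    refine ⟨⟨List.Nodup.append h.nodup (List.nodup_singleton e) (by simpa using he),
      h.isMaxCard.append_singleton hmax, ?_, fun x => ?_, fun k x hx => ?_⟩, ?_⟩
    · rw [hs.reg 8 (by decide)]; simp
    · rw [hs.arr 12 (by decide)]
      by_cases hx : x = e
      · subst hx; simp
      · simp [Function.update_of_ne (Fin.val_injective.ne hx), hx, h.selected]
    · rw [hs.arr 13 (by decide)]
      by_cases hk : k < l.length
      · rw [List.getElem?_append_left hk] at hx
        simp [Function.update_of_ne hk.ne, h.order k x hx]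
      · have hk' := (List.getElem?_eq_some_iff.1 hx).1
        have : k = l.length := by simp at hk'; omega
        subst this
        simp at hx
        simp [hx]
    · have : sizeSum L (l ++ [e]) = sizeSum L l + (vertsOf L e).length := by simp [sizeSum]
      refine hq.congr rfl rfl rfl rfl rfl ?_
      rw [this, List.length_append, List.length_singleton]
      omega

/-- One step of the search: look at the top of the highest stack. -/
def searchStep : Prog :=
  block [.load 9 10 17] (.ite (.eq 9 5) (block [.sub 17 17 4] .skip)
    (block [.sub 9 9 4, .store 10 17 9, .load 10 5 17, .add 10 10 9, .load 11 11 10, .load 10 12 11]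
      (.ite (.eq 10 5) selectProg .skip)))

/-- A step either lowers the pointer or removes a stack entry, and the 12 steps released pay for
looking. An unselected top entry is a correct choice: its weight is at least `j`, and all unselected
hyperedges have weight at most `j`. -/
theorem wp_searchStep {H : HGraph n m} (hL : ListsIncidences H.edge L) (hb : HasBase n m K s)
    (hadj : HasAdj K L s) (hK : n + m < K) (hl : l.length < m) (h : SearchInv H L K T l t s) :
    Wp A searchStep (fun t' s' => ∃ l', SearchInv H L K T l' t' s') (t + 1) s := by
  obtain ⟨h, ⟨tab, j, hq, hT⟩, hmarks⟩ := h
  have e1 : s.arr 10 j = (tab j).length := hq.table.cnt_eq j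
  have e3 := hb.row j (by have := hq.top_le; omega)
  have hj := hq.top_eq
  simp only [searchStep, wp_block_cons, wp_block_nil, wp_ite]
  simp only [Instr.run_load, Mem.setReg_reg, Mem.setReg_arr, Test.holds_eq]
  simp only [Nat.reduceEqDiff, if_true, if_false, hj, e1, hb.reg_zero]
  constructor
  -- Every unselected hyperedge occurs in the stack of its weight, so none has weight `j`. As one
  -- exists, `j` is positive and can be lowered.
  · intro hemp
    rw [List.length_eq_zero_iff] at hemp
    obtain ⟨e, he⟩ : ∃ e, e ∉ l := by
      by_contra! hall
      have : (univ : Finset (Fin m)) ⊆ l.toFinset := fun x _ => List.mem_toFinset.2 (hall x)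
      have := (card_le_card this).trans (List.toFinset_card_le l)
      rw [card_univ, Fintype.card_fin] at this
      omega
    have hlow : ∀ e, e ∉ l → (H.edge e ∩ H.covered l).card < j := by
      intro e he
      obtain ⟨h1, h2⟩ := hq.mem e he
      refine lt_of_le_of_ne h1 fun h3 => ?_
      rw [h3, hemp] at h2
      exact List.not_mem_nil h2
    have hj0 := hlow e he
    simp [hb.reg_one]
    refine ⟨l, h.congr (by simp) (by simp) (by simp),
      ⟨tab, j - 1, ⟨?_, ?_, ?_, ?_, ?_, hq.le, hq.nodup⟩, by omega⟩, by simpa using hmarks⟩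
    · simpa using hq.weight
    · simpa using hq.table
    · simp [hj]
    · have := hq.top_le; omega
    · exact fun e he => ⟨by have := hlow e he; omega, (hq.mem e he).2⟩
  · intro hne
    obtain ⟨l₀, e, hl₀⟩ : ∃ l₀ e, tab j = l₀ ++ [e] := by
      rcases List.eq_nil_or_concat (tab j) with h0 | ⟨l₀, e, h0⟩
      · rw [h0] at hne; exact absurd rfl hne
      · exact ⟨l₀, e, by rw [h0, List.concat_eq_append]⟩
    obtain ⟨hpop, hget⟩ := hq.table.pop Function.injective_id hl₀
    rw [id] at hpop hget
    have hlen : (tab j).length - 1 = l₀.length := by rw [hl₀]; simp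
    have hsel := h.selected e
    simp only [Instr.run_sub, Instr.run_store, Instr.run_add, Mem.setReg_reg,
      Mem.setReg_arr, Mem.setArr_reg, Mem.setArr_arr]
    simp only [Nat.reduceEqDiff, if_true, if_false, hj, hb.reg_one, hb.reg_zero, hlen, e3, hget, hsel]
    have hsum := sum_length_update (by have := hq.top_le; omega : j < K) tab l₀
    rw [hl₀, List.length_append, List.length_singleton] at hsum
    have hmem : e ∈ tab j := by rw [hl₀]; simp
    have hnd : (l₀ ++ [e]).Nodup := hl₀ ▸ hq.nodup j
    -- Stated for a general `l'` in order to serve both outcomes, `e` newly selected and `e` an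
    -- outdated entry.
    have hcond : ∀ l' : List (Fin m), (∀ x, x ∉ l → x = e → x ∈ l') → (∀ x, x ∈ l → x ∈ l') →
        ∀ x, x ∉ l' → (H.edge x ∩ H.covered l).card ≤ j ∧
          x ∈ Function.update tab j l₀ (H.edge x ∩ H.covered l).card := by
      intro l' hl1 hl2 x hx
      have hxl : x ∉ l := fun h => hx (hl2 x h)
      have hxe : x ≠ e := fun h => hx (hl1 x hxl h)
      obtain ⟨h1, h2⟩ := hq.mem x hxl
      refine ⟨h1, ?_⟩
      by_cases hw : (H.edge x ∩ H.covered l).card = j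
      · rw [hw, hl₀] at h2
        rw [hw, Function.update_self]
        simpa [hxe] using h2
      · rwa [Function.update_of_ne hw]
    have hle : ∀ q, ∀ x ∈ Function.update tab j l₀ q, q ≤ (H.edge x ∩ H.covered l).card := by
      intro q x hx
      by_cases hw : q = j
      · subst hw
        rw [Function.update_self] at hx
        exact hq.le q x (by rw [hl₀]; simp [hx])
      · rw [Function.update_of_ne hw] at hx
        exact hq.le q x hx
    have hnodup : ∀ q, (Function.update tab j l₀ q).Nodup := by
      intro q
      by_cases hw : q = j
      · subst hw
        rw [Function.update_self]
        exact (List.nodup_append.1 hnd).1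
      · rw [Function.update_of_ne hw]
        exact hq.nodup q
    constructor
    · intro he0
      have he : e ∉ l := by
        intro he
        simp [he] at he0
      have hmax : ∀ x, x ∉ l →
          (H.edge x ∩ H.covered l).card ≤ (H.edge e ∩ H.covered l).card :=
        fun x hx => (hq.mem x hx).1.trans (hq.le j e hmem)
      refine (wp_selectProg hL ((((((((hb.setReg 9 _ (by decide)).setReg 9 _ (by decide)).setArr 10 _
        _ (by decide)).setReg 10 _ (by decide)).setReg 10 _ (by decide)).setReg 11 _
        (by decide)).setReg 10 _ (by decide))) ⟨?_, ?_⟩ hK ?_ he hmax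
        (h.congr ?_ ?_ ?_) ⟨⟨Function.update tab j l₀, j, ⟨?_, ?_, ?_, hq.top_le, hcond _ ?_ ?_, hle,
          hnodup⟩, ?_⟩, ?_⟩).mono fun t' s' h => ⟨_, h⟩
      · simpa using hadj.verts
      · simpa using hadj.edges
      · simp
      · simp
      · simp
      · simp
      · simpa using hq.weight
      · simpa using hpop
      · simpa using hj
      · rintro x - rfl; simp
      · intro x hx; simp [hx]
      · omega
      · simpa using hmarks
    · intro he0
      have he : e ∈ l := by
        by_contra he
        simp [he] at he0
      rw [wp_skip]
      refine ⟨l, h.congr ?_ ?_ ?_, ⟨Function.update tab j l₀, j, ⟨?_, ?_, ?_, hq.top_le, hcond _ ?_ ?_,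
        hle, hnodup⟩, ?_⟩, ?_⟩
      · simp
      · simp
      · simp
      · simpa using hq.weight
      · simpa using hpop
      · simpa using hj
      · rintro x hx rfl; exact absurd he hx
      · exact fun _ h => h
      · omega
      · simpa using hmarks

/-- Compute a maximum cardinality order of the hyperedges in array `13`. -/
def searchProg : Prog :=
  .seq (block [.const 8 0] (forUp 8 1 (block (pushCode 10 11 5 8) .skip)))
    (block [.const 8 0, .const 17 0] (.loop (.lt 8 1) searchStep))

/-- At the start nothing is covered, so all hyperedges are put on stack `0`; this takes 9 steps each
and creates a potential of 12 each. With 10 steps per selection this makes `31 * m`. The incidences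
are paid once by hyperedge (11) and once by vertex (40). -/
theorem wp_searchProg {H : HGraph n m} (hL : ListsIncidences H.edge L) (hb : HasBase n m K s)
    (hadj : HasAdj K L s) (hK : n + m < K) (h10 : ∀ i, s.arr 10 i = 0) (h12 : ∀ i, s.arr 12 i = 0)
    (h14 : ∀ i, s.arr 14 i = 0) (h15 : ∀ i, s.arr 15 i = 0) :
    Wp A searchProg (fun t' s' => t' ≤ t + 31 * m + 51 * L.length + 6 ∧ ∃ l : List (Fin m),
      l.Nodup ∧ H.IsMaxCard l ∧ l.length = m ∧
        ∀ (k : ℕ) (e : Fin m), l[k]? = some e → s'.arr 13 k = e) t s := by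
  simp only [searchProg, wp_seq]
  refine Wp.mono (Q := fun t' s' => t' = t + 9 * m + 2 ∧ IsTable K id Fin.val (s'.arr 10)
    (s'.arr 11) (Function.update (fun _ => []) 0 (List.finRange m)) ∧ HasBase n m K s' ∧
    HasAdj K L s' ∧ (∀ i, s'.arr 12 i = 0) ∧ (∀ i, s'.arr 14 i = 0) ∧ (∀ i, s'.arr 15 i = 0)) ?_ ?_
  · simp only [wp_block_cons, wp_block_nil, Instr.run_const]
    refine wp_forUp (k₀ := 0) (N := m) (fun k t' s' => t' = t + 1 + 9 * k ∧
      IsTable K id Fin.val (s'.arr 10) (s'.arr 11)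
        (Function.update (fun _ => []) 0 ((List.finRange m).take k))) (by decide)
      (by simp [hb.reg_m]) (by simp [hb.reg_one]) (by simp) (by simp) ⟨by simp, ?_⟩ ?_ ?_
    · rw [List.take_zero, Function.update_eq_self_iff.2 rfl]
      exact .empty (by simp [h10])
    · rintro k t' s' - hk h8 hs ⟨ht, htab⟩
      have hb' := (hb.setReg 8 0 (by decide)).of_same hs (by decide)
      have hk' : k < (List.finRange m).length := by simpa using hk
      have hpush := htab.push Function.injective_id (v := 0) (x := (⟨k, hk⟩ : Fin m)) (by
        rw [Function.update_self, List.length_take, List.length_finRange]; omega)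
      have e1 := htab.cnt_eq 0
      rw [id, Function.update_self, List.length_take, List.length_finRange, min_eq_left hk.le] at e1
      rw [Function.update_idem, Function.update_self, List.length_take, List.length_finRange,
        min_eq_left hk.le, id] at hpush
      have htake : (List.finRange m).take (k + 1) = (List.finRange m).take k ++ [⟨k, hk⟩] := by
        rw [List.take_succ_eq_append_getElem hk']
        simp
      have h50 := hb'.row 0 (by omega)
      rw [htake]
      simp [pushCode, hb'.reg_zero, hb'.reg_one, h8, e1, ht, h50]
      refine ⟨by ring, ?_⟩
      simpa using hpush
    · rintro t' s' - hs ⟨ht, htab⟩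
      rw [List.take_of_length_le (by simp)] at htab
      refine ⟨by omega, htab, (hb.setReg 8 0 (by decide)).of_same hs (by decide),
        HasAdj.of_same (s := s.setReg 8 0) ⟨hadj.verts, hadj.edges⟩ hs (by decide), ?_, ?_, ?_⟩
      · rw [hs.arr 12 (by decide)]; exact h12
      · rw [hs.arr 14 (by decide)]; exact h14
      · rw [hs.arr 15 (by decide)]; exact h15
  · rintro t₁ s₁ ⟨ht₁, htab, hb₁, hadj₁, a12, a14, a15⟩
    simp only [wp_block_cons, wp_block_nil, Instr.run_const]
    set T := t₁ + 2 + 12 * m with hT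
    have hsize : ∑ q ∈ range K, (Function.update (fun _ => []) 0 (List.finRange m) q).length = m := by
      have := sum_length_update (by omega : 0 < K) (fun _ => ([] : List (Fin m))) (List.finRange m)
      simpa using this
    refine wp_loop (fun t' s' => ∃ l, SearchInv H L K T l t' s')
      (T + 11 * L.length + 10 * m + 40 * L.length) ⟨[], ⟨List.nodup_nil, ?_, ?_, ?_, ?_⟩,
        ⟨Function.update (fun _ => []) 0 (List.finRange m), 0,
          ⟨?_, ?_, ?_, Nat.zero_le _, ?_, ?_, ?_⟩, ?_⟩, ?_⟩ ?_ ?_ ?_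
    · intro l₁ e l₂ h
      simp at h
    · simp
    · intro e; simp [a12]
    · intro k e h
      simp at h
    · intro e
      simp [HGraph.covered, a15]
    · simpa using htab
    · simp
    · intro e _
      have hc : (H.edge e ∩ H.covered []).card = 0 := by simp [HGraph.covered]
      rw [hc]
      simp
    · intro q e he
      by_cases hq : q = 0
      · omega
      · simp [Function.update_of_ne hq] at he
    · intro q
      by_cases hq : q = 0
      · subst hq; simpa using List.nodup_finRange m
      · simp [Function.update_of_ne hq]
    · rw [hsize]; omega
    · intro v; simp [HGraph.covered, a14]
    · rintro t' s' ⟨l, ho, ⟨tab, j, _, hle⟩, _⟩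
      have h1 := degSum_le L (H.covered l)
      have h2 := sizeSum_le L ho.nodup
      have h3 := ho.nodup.length_le_card
      rw [Fintype.card_fin] at h3
      omega
    · rintro t' s' ⟨l, h⟩ hs hlt
      have hb' := ((hb₁.setReg 8 0 (by decide)).setReg 17 0 (by decide)).of_same hs (by decide)
      have hadj' : HasAdj K L s' := HasAdj.of_same (s := (s₁.setReg 8 0).setReg 17 0)
        ⟨hadj₁.verts, hadj₁.edges⟩ hs (by decide)
      rw [Test.holds_lt, h.1.count, hb'.reg_m] at hlt
      exact wp_searchStep hL hb' hadj' hK hlt h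
    · rintro t' s' ⟨l, h⟩ hs hlt
      have hb' := ((hb₁.setReg 8 0 (by decide)).setReg 17 0 (by decide)).of_same hs (by decide)
      rw [Test.holds_lt, h.1.count, hb'.reg_m, not_lt] at hlt
      obtain ⟨ho, ⟨tab, j, _, hle⟩, _⟩ := h
      have h1 := degSum_le L (H.covered l)
      have h2 := sizeSum_le L ho.nodup
      have h3 := ho.nodup.length_le_card
      rw [Fintype.card_fin] at h3
      exact ⟨by omega, l, ho.nodup, ho.isMaxCard, by omega, ho.order⟩

end Buckets

/-! ### Parents and the query for the subroutine -/

section Parents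

variable {n m : ℕ}

/-- The query arrays `17`, `18` list, without repetition, the pairs in the relation `P`. -/
def QueryInv (n m : ℕ) (P : Fin n → ℕ → Prop) (s : Mem) : Prop :=
  ∃ Q : List (Fin n × Fin (m - 1)), Q.Nodup ∧ (∀ v c, (v, c) ∈ Q ↔ P v c) ∧ s.reg 10 = Q.length ∧
    ∀ (k : ℕ) (q : Fin n × Fin (m - 1)), Q[k]? = some q → s.arr 17 k = q.1 ∧ s.arr 18 k = q.2

theorem QueryInv.congr {P P' : Fin n → ℕ → Prop} {s s' : Mem} (h : QueryInv n m P s)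
    (hP : ∀ v c, P v c ↔ P' v c) (h10 : s'.reg 10 = s.reg 10) (h17 : s'.arr 17 = s.arr 17)
    (h18 : s'.arr 18 = s.arr 18) : QueryInv n m P' s' := by
  obtain ⟨Q, h1, h2, h3, h4⟩ := h
  exact ⟨Q, h1, fun v c => (h2 v c).trans (hP v c), by rw [h10, h3], by rw [h17, h18]; exact h4⟩

theorem QueryInv.concat {P : Fin n → ℕ → Prop} {s s' : Mem} (h : QueryInv n m P s) {v : Fin n}
    {c : ℕ} (hc : c < m - 1) (hP : ¬ P v c) (h10 : s'.reg 10 = s.reg 10 + 1)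
    (h17 : s'.arr 17 = Function.update (s.arr 17) (s.reg 10) v)
    (h18 : s'.arr 18 = Function.update (s.arr 18) (s.reg 10) c) :
    QueryInv n m (fun v' c' => P v' c' ∨ (v' = v ∧ c' = c)) s' := by
  obtain ⟨Q, h1, h2, h3, h4⟩ := h
  refine ⟨Q ++ [(v, ⟨c, hc⟩)], List.Nodup.append h1 (List.nodup_singleton _) ?_, fun v' c' => ?_,
    by simp [h10, h3], fun k q hq => ?_⟩
  · rw [List.disjoint_singleton, h2]
    exact hP
  · simp [h2, Fin.ext_iff]
  · rw [h17, h18, h3]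
    by_cases hk : k < Q.length
    · rw [List.getElem?_append_left hk] at hq
      rw [Function.update_of_ne hk.ne, Function.update_of_ne hk.ne]
      exact h4 k q hq
    · have hk' := (List.getElem?_eq_some_iff.1 hq).1
      have : k = Q.length := by simp at hk'; omega
      subst this
      simp at hq
      simp [← hq]

/-- Handle the vertex number `reg 18` of the hyperedge with rank `reg 8`: note the rank if the vertex is
new, otherwise add an incidence to the query and update the maximal rank. -/
def parentStep : Prog :=
  block [.add 21 20 18, .load 21 7 21, .load 22 16 21] (.ite (.eq 22 5)
    (block [.add 23 8 4, .store 16 21 23] .skip)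
    (block [.store 17 10 21, .store 18 10 9, .add 10 10 4]
      (.ite (.lt 12 22) (block [.move 12 22] .skip) .skip)))

/-- Compute the parents, in array `4`, and the query. -/
def parentProg : Prog :=
  block [.const 10 0, .const 8 0] (forUp 8 1 (block [.load 11 13 8, .load 20 5 11, .load 19 6 11,
    .const 18 0, .const 12 0, .sub 9 8 4] (.seq (forUp 18 19 parentStep)
      (block [.sub 12 12 4, .load 12 13 12, .store 4 11 12] .skip))))

/-- The ranks of the first hyperedges, with `1` added, of the vertices that satisfy `P`. -/
def FirstInv (H : HGraph n m) (rk : Equiv.Perm (Fin m)) (P : Fin n → Prop) (s : Mem) : Prop :=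
  ∀ v, (∃ x, v ∈ H.edge x) → (P v → s.arr 16 v = H.firstPos rk v + 1) ∧ (¬ P v → s.arr 16 v = 0)

variable {K : ℕ} {t : ℕ} {s : Mem} {A : SubsetAlg} {L : List (Fin n × Fin m)} {H : HGraph n m}
  {rk : Equiv.Perm (Fin m)} {root : Fin m} {parent : Fin m → Fin m}

open Classical in
/-- The invariant of the inner loop, after the vertices in `l` have been handled. -/
structure ParentInv (H : HGraph n m) (rk : Equiv.Perm (Fin m)) (i : ℕ) (l : List (Fin n))
    (s : Mem) : Prop where
  first : FirstInv H rk (fun v => H.firstPos rk v < i ∨ v ∈ l) s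
  query : QueryInv n m (fun v c => (c + 1 < i ∧ ∃ x, (rk x : ℕ) = c + 1 ∧ v ∈ H.upSep rk x) ∨
    (c + 1 = i ∧ v ∈ l ∧ H.firstPos rk v < i)) s
  best : s.reg 12 = (l.toFinset.filter fun v => H.firstPos rk v < i).sup
    fun v => H.firstPos rk v + 1

/-- Array `16` holds first positions increased by one, so `0` means that the vertex is new; register
`12` is shifted in the same way. A vertex seen earlier belongs to the up-separator. The separator of
the hyperedge at position `i` has the number `i - 1`, as the root at position `0` has none. -/
theorem wp_parentStep (hL : ListsIncidences H.edge L) (hb : HasBase n m K s) (hadj : HasAdj K L s)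
    {x : Fin m} {a : ℕ} (h8 : s.reg 8 = rk x) (h9 : s.reg 9 = rk x - 1) (h20 : s.reg 20 = x * K)
    (h18 : s.reg 18 = a) (ha : a < (vertsOf L x).length)
    (h : ParentInv H rk (rk x) ((vertsOf L x).take a) s) :
    Wp A parentStep (fun t' s' => t' ≤ t + 10 ∧ ParentInv H rk (rk x) ((vertsOf L x).take (a + 1)) s')
      t s := by
  classical
  set v := (vertsOf L x)[a] with hv
  have hvx : v ∈ H.edge x := (mem_vertsOf hL).1 (List.getElem_mem ha)
  have hfp := H.firstPos_le (pos := rk) hvx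
  have hnd := nodup_vertsOf hL.1 x
  -- A hyperedge lists each vertex once, so an entry for `v` stems from an earlier hyperedge and not
  -- from `x` itself.
  have hnot : v ∉ (vertsOf L x).take a := by
    intro h
    obtain ⟨i, hi, hie⟩ := List.mem_iff_getElem.1 h
    rw [List.getElem_take, hv, hnd.getElem_inj_iff] at hie
    rw [List.length_take] at hi
    omega
  have htake : (vertsOf L x).take (a + 1) = (vertsOf L x).take a ++ [v] := by
    rw [List.take_succ_eq_append_getElem ha]
  have e1 := hadj.verts.get ha
  rw [← hv] at e1
  have hfirst := h.first v ⟨x, hvx⟩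
  rw [htake]
  set l := (vertsOf L x).take a with hl
  simp only [parentStep, wp_block_cons, wp_block_nil, wp_ite]
  simp only [Instr.run_add, Instr.run_load, Instr.run_store, Mem.setReg_reg, Mem.setReg_arr,
    Mem.setArr_reg, Test.holds_eq, Test.holds_lt, Instr.run_move]
  simp only [Nat.reduceEqDiff, if_true, if_false, h20, h18, e1, hb.reg_zero, hb.reg_one, h8, wp_skip]
  have hfirst' : ∀ s' : Mem, s'.arr 16 v = H.firstPos rk v + 1 →
      (∀ w : Fin n, w ≠ v → s'.arr 16 w = s.arr 16 w) →
      FirstInv H rk (fun w => H.firstPos rk w < rk x ∨ w ∈ l ++ [v]) s' := by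
    intro s' h1 h2 w hw
    by_cases hwv : w = v
    · subst hwv
      exact ⟨fun _ => h1, fun h => absurd (.inr (by simp)) h⟩
    · rw [h2 w hwv]
      have := h.first w hw
      simpa [hwv] using this
  constructor
  · intro h0
    have hnew : ¬ H.firstPos rk v < rk x := by
      intro hlt
      rw [hfirst.1 (.inl hlt)] at h0
      omega
    refine ⟨by omega, hfirst' _ ?_ ?_, ?_, ?_⟩
    · simp; omega
    · intro w hw
      simp [Function.update_of_ne (Fin.val_injective.ne hw)]
    · refine h.query.congr (fun w c => ?_) (by simp) (by simp) (by simp)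
      refine or_congr_right (and_congr_right fun _ => ?_)
      constructor
      · exact fun h => ⟨List.mem_append_left _ h.1, h.2⟩
      · rintro ⟨h1, h2⟩
        rw [List.mem_append, List.mem_singleton] at h1
        rcases h1 with h1 | rfl
        exacts [⟨h1, h2⟩, absurd h2 hnew]
    · have : ((l ++ [v]).toFinset.filter fun v => H.firstPos rk v < rk x) =
          l.toFinset.filter fun v => H.firstPos rk v < rk x := by
        ext w
        simp only [mem_filter, List.mem_toFinset, List.mem_append, List.mem_singleton]
        constructor
        · rintro ⟨h1 | rfl, h2⟩
          exacts [⟨h1, h2⟩, absurd h2 hnew]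
        · exact fun h => ⟨.inl h.1, h.2⟩
      rw [this]
      simpa using h.best
  · intro h0
    have hold : H.firstPos rk v < rk x := by
      by_contra hlt
      exact h0 (hfirst.2 (by simp [hlt, hnot]))
    have htop := hfirst.1 (.inl hold)
    have hset : ((l ++ [v]).toFinset.filter fun v => H.firstPos rk v < rk x) =
        insert v (l.toFinset.filter fun v => H.firstPos rk v < rk x) := by
      ext w
      simp only [mem_filter, List.mem_toFinset, List.mem_append, List.mem_singleton, mem_insert]
      constructor
      · rintro ⟨h1 | rfl, h2⟩
        exacts [.inr ⟨h1, h2⟩, .inl rfl]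
      · rintro (rfl | h)
        exacts [⟨.inr rfl, hold⟩, ⟨.inl h.1, h.2⟩]
    have hquery : ∀ s' : Mem, s'.reg 10 = s.reg 10 + 1 →
        s'.arr 17 = Function.update (s.arr 17) (s.reg 10) v →
        s'.arr 18 = Function.update (s.arr 18) (s.reg 10) (rk x - 1) →
        QueryInv n m (fun w c => (c + 1 < rk x ∧ ∃ y, (rk y : ℕ) = c + 1 ∧ w ∈ H.upSep rk y) ∨
          (c + 1 = rk x ∧ w ∈ l ++ [v] ∧ H.firstPos rk w < rk x)) s' := by
      intro s' h1 h2 h3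
      have hx := (rk x).2
      refine (h.query.concat (c := rk x - 1) (by omega) ?_ h1 h2 h3).congr (fun w c => ?_) rfl rfl rfl
      · rintro (⟨h, _⟩ | ⟨_, h, _⟩)
        · omega
        · exact hnot h
      · rw [or_assoc]
        refine or_congr_right ⟨?_, ?_⟩
        · rintro (⟨h1, h2, h3⟩ | ⟨rfl, rfl⟩)
          · exact ⟨h1, List.mem_append_left _ h2, h3⟩
          · exact ⟨by omega, by simp, hold⟩
        · rintro ⟨h1, h2, h3⟩
          rw [List.mem_append, List.mem_singleton] at h2
          rcases h2 with h2 | rfl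
          · exact .inl ⟨h1, h2, h3⟩
          · exact .inr ⟨rfl, by omega⟩
    rw [htop, h9, h.best]
    constructor
    · intro hlt
      refine ⟨by omega, hfirst' _ ?_ ?_, hquery _ ?_ ?_ ?_, ?_⟩
      · simpa using htop
      · intro w hw; simp
      · simp
      · simp
      · simp
      · rw [hset, sup_insert, sup_eq_left.2 hlt.le]
        simp
    · intro hlt
      refine ⟨by omega, hfirst' _ ?_ ?_, hquery _ ?_ ?_ ?_, ?_⟩
      · simpa using htop
      · intro w hw; simp
      · simp
      · simp
      · simp
      · rw [hset, sup_insert, sup_eq_right.2 (not_lt.1 hlt)]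
        simpa using h.best

/-- Undoes the shift of register `12`; truncated subtraction gives the right value `0` for the empty
set. -/
theorem sup_add_one_sub_one {α : Type*} (S : Finset α) (f : α → ℕ) :
    (S.sup fun x => f x + 1) - 1 = S.sup f := by
  classical
  induction S using Finset.induction_on with
  | empty => simp
  | insert a S _ ih =>
    rw [sup_insert, sup_insert, ← ih]
    rcases S.eq_empty_or_nonempty with rfl | ⟨b, hb⟩
    · simp
    · have := le_sup (f := fun x => f x + 1) hb
      omega

/-- The program has computed the query and the parents. -/
structure HasParents (H : HGraph n m) (rk : Equiv.Perm (Fin m)) (root : Fin m)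
    (parent : Fin m → Fin m) (i : ℕ) (s : Mem) : Prop where
  query : QueryInv n m (fun v c => c + 1 < i ∧ ∃ x, (rk x : ℕ) = c + 1 ∧ v ∈ H.upSep rk x) s
  parent_eq : ∀ x, x ≠ root → (rk x : ℕ) < i → s.arr 4 x = parent x

/-- The inner loops sum to the number of incidences. At position `0` all vertices are new, so no
incidence is emitted with the truncated number `0 - 1`; the value stored there as parent of the root
carries no meaning. -/
theorem wp_parentProg (hL : ListsIncidences H.edge L) (hb : HasBase n m K s) (hadj : HasAdj K L s)
    (hK : n + m < K) (hR : H.IsRun root rk parent) (hord : ∀ x : Fin m, s.arr 13 (rk x) = x)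
    (h16 : ∀ i, s.arr 16 i = 0) :
    Wp A parentProg (fun t' s' => t' ≤ t + 13 * m + 12 * L.length + 3 ∧
      HasParents H rk root parent m s') t s := by
  classical
  simp only [parentProg, wp_block_cons, wp_block_nil, Instr.run_const]
  refine wp_forUp (k₀ := 0) (N := m) (fun k t' s' =>
    t' ≤ t + 2 + 13 * k + 12 * ∑ x ∈ univ.filter fun x => (rk x : ℕ) < k, (vertsOf L x).length ∧
      HasParents H rk root parent k s' ∧ FirstInv H rk (fun v => H.firstPos rk v < k) s')
    (by decide) (by simp [hb.reg_m]) (by simp [hb.reg_one]) (by simp) (by simp)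
    ⟨by simp, ⟨⟨[], List.nodup_nil, by simp, by simp, by simp⟩, by simp⟩, ?_⟩ ?_ ?_
  · intro v _
    simp [h16]
  · rintro k t' s' - hk h8 hs ⟨ht, hpar, hfirst⟩
    have hb' := ((hb.setReg 10 0 (by decide)).setReg 8 0 (by decide)).of_same hs (by decide)
    have hadj' : HasAdj K L s' := HasAdj.of_same (s := (s.setReg 10 0).setReg 8 0)
      ⟨hadj.verts, hadj.edges⟩ hs (by decide)
    have hord' : ∀ x : Fin m, s'.arr 13 (rk x) = x := by
      rw [hs.arr 13 (by decide)]; exact hord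
    obtain ⟨x, hx⟩ : ∃ x, (rk x : ℕ) = k := ⟨rk.symm ⟨k, hk⟩, by simp⟩
    subst hx
    have e1 := hadj'.verts.cnt_eq x
    have e2 := hb'.row x (by have := x.2; omega)
    have hsum : ∑ y ∈ univ.filter fun y => (rk y : ℕ) < rk x + 1, (vertsOf L y).length =
        (vertsOf L x).length + ∑ y ∈ univ.filter fun y => (rk y : ℕ) < rk x,
          (vertsOf L y).length := by
      have hset : (univ.filter fun y => (rk y : ℕ) < rk x + 1) =
          insert x (univ.filter fun y => (rk y : ℕ) < rk x) := by
        ext y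
        rw [mem_insert, mem_filter, mem_filter, Nat.lt_succ_iff_lt_or_eq, perm_val_inj]
        simp only [mem_univ, true_and]
        tauto
      rw [hset, sum_insert]
      rw [mem_filter]
      exact fun h => lt_irrefl _ h.2
    rw [hsum]
    simp only [wp_block_cons, wp_block_nil, wp_seq, wp_skip]
    simp only [Instr.run_sub, Instr.run_load, Instr.run_const, Instr.run_store, Mem.setReg_reg,
      Mem.setReg_arr]
    simp only [Nat.reduceEqDiff, if_true, if_false, h8, hord', e1, e2, hb'.reg_one]
    refine wp_forUp (k₀ := 0) (N := (vertsOf L x).length) (fun a t'' s'' =>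
      t'' ≤ t' + 7 + 12 * a ∧ ParentInv H rk (rk x) ((vertsOf L x).take a) s'')
      (by decide) (by simp) (by simp [hb'.reg_one]) (by simp) (by simp)
      ⟨by omega, ?_, ?_, ?_⟩ ?_ ?_
    · simpa [FirstInv] using hfirst
    · exact hpar.query.congr (by simp) (by simp) (by simp) (by simp)
    · simp
    · rintro a t'' s'' - ha h18 hs' ⟨ht', hinv⟩
      have hb'' := ((((((hb'.setReg 11 x (by decide)).setReg 20 (x * K) (by decide)).setReg 19
        (vertsOf L x).length (by decide)).setReg 18 0 (by decide)).setReg 12 0 (by decide)).setReg 9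
        (rk x - 1) (by decide)).of_same hs' (by decide)
      have hadj'' : HasAdj K L s'' := by
        refine HasAdj.of_same ⟨?_, ?_⟩ hs' (by decide)
        · simpa using hadj'.verts
        · simpa using hadj'.edges
      refine (wp_parentStep hL hb'' hadj'' ?_ ?_ ?_ h18 ha hinv).mono ?_
      · rw [hs'.reg 8 (by decide)]; simp [h8]
      · rw [hs'.reg 9 (by decide)]; simp
      · rw [hs'.reg 20 (by decide)]; simp
      · rintro t₃ s₃ ⟨h1, h2⟩
        refine ⟨by omega, ?_, ?_, ?_⟩
        · simpa [FirstInv] using h2.first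
        · exact h2.query.congr (fun _ _ => Iff.rfl) (by simp) (by simp) (by simp)
        · simpa using h2.best
    · rintro t'' s'' - hs' ⟨ht', hinv⟩
      rw [List.take_length] at hinv
      have hmem : ∀ v, v ∈ vertsOf L x ∧ H.firstPos rk v < rk x ↔ v ∈ H.upSep rk x := by
        intro v
        rw [HGraph.mem_upSep, mem_vertsOf hL]
      have hbest : s''.reg 12 - 1 = (H.upSep rk x).sup (H.firstPos rk) := by
        rw [hinv.best, sup_add_one_sub_one]
        congr 1
        ext v
        rw [mem_filter, List.mem_toFinset, hmem]
      have h4 : s''.reg 4 = 1 := by rw [hs'.reg 4 (by decide)]; simp [hb'.reg_one]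
      have h11 : s''.reg 11 = x := by rw [hs'.reg 11 (by decide)]; simp
      have h13 : s''.arr 13 = s'.arr 13 := by rw [hs'.arr 13 (by decide)]; simp
      simp only [h4, hbest, h13, h11]
      refine ⟨by omega, ⟨?_, fun y hyr hy => ?_⟩, ?_⟩
      · refine hinv.query.congr (fun v c => ?_) (by simp) (by simp) (by simp)
        rw [hmem]
        constructor
        · rintro (⟨h1, h2⟩ | ⟨h1, h2⟩)
          · exact ⟨by omega, h2⟩
          · exact ⟨by omega, x, h1.symm, h2⟩
        · rintro ⟨h1, y, hy, h2⟩
          by_cases hyx : (rk y : ℕ) = rk x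
          · rw [perm_val_inj] at hyx
            subst hyx
            exact .inr ⟨hy.symm, h2⟩
          · exact .inl ⟨by omega, y, hy, h2⟩
      · by_cases hyx : y = x
        · subst hyx
          simp [← hR.pos_parent y hyr, hord']
        · have hlt : (rk y : ℕ) < rk x := by
            refine lt_of_le_of_ne (by omega) ?_
            rwa [Ne, perm_val_inj]
          have h4' : s''.arr 4 = s'.arr 4 := by rw [hs'.arr 4 (by decide)]; simp
          simp [Function.update_of_ne (Fin.val_injective.ne hyx), h4', hpar.parent_eq y hyr hlt]
      · intro v hv
        have := hinv.first v hv
        have heq : (H.firstPos rk v < rk x ∨ v ∈ vertsOf L x) ↔ H.firstPos rk v < rk x + 1 := by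
          rw [mem_vertsOf hL]
          constructor
          · rintro (h | h)
            · omega
            · exact Nat.lt_succ_of_le (H.firstPos_le h)
          · intro h
            rcases Nat.lt_succ_iff_lt_or_eq.1 h with h | h
            · exact .inl h
            · obtain ⟨y, hy⟩ := hv
              obtain ⟨z, hz, he⟩ := H.exists_firstPos (pos := rk) hy
              rw [he, perm_val_inj] at h
              exact .inr (h ▸ hz)
        simpa [heq] using this
  · rintro t' s' - hs ⟨ht, hpar, -⟩
    have h1 : ∑ x ∈ univ.filter fun x => (rk x : ℕ) < m, (vertsOf L x).length = L.length := by
      rw [filter_true_of_mem fun x _ => (rk x).2, sum_length_vertsOf]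
    rw [h1] at ht
    exact ⟨by omega, hpar⟩

end Parents

/-! ### Subtree sizes and pre-order numbers by two sweeps -/

section Numbering

variable {n m : ℕ}

/-- Number the hyperedges in a pre-order: array `19` gets the numbers of proper descendants, array `21`
the numbers in the pre-order. -/
def numberProg : Prog :=
  .seq (block [.const 8 1] (forUp 8 1 (block [.sub 9 1 8, .load 11 13 9, .load 12 4 11, .load 13 19 11,
      .add 13 13 4, .load 14 19 12, .add 14 14 13, .store 19 12 14] .skip)))
    (block [.const 8 1] (forUp 8 1 (block [.load 11 13 8, .load 12 4 11, .load 13 21 12, .add 13 13 4,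
      .load 14 20 12, .add 13 13 14, .store 21 11 13, .load 15 19 11, .add 15 15 4, .add 14 14 15,
      .store 20 12 14] .skip)))

variable {K : ℕ} {t : ℕ} {s : Mem} {A : SubsetAlg} {rk : Equiv.Perm (Fin m)} {root : Fin m}
  {parent : Fin m → Fin m}

-- Parents have smaller ranks. The first sweep goes down the ranks, so the size of a subtree is
-- complete before it is added to the parent. The second sweep goes up; array `20` accumulates at
-- each parent the sizes of the children already numbered, which is the offset of the next child.
open Classical in
theorem wp_numberProg (hb : HasBase n m K s)
    (h0 : (rk root : ℕ) = 0) (hrk : RankDecreases root parent fun x => (rk x : ℕ))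
    (hord : ∀ x : Fin m, s.arr 13 (rk x) = x) (hpar : ∀ x, x ≠ root → s.arr 4 x = parent x)
    (h19 : ∀ i, s.arr 19 i = 0) (h20 : ∀ i, s.arr 20 i = 0) (h21 : ∀ i, s.arr 21 i = 0) :
    Wp A numberProg (fun t' s' => t' ≤ t + 25 * m + 4 ∧
      (∀ x : Fin m, s'.arr 19 x + 1 = descCard root parent x) ∧
      ∀ x : Fin m, s'.arr 21 x = preNum root parent rk x) t s := by
  have hm : 1 ≤ m := Nat.one_le_iff_ne_zero.2 fun h => by subst h; exact root.elim0
  simp only [numberProg, wp_seq, wp_block_cons, wp_block_nil, Instr.run_const]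
  -- The condition `m < rk z + k` describes the nodes of rank above `m - k`, those already visited.
  refine wp_forUp (k₀ := 1) (N := m) (fun k t' s' => t' = t + 1 + 11 * (k - 1) ∧
    ∀ x : Fin m, s'.arr 19 x = ∑ z ∈ univ.filter fun z => z ≠ root ∧ parent z = x ∧ m < rk z + k,
      descCard root parent z) (by decide) (by simp [hb.reg_m]) (by simp [hb.reg_one]) (by simp) hm
    ⟨by simp, fun x => ?_⟩ ?_ ?_
  · rw [filter_eq_empty_iff.2, sum_empty]
    · simp [h19]
    · rintro z _ ⟨_, _, h⟩
      have := (rk z).2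
      omega
  · rintro k t' s' hk1 hk h8 hs ⟨ht, hsz⟩
    have hb' := (hb.setReg 8 1 (by decide)).of_same hs (by decide)
    obtain ⟨x, hx⟩ : ∃ x, (rk x : ℕ) = m - k := ⟨rk.symm ⟨m - k, by omega⟩, by simp⟩
    have hxr : x ≠ root := by rintro rfl; omega
    have e13 : s'.arr 13 (m - k) = x := by
      rw [hs.arr 13 (by decide), ← hx]; exact hord x
    have e4 : s'.arr 4 x = parent x := by
      rw [hs.arr 4 (by decide)]; exact hpar x hxr
    have e19 : s'.arr 19 x + 1 = descCard root parent x := by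
      rw [hsz, descCard_eq hrk, add_comm]
      congr 2
      ext z
      simp only [mem_filter, mem_univ, true_and]
      constructor
      · exact fun h => ⟨h.1, h.2.1⟩
      · rintro ⟨h1, rfl⟩
        have : (rk (parent z) : ℕ) < rk z := hrk z h1
        exact ⟨h1, rfl, by omega⟩
    simp [h8, hb'.reg_m, hb'.reg_one, e13, e4, e19, ht]
    refine ⟨by omega, fun y => ?_⟩
    by_cases hy : y = parent x
    · subst hy
      rw [Function.update_self, hsz, add_comm, ← sum_insert]
      · congr 1
        ext z
        simp only [mem_insert, mem_filter, mem_univ, true_and]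
        constructor
        · rintro (rfl | h)
          · exact ⟨hxr, rfl, by omega⟩
          · exact ⟨h.1, h.2.1, by omega⟩
        · rintro ⟨h1, h2, h3⟩
          by_cases hz : z = x
          · exact .inl hz
          · rw [← perm_val_inj (pos := rk)] at hz
            exact .inr ⟨h1, h2, by omega⟩
      · simp only [mem_filter, not_and]
        intros
        omega
    · rw [Function.update_of_ne (Fin.val_injective.ne hy), hsz]
      congr 1
      ext z
      simp only [mem_filter, mem_univ, true_and]
      constructor
      · exact fun h => ⟨h.1, h.2.1, by omega⟩
      · rintro ⟨h1, h2, h3⟩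
        by_cases hz : z = x
        · subst hz; exact absurd h2.symm hy
        · rw [← perm_val_inj (pos := rk)] at hz
          exact ⟨h1, h2, by omega⟩
  · rintro t₁ s₁ - hs₁ ⟨ht₁, hsz₁⟩
    have hb₁ := (hb.setReg 8 1 (by decide)).of_same hs₁ (by decide)
    have a19 : ∀ x : Fin m, s₁.arr 19 x + 1 = descCard root parent x := by
      intro x
      rw [hsz₁, descCard_eq hrk, add_comm]
      congr 2
      ext z
      simp only [mem_filter, mem_univ, true_and]
      constructor
      · exact fun h => ⟨h.1, h.2.1⟩
      · rintro ⟨h1, rfl⟩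
        have : (rk (parent z) : ℕ) < rk z := hrk z h1
        exact ⟨h1, rfl, by omega⟩
    refine wp_forUp (k₀ := 1) (N := m) (fun k t' s' => t' = t₁ + 2 + 14 * (k - 1) ∧
      (∀ x : Fin m, (rk x : ℕ) < k → s'.arr 21 x = preNum root parent rk x) ∧
      ∀ x : Fin m, s'.arr 20 x = ∑ z ∈ univ.filter fun z => z ≠ root ∧ parent z = x ∧ (rk z : ℕ) < k,
        descCard root parent z) (by decide) (by simp [hb₁.reg_m]) (by simp [hb₁.reg_one]) (by simp) hm
      ⟨by simp, fun x hx => ?_, fun x => ?_⟩ ?_ ?_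
    · have hxr : x = root := by
        rw [← perm_val_inj (pos := rk)]
        omega
      rw [hxr, preNum_root, Mem.setReg_arr, hs₁.arr 21 (by decide)]
      exact h21 _
    · rw [filter_eq_empty_iff.2, sum_empty]
      · rw [Mem.setReg_arr, hs₁.arr 20 (by decide)]
        exact h20 _
      · rintro z _ ⟨h1, _, h⟩
        have h1' : (rk z : ℕ) ≠ rk root := by rwa [Ne, perm_val_inj]
        omega
    · rintro k t' s' hk1 hk h8 hs ⟨ht, hpre, hoff⟩
      have hb' := (hb₁.setReg 8 1 (by decide)).of_same hs (by decide)
      obtain ⟨x, hx⟩ : ∃ x, (rk x : ℕ) = k := ⟨rk.symm ⟨k, hk⟩, by simp⟩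
      have hxr : x ≠ root := by rintro rfl; omega
      have e13 : s'.arr 13 k = x := by
        rw [hs.arr 13 (by decide), Mem.setReg_arr, hs₁.arr 13 (by decide), ← hx]; exact hord x
      have e4 : s'.arr 4 x = parent x := by
        rw [hs.arr 4 (by decide), Mem.setReg_arr, hs₁.arr 4 (by decide)]; exact hpar x hxr
      have e19 : s'.arr 19 x + 1 = descCard root parent x := by
        rw [hs.arr 19 (by decide)]; exact a19 x
      have e21 := hpre (parent x) (by have : (rk (parent x) : ℕ) < rk x := hrk x hxr; omega)
      have e20 : s'.arr 20 (parent x) = siblingOffset root parent rk x := by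
        rw [hoff, siblingOffset]
        congr 1
        ext z
        simp only [mem_filter, mem_univ, true_and, ← hx, Fin.val_fin_lt]
      have hnum := preNum_eq hrk hxr
      simp [h8, hb'.reg_one, e13, e4, e19, e21, e20, ht]
      refine ⟨by omega, fun y hy => ?_, fun y => ?_⟩
      · by_cases hyx : y = x
        · subst hyx
          rw [Function.update_self, hnum]
        · rw [Function.update_of_ne (Fin.val_injective.ne hyx)]
          rw [← perm_val_inj (pos := rk)] at hyx
          exact hpre y (by omega)
      · by_cases hy : y = parent x
        · subst hy
          rw [Function.update_self, ← e20, hoff, add_comm, ← sum_insert]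
          · congr 1
            ext z
            simp only [mem_insert, mem_filter, mem_univ, true_and]
            constructor
            · rintro (rfl | h)
              · exact ⟨hxr, rfl, by omega⟩
              · exact ⟨h.1, h.2.1, by omega⟩
            · rintro ⟨h1, h2, h3⟩
              by_cases hz : z = x
              · exact .inl hz
              · rw [← perm_val_inj (pos := rk)] at hz
                exact .inr ⟨h1, h2, by omega⟩
          · simp only [mem_filter, not_and]
            intros
            omega
        · rw [Function.update_of_ne (Fin.val_injective.ne hy), hoff]
          congr 1
          ext z
          simp only [mem_filter, mem_univ, true_and]
          constructor
          · exact fun h => ⟨h.1, h.2.1, by omega⟩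
          · rintro ⟨h1, h2, h3⟩
            by_cases hz : z = x
            · subst hz; exact absurd h2.symm hy
            · rw [← perm_val_inj (pos := rk)] at hz
              exact ⟨h1, h2, by omega⟩
    · rintro t' s' - hs ⟨ht, hpre, -⟩
      refine ⟨by omega, fun x => ?_, fun x => hpre x (rk x).2⟩
      rw [hs.arr 19 (by decide)]
      exact a19 x

end Numbering

/-! ### The call of the subroutine -/

section Call

variable {n m : ℕ} {K : ℕ} {t : ℕ} {s : Mem} {A : SubsetAlg}

/-- Call the subroutine. -/
def callProg : Prog := block [.sub 9 1 4] (.call 0 9 10 17 18 11 22 23)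

theorem pairs_eq_natPairs {a b : ℕ} {s : Mem} {x y len : ℕ} {Q : List (Fin a × Fin b)}
    (hlen : len = Q.length) (h : ∀ (k : ℕ) (q : Fin a × Fin b), Q[k]? = some q →
      s.arr x k = q.1 ∧ s.arr y k = q.2) : s.pairs x y len = natPairs Q := by
  subst hlen
  refine List.ext_getElem (by simp [Mem.pairs, natPairs]) fun k h1 h2 => ?_
  have hk : k < Q.length := by simpa [natPairs] using h2
  obtain ⟨e1, e2⟩ := h k Q[k] (List.getElem?_eq_getElem hk)
  simp [Mem.pairs, natPairs, e1, e2]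

theorem putPairs_get {a b : ℕ} (s : Mem) (D : List (Fin a × Fin b)) {l x y : ℕ} (hxy : x ≠ y) :
    (s.putPairs (natPairs D) l x y).reg l = D.length ∧ ∀ (k : ℕ) (q : Fin a × Fin b),
      D[k]? = some q → (s.putPairs (natPairs D) l x y).arr x k = q.1 ∧
        (s.putPairs (natPairs D) l x y).arr y k = q.2 := by
  refine ⟨by simp [Mem.putPairs, natPairs], fun k q hq => ?_⟩
  have : (natPairs D)[k]? = some ((q.1 : ℕ), (q.2 : ℕ)) := by simp [natPairs, hq]
  simp [Mem.putPairs, this, Function.update_of_ne hxy]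

theorem wp_callProg {Q D : List _} (hb : HasBase n m K s) (h10 : s.reg 10 = Q.length)
    (hQ : ∀ (k : ℕ) (q : Fin n × Fin (m - 1)), Q[k]? = some q →
      s.arr 17 k = q.1 ∧ s.arr 18 k = q.2)
    (hD : A.answer ⟨n, m - 1, natPairs Q⟩ = natPairs (a := m - 1) (b := m - 1) D) :
    Wp A callProg (fun t' s' => t' = t + 2 + A.time ⟨n, m - 1, natPairs Q⟩ ∧
      s'.queries = s.queries ++ [⟨n, m - 1, natPairs Q⟩] ∧ s'.reg 11 = D.length ∧
      ∀ (k : ℕ) (d : Fin (m - 1) × Fin (m - 1)), D[k]? = some d →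
        s'.arr 22 k = d.1 ∧ s'.arr 23 k = d.2) t s := by
  simp only [callProg, wp_block_cons, wp_block_nil, Instr.run_sub]
  set s₁ := s.setReg 9 (s.reg 1 - s.reg 4) with hs₁
  have hq : s₁.query 0 9 10 17 18 = ⟨n, m - 1, natPairs Q⟩ := by
    have h := pairs_eq_natPairs (s := s₁) (x := 17) (y := 18) h10 hQ
    rw [h10] at h
    simp only [Mem.query, Query.mk.injEq]
    refine ⟨by simp [hs₁, hb.reg_n], by simp [hs₁, hb.reg_m, hb.reg_one], ?_⟩
    have : s₁.reg 10 = Q.length := by simp [hs₁, h10]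
    rw [this]
    exact h
  have hc := Exec.call (A := A) 0 9 10 17 18 11 22 23 s₁
  rw [hq, hD] at hc
  obtain ⟨h1, h2⟩ := putPairs_get s₁ D (l := 11) (x := 22) (y := 23) (by decide)
  exact ⟨_, _, hc, by ring, by simp [hs₁], h1, h2⟩

end Call

/-! ### Grouping a list by keys -/

section Collect

variable {ι α δ : Type*} [DecidableEq ι]

/-- For each key `c`, the list `init c` followed by the values of the members of `D` with the property `P`
and with key `c`. -/
def collect (key : δ → ι) (val : δ → α) (P : δ → Prop) [DecidablePred P] (init : ι → List α)
    (D : List δ) (c : ι) : List α :=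
  init c ++ (D.filter fun d => P d ∧ key d = c).map val

variable {key : δ → ι} {val : δ → α} {P : δ → Prop} [DecidablePred P] {init : ι → List α}

theorem collect_nil : collect key val P init [] = init := by
  funext c
  simp [collect]

theorem collect_concat_of_pos {D : List δ} {d : δ} (h : P d) :
    collect key val P init (D ++ [d]) = Function.update (collect key val P init D) (key d)
      (collect key val P init D (key d) ++ [val d]) := by
  funext c
  by_cases hc : c = key d
  · subst hc
    simp [collect, h]
  · simp [collect, Function.update_of_ne hc, Ne.symm hc]

theorem collect_concat_of_neg {D : List δ} {d : δ} (h : ¬ P d) :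
    collect key val P init (D ++ [d]) = collect key val P init D := by
  funext c
  simp [collect, h]

/-- Bounds the rows of a partially filled table by those of the complete one. -/
theorem collect_append_prefix {D D' : List δ} {c : ι} :
    collect key val P init D c <+: collect key val P init (D ++ D') c :=
  ⟨(D'.filter fun d => P d ∧ key d = c).map val, by simp [collect]⟩

end Collect

/-! ### The two sides as lists of arcs -/

section Sides

variable {n m : ℕ} {H : HGraph n m}

/-- The hyperedge whose separator has the number `k`, in the order of positions. -/
def sepOwner (rk : Equiv.Perm (Fin m)) (k : Fin (m - 1)) : Fin m :=
  rk.symm ⟨k + 1, by omega⟩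

variable {rk : Equiv.Perm (Fin m)}

theorem rk_sepOwner (k : Fin (m - 1)) : (rk (sepOwner rk k) : ℕ) = k + 1 := by
  simp [sepOwner]

theorem sepOwner_injective : Function.Injective (sepOwner rk) := fun k k' h => by
  have h1 := rk_sepOwner (rk := rk) k
  rw [h, rk_sepOwner] at h1
  exact Fin.ext (by omega)

variable (R : TreeRun H)

theorem sepOwner_ne_root (h0 : (rk R.root : ℕ) = 0) (k : Fin (m - 1)) : sepOwner rk k ≠ R.root := by
  intro h
  have := rk_sepOwner (rk := rk) k
  rw [h, h0] at this
  omega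

theorem exists_sepOwner (h0 : (rk R.root : ℕ) = 0) {c : Fin m} (hc : c ≠ R.root) :
    ∃ k, sepOwner rk k = c := by
  have h1 := pos_pos_of_ne h0 hc
  have h2 := (rk c).2
  refine ⟨⟨rk c - 1, by omega⟩, ?_⟩
  rw [← perm_val_inj (pos := rk), rk_sepOwner]
  simp only
  omega

open Classical in
/-- The two sides that are collected for each separator, from a list `D` of arcs of the subset graph. -/
noncomputable def sideLists (rk : Equiv.Perm (Fin m)) (below : Prop) (D : List (Fin (m - 1) × Fin (m - 1))) :
    Fin m → List (Fin m) :=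
  collect (fun d => sepOwner rk d.1) (fun d => sepOwner rk d.2)
    (fun d => d.1 ≠ d.2 ∧ (Desc R.root R.parent (sepOwner rk d.1) (sepOwner rk d.2) ↔ below))
    (fun c => if c = R.root then [] else [if below then c else R.parent c]) D

variable {R} {D : List (Fin (m - 1) × Fin (m - 1))}

theorem mem_sideLists {below : Prop} {c x : Fin m} : x ∈ sideLists R rk below D c ↔
    (c ≠ R.root ∧ (below ∧ x = c ∨ ¬ below ∧ x = R.parent c)) ∨
      ∃ d ∈ D, d.1 ≠ d.2 ∧ sepOwner rk d.1 = c ∧ sepOwner rk d.2 = x ∧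
        (Desc R.root R.parent c x ↔ below) := by
  simp only [sideLists, collect, List.mem_append, List.mem_map, List.mem_filter]
  apply or_congr
  · by_cases h1 : c = R.root <;> by_cases h2 : below <;> simp [h1, h2]
  · constructor
    · rintro ⟨d, ⟨hd, h⟩, rfl⟩
      simp only [decide_eq_true_eq] at h
      obtain ⟨⟨h1, h2⟩, rfl⟩ := h
      exact ⟨d, hd, h1, rfl, rfl, h2⟩
    · rintro ⟨d, hd, h1, rfl, rfl, h2⟩
      exact ⟨d, ⟨hd, by simpa using ⟨h1, h2⟩⟩, rfl⟩

/-- Loops may or may not be among the arcs, so they are skipped, and `c` and its parent come from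
the initial lists. All other collected hyperedges are ends of proper arcs. -/
theorem mem_sideLists_iff (h0 : (rk R.root : ℕ) = 0)
    (hD : ListsSubsetGraph (fun k => R.up (sepOwner rk k)) D) {below : Prop} {c x : Fin m}
    (hc : c ≠ R.root) : x ∈ sideLists R rk below D c ↔
      x ∈ R.collected c ∧ (Desc R.root R.parent c x ↔ below) := by
  have hcp : ¬ Desc R.root R.parent c (R.parent c) := not_desc_parent R.isRun.rank hc
  rw [mem_sideLists, R.mem_collected hc]
  constructor
  · rintro (⟨-, ⟨h, rfl⟩ | ⟨h, rfl⟩⟩ | ⟨d, hd, h1, rfl, rfl, h⟩)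
    · exact ⟨.inr ⟨hc, subset_rfl⟩, by simpa [h] using Desc.refl⟩
    · exact ⟨.inl rfl, by simpa [h] using hcp⟩
    · exact ⟨.inr ⟨sepOwner_ne_root R h0 _, (hD.2 _ _ h1).1 hd⟩, h⟩
  · rintro ⟨rfl | ⟨hx, hs⟩, h⟩
    · exact .inl ⟨hc, .inr ⟨fun hb => hcp (h.2 hb), rfl⟩⟩
    · by_cases hxc : x = c
      · subst hxc
        exact .inl ⟨hc, .inl ⟨h.1 .refl, rfl⟩⟩
      · obtain ⟨k, rfl⟩ := exists_sepOwner R h0 hc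
        obtain ⟨k', rfl⟩ := exists_sepOwner R h0 hx
        have hk : k ≠ k' := fun h => hxc (by rw [h])
        exact .inr ⟨(k, k'), (hD.2 k k' hk).2 hs, hk, rfl, rfl, h⟩

theorem toFinset_sideLists_true (h0 : (rk R.root : ℕ) = 0)
    (hD : ListsSubsetGraph (fun k => R.up (sepOwner rk k)) D) {c : Fin m} (hc : c ≠ R.root) :
    (sideLists R rk True D c).toFinset = R.sideOf c c := by
  ext x
  rw [List.mem_toFinset, mem_sideLists_iff h0 hD hc, R.mem_sideOf_self hc]
  simp

theorem toFinset_sideLists_false (h0 : (rk R.root : ℕ) = 0)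
    (hD : ListsSubsetGraph (fun k => R.up (sepOwner rk k)) D) {c : Fin m} (hc : c ≠ R.root) :
    (sideLists R rk False D c).toFinset = R.sideOf c (R.parent c) := by
  ext x
  rw [List.mem_toFinset, mem_sideLists_iff h0 hD hc, R.mem_sideOf_parent hc]
  simp

/-- Otherwise the grandparent of `c` would contain the separator of `c` and precede the parent. So
no arc lists the parent a second time. -/
theorem parent_not_mem_sides {c : Fin m} (hc : c ≠ R.root) (hp : R.parent c ≠ R.root) :
    ¬ R.up c ⊆ R.up (R.parent c) := by
  intro h
  have h1 : R.up c ⊆ H.edge (R.parent (R.parent c)) := by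
    refine h.trans ?_
    rw [R.up_eq_sep hp]
    exact inter_subset_right
  have h2 := R.isRun.pos_parent_le hc h1
  have h3 : (R.pos (R.parent (R.parent c)) : ℕ) < R.pos (R.parent c) := R.isRun.rank _ hp
  omega

theorem nodup_sideLists (h0 : (rk R.root : ℕ) = 0)
    (hD : ListsSubsetGraph (fun k => R.up (sepOwner rk k)) D) (below : Prop) (c : Fin m) :
    (sideLists R rk below D c).Nodup := by
  classical
  unfold sideLists collect
  rw [List.nodup_append]
  refine ⟨by by_cases hc : c = R.root <;> simp [hc], ?_, ?_⟩
  · refine List.Nodup.map_on ?_ (hD.1.filter _)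
    simp only [List.mem_filter, decide_eq_true_eq]
    rintro d ⟨-, -, h1⟩ d' ⟨-, -, h2⟩ h
    exact Prod.ext (sepOwner_injective (h1.trans h2.symm)) (sepOwner_injective h)
  · intro a ha b hb
    by_cases hc : c = R.root
    · simp [hc] at ha
    · simp only [List.mem_map, List.mem_filter, decide_eq_true_eq] at hb
      obtain ⟨d, ⟨hd, ⟨h1, h2⟩, rfl⟩, rfl⟩ := hb
      by_cases hb : below
      · simp only [hc, hb, if_true, if_false, List.mem_singleton] at ha
        rw [ha]
        exact sepOwner_injective.ne h1
      · simp only [hc, hb, if_false, List.mem_singleton] at ha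
        rw [ha]
        intro h
        refine parent_not_mem_sides hc ?_ (by rw [h]; exact (hD.2 _ _ h1).1 hd)
        rw [h]
        exact sepOwner_ne_root R h0 _

/-- A list of hyperedges without repetition has at most `m` members, so no table row overflows at
any stage. -/
theorem length_sideLists_take_le (h0 : (rk R.root : ℕ) = 0)
    (hD : ListsSubsetGraph (fun k => R.up (sepOwner rk k)) D) (below : Prop) (k : ℕ) (c : Fin m) :
    (sideLists R rk below (D.take k) c).length ≤ m := by
  have h1 : sideLists R rk below (D.take k) c <+: sideLists R rk below D c := by
    classical
    conv_rhs => rw [← List.take_append_drop k D]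
    exact collect_append_prefix
  simpa using h1.length_le.trans (nodup_sideLists h0 hD below c).length_le_card

theorem sideLists_nil (below : Prop) : (sideLists R rk below [] : Fin m → List (Fin m)) =
    fun c => if c = R.root then [] else [open Classical in if below then c else R.parent c] := by
  classical
  exact collect_nil

theorem sideLists_concat_of_pos {below : Prop} {d : Fin (m - 1) × Fin (m - 1)}
    (h : d.1 ≠ d.2 ∧ (Desc R.root R.parent (sepOwner rk d.1) (sepOwner rk d.2) ↔ below)) :
    sideLists R rk below (D ++ [d]) = Function.update (sideLists R rk below D) (sepOwner rk d.1)
      (sideLists R rk below D (sepOwner rk d.1) ++ [sepOwner rk d.2]) := by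
  classical
  exact collect_concat_of_pos (P := fun d : Fin (m - 1) × Fin (m - 1) =>
    d.1 ≠ d.2 ∧ (Desc R.root R.parent (sepOwner rk d.1) (sepOwner rk d.2) ↔ below)) h

theorem sideLists_concat_of_neg {below : Prop} {d : Fin (m - 1) × Fin (m - 1)}
    (h : ¬ (d.1 ≠ d.2 ∧ (Desc R.root R.parent (sepOwner rk d.1) (sepOwner rk d.2) ↔ below))) :
    sideLists R rk below (D ++ [d]) = sideLists R rk below D := by
  classical
  exact collect_concat_of_neg (P := fun d : Fin (m - 1) × Fin (m - 1) =>
    d.1 ≠ d.2 ∧ (Desc R.root R.parent (sepOwner rk d.1) (sepOwner rk d.2) ↔ below)) h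

end Sides

/-! ### Collecting the sides -/

section Program

variable {n m : ℕ} {H : HGraph n m} {R : TreeRun H} {K : ℕ} {t : ℕ} {s : Mem} {A : SubsetAlg}
  {rk : Equiv.Perm (Fin m)}

/-- Collect the two sides for each separator: arrays `24`, `25` hold those on the side of the subtree and
arrays `26`, `27` the others. -/
def sidesProg : Prog :=
  .seq (block [.const 8 1] (forUp 8 1 (block
      ([.load 12 13 8, .load 13 4 12] ++ pushCode 24 25 12 12 ++ pushCode 26 27 12 13) .skip)))
    (block [.const 8 0] (forUp 8 11 (block [.load 12 22 8, .load 13 23 8] (.ite (.eq 12 13) .skip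
      (block [.add 12 12 4, .load 12 13 12, .add 13 13 4, .load 13 13 13, .load 14 21 12, .load 15 21 13,
          .load 16 19 12, .add 16 14 16]
        (.ite (.lt 15 14) (block (pushCode 26 27 12 13) .skip)
          (.ite (.lt 16 15) (block (pushCode 26 27 12 13) .skip)
            (block (pushCode 24 25 12 13) .skip))))))))

/-- The tables with the two sides. -/
structure HasSides (K : ℕ) (s : Mem) (LA LB : Fin m → List (Fin m)) : Prop where
  left : IsTable K Fin.val Fin.val (s.arr 24) (s.arr 25) LA
  right : IsTable K Fin.val Fin.val (s.arr 26) (s.arr 27) LB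

/-- The root has no separator, so the loop starts at position `1`. -/
theorem wp_sidesInit (hb : HasBase n m K s) (hK : m + 1 < K) (h0 : (rk R.root : ℕ) = 0)
    (hord : ∀ x : Fin m, s.arr 13 (rk x) = x) (hpar : ∀ x, x ≠ R.root → s.arr 4 x = R.parent x)
    (h24 : ∀ i, s.arr 24 i = 0) (h26 : ∀ i, s.arr 26 i = 0) :
    Wp A (block [.const 8 1] (forUp 8 1 (block
      ([.load 12 13 8, .load 13 4 12] ++ pushCode 24 25 12 12 ++ pushCode 26 27 12 13) .skip)))
      (fun t' s' => t' ≤ t + 17 * m + 2 ∧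
        HasSides K s' (sideLists R rk True []) (sideLists R rk False [])) t s := by
  have hm : 1 ≤ m := Nat.one_le_iff_ne_zero.2 fun h => by subst h; exact R.root.elim0
  simp only [wp_block_cons, wp_block_nil, Instr.run_const]
  refine wp_forUp (k₀ := 1) (N := m) (fun k t' s' => t' = t + 1 + 17 * (k - 1) ∧
    HasSides K s' (fun c => if c ≠ R.root ∧ (rk c : ℕ) < k then [c] else [])
      (fun c => if c ≠ R.root ∧ (rk c : ℕ) < k then [R.parent c] else []))
    (by decide) (by simp [hb.reg_m]) (by simp [hb.reg_one]) (by simp) hm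
    ⟨by simp, ?_⟩ ?_ ?_
  · have h : ∀ c : Fin m, ¬ (c ≠ R.root ∧ (rk c : ℕ) < 1) := fun c hc => by
      have := pos_pos_of_ne h0 hc.1
      omega
    simp only [h, if_false]
    exact ⟨.empty (by simp [h24]), .empty (by simp [h26])⟩
  · rintro k t' s' hk1 hk h8 hs ⟨ht, hsd⟩
    have hb' := (hb.setReg 8 1 (by decide)).of_same hs (by decide)
    obtain ⟨x, hx⟩ : ∃ x, (rk x : ℕ) = k := ⟨rk.symm ⟨k, hk⟩, by simp⟩
    have hxr : x ≠ R.root := by rintro rfl; omega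
    have e13 : s'.arr 13 k = x := by
      rw [hs.arr 13 (by decide), ← hx]; exact hord x
    have e4 : s'.arr 4 x = R.parent x := by
      rw [hs.arr 4 (by decide)]; exact hpar x hxr
    have r1 := hb'.row x (by have := x.2; omega)
    have p1 := hsd.left.push Fin.val_injective (v := x) (x := x) (by simp [hx]; omega)
    have p2 := hsd.right.push Fin.val_injective (v := x) (x := R.parent x) (by simp [hx]; omega)
    have c1 := hsd.left.cnt_eq x
    have c2 := hsd.right.cnt_eq x
    have upd : ∀ f : Fin m → Fin m, Function.update
        (fun c => if c ≠ R.root ∧ (rk c : ℕ) < k then [f c] else []) x [f x] =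
        fun c => if c ≠ R.root ∧ (rk c : ℕ) < k + 1 then [f c] else [] := by
      intro f
      funext c
      by_cases hc : c = x
      · subst hc; simp [hxr, hx]
      · rw [Function.update_of_ne hc]
        have : (rk c : ℕ) ≠ k := by rw [← hx, Ne, perm_val_inj]; exact hc
        congr 2
        simp only [eq_iff_iff]
        omega
    simp only [hx, lt_irrefl, and_false, if_false, List.length_nil, List.nil_append] at p1 p2 c1 c2
    rw [upd fun c => c] at p1
    rw [upd] at p2
    simp [pushCode, h8, e13, e4, r1, c1, c2, hb'.reg_one, ht]
    exact ⟨by omega, by simpa using p1, by simpa using p2⟩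
  · rintro t' s' - hs ⟨ht, hsd⟩
    refine ⟨by omega, ?_⟩
    have e : ∀ (f : Fin m → Fin m), (fun c => if c ≠ R.root ∧ (rk c : ℕ) < m then [f c] else []) =
        fun c => if c = R.root then [] else [f c] := by
      intro f
      funext c
      by_cases hc : c = R.root <;> simp [hc]
    rw [e fun c => c, e] at hsd
    simpa [sideLists_nil] using hsd

/-- Each arc is sorted in constant time by testing whether the pre-order number of its target lies
in the interval of its source. Array `19` omits the node itself, so register `16` is the last number
in the subtree and the test against it is strict. -/
theorem wp_sidesProg {D : List (Fin (m - 1) × Fin (m - 1))} (hb : HasBase n m K s) (hK : m + 1 < K)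
    (h0 : (rk R.root : ℕ) = 0) (hrk : RankDecreases R.root R.parent fun x => (rk x : ℕ))
    (hD : ListsSubsetGraph (fun k => R.up (sepOwner rk k)) D)
    (hord : ∀ x : Fin m, s.arr 13 (rk x) = x) (hpar : ∀ x, x ≠ R.root → s.arr 4 x = R.parent x)
    (h19 : ∀ x : Fin m, s.arr 19 x + 1 = descCard R.root R.parent x)
    (h21 : ∀ x : Fin m, s.arr 21 x = preNum R.root R.parent rk x)
    (hlen : s.reg 11 = D.length)
    (hans : ∀ (k : ℕ) (d : Fin (m - 1) × Fin (m - 1)), D[k]? = some d →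
      s.arr 22 k = d.1 ∧ s.arr 23 k = d.2)
    (h24 : ∀ i, s.arr 24 i = 0) (h26 : ∀ i, s.arr 26 i = 0) :
    Wp A sidesProg (fun t' s' => t' ≤ t + 17 * m + 22 * D.length + 4 ∧
      HasSides K s' (sideLists R rk True D) (sideLists R rk False D)) t s := by
  rw [sidesProg, wp_seq]
  refine (wp_sidesInit hb hK h0 hord hpar h24 h26).same.mono fun t₁ s₁ => ?_
  rintro ⟨⟨ht₁, hsd₁⟩, hs₁⟩
  simp only [wp_block_cons, wp_block_nil, Instr.run_const]
  refine wp_forUp (k₀ := 0) (N := D.length) (fun k t' s' => t' ≤ t₁ + 1 + 22 * k ∧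
    HasSides K s' (sideLists R rk True (D.take k)) (sideLists R rk False (D.take k)))
    (by decide) (by simp [hs₁.reg 11 (by decide), hlen])
    (by simp [hs₁.reg 4 (by decide), hb.reg_one]) (by simp) (by simp)
    ⟨by simp, by simpa using ⟨hsd₁.left, hsd₁.right⟩⟩ ?_ ?_
  · rintro k t' s' - hk h8 hs ⟨ht, hsd⟩
    have hb' := ((hb.of_same hs₁ (by decide)).setReg 8 0 (by decide)).of_same hs (by decide)
    obtain ⟨d, hd⟩ : ∃ d, D[k]? = some d := ⟨D[k], List.getElem?_eq_getElem hk⟩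
    have htake : D.take (k + 1) = D.take k ++ [d] := by
      rw [List.take_add_one, hd]; rfl
    have e22 : s'.arr 22 k = d.1 := by
      rw [hs.arr 22 (by decide), Mem.setReg_arr, hs₁.arr 22 (by decide)]; exact (hans k d hd).1
    have e23 : s'.arr 23 k = d.2 := by
      rw [hs.arr 23 (by decide), Mem.setReg_arr, hs₁.arr 23 (by decide)]; exact (hans k d hd).2
    have eord : ∀ j : Fin (m - 1), s'.arr 13 (j + 1) = sepOwner rk j := fun j => by
      rw [hs.arr 13 (by decide), Mem.setReg_arr, hs₁.arr 13 (by decide), ← rk_sepOwner (rk := rk)]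
      exact hord _
    have e19 : ∀ x : Fin m, s'.arr 19 x + 1 = descCard R.root R.parent x := fun x => by
      rw [hs.arr 19 (by decide), Mem.setReg_arr, hs₁.arr 19 (by decide)]; exact h19 x
    have e21 : ∀ x : Fin m, s'.arr 21 x = preNum R.root R.parent rk x := fun x => by
      rw [hs.arr 21 (by decide), Mem.setReg_arr, hs₁.arr 21 (by decide)]; exact h21 x
    have r1 := hb'.row (sepOwner rk d.1) (by have := (sepOwner rk d.1).2; omega)
    have hA := length_sideLists_take_le h0 hD True k (sepOwner rk d.1)
    have hB := length_sideLists_take_le h0 hD False k (sepOwner rk d.1)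
    have p1 := hsd.left.push Fin.val_injective (v := sepOwner rk d.1) (x := sepOwner rk d.2)
      (by omega)
    have p2 := hsd.right.push Fin.val_injective (v := sepOwner rk d.1) (x := sepOwner rk d.2)
      (by omega)
    have c1 := hsd.left.cnt_eq (sepOwner rk d.1)
    have c2 := hsd.right.cnt_eq (sepOwner rk d.1)
    have hdesc := desc_iff_preNum hrk (sepOwner rk d.1) (sepOwner rk d.2)
    rw [← e19, ← e21, ← e21] at hdesc
    rw [htake]
    simp only [wp_block_cons, wp_block_nil, wp_ite, Instr.run_load]
    by_cases hdd : d.1 = d.2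
    · rw [sideLists_concat_of_neg fun h => h.1 hdd, sideLists_concat_of_neg fun h => h.1 hdd]
      simp [h8, e22, e23, hdd]
      exact ⟨by omega, hsd.left, hsd.right⟩
    · have hne : (d.1 : ℕ) ≠ d.2 := Fin.val_injective.ne hdd
      by_cases hds : Desc R.root R.parent (sepOwner rk d.1) (sepOwner rk d.2)
      · rw [sideLists_concat_of_pos (below := True) ⟨hdd, by simp [hds]⟩,
          sideLists_concat_of_neg (below := False) fun h => h.2.1 hds]
        have h1 := hdesc.1 hds
        have h2 : ¬ s'.arr 21 (sepOwner rk d.2) < s'.arr 21 (sepOwner rk d.1) := by omega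
        have h3 : ¬ s'.arr 21 (sepOwner rk d.1) + s'.arr 19 (sepOwner rk d.1) <
          s'.arr 21 (sepOwner rk d.2) := by omega
        simp [pushCode, h8, e22, e23, hne, hb'.reg_one, eord, h2, h3, r1, c1]
        exact ⟨by omega, by simpa using p1, by simpa using hsd.right⟩
      · rw [sideLists_concat_of_pos (below := False) ⟨hdd, by simp [hds]⟩,
          sideLists_concat_of_neg (below := True) fun h => hds (h.2.2 trivial)]
        simp [pushCode, h8, e22, e23, hne, hb'.reg_one, eord, r1, c2]
        refine ⟨fun _ => ⟨by omega, by simpa using hsd.left, by simpa using p2⟩, fun h1 =>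
          ⟨fun _ => ⟨by omega, by simpa using hsd.left, by simpa using p2⟩, fun h2 => ?_⟩⟩
        exact absurd (hdesc.2 ⟨h1, by omega⟩) hds
  · rintro t' s' - hs ⟨ht, hsd⟩
    rw [List.take_length] at hsd
    exact ⟨by omega, hsd⟩

end Program

/-! ### The size of the subset graph -/

section Counting

variable {n m : ℕ} {H : HGraph n m} {R : TreeRun H} {rk : Equiv.Perm (Fin m)}
  {D : List (Fin (m - 1) × Fin (m - 1))}

theorem card_addedFor (c : Fin m) : Multiset.card (R.addedFor c) =
    (R.sideOf c c).card * (R.sideOf c (R.parent c)).card := by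
  rw [TreeRun.addedFor, Multiset.card_map, card_val, card_product]

/-- Both sides are non-empty, since `c` and its parent are collected, and a + b ≤ 1 + ab for
positive a, b. -/
theorem card_collected_le {c : Fin m} (hc : c ≠ R.root) :
    (R.collected c).card ≤ 1 + Multiset.card (R.addedFor c) := by
  classical
  have h1 : R.sideOf c c = (R.collected c).filter fun x => Desc R.root R.parent c x := by
    ext x; rw [R.mem_sideOf_self hc, mem_filter]
  have h2 : R.sideOf c (R.parent c) =
      (R.collected c).filter fun x => ¬ Desc R.root R.parent c x := by
    ext x; rw [R.mem_sideOf_parent hc, mem_filter]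
  have h3 : 0 < (R.sideOf c c).card := card_pos.2
    ⟨c, (R.mem_sideOf_self hc).2 ⟨(R.mem_collected hc).2 (.inr ⟨hc, subset_rfl⟩), .refl⟩⟩
  have h4 : 0 < (R.sideOf c (R.parent c)).card := card_pos.2 ⟨R.parent c,
    (R.mem_sideOf_parent hc).2 ⟨(R.mem_collected hc).2 (.inl rfl), not_desc_parent R.isRun.rank hc⟩⟩
  rw [card_addedFor, ← card_filter_add_card_filter_not fun x => Desc R.root R.parent c x, ← h1, ← h2]
  nlinarith

/-- The subset graph of the separators has hardly more arcs than the loop adds edges. -/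
theorem length_subsetGraph_le (h0 : (rk R.root : ℕ) = 0)
    (hD : ListsSubsetGraph (fun k => R.up (sepOwner rk k)) D) :
    D.length ≤ m + Multiset.card R.added := by
  classical
  have h1 : D.length = ∑ k, (D.toFinset.filter fun d => d.1 = k).card := by
    rw [← card_eq_sum_card_fiberwise fun _ _ => mem_univ _, List.toFinset_card_of_nodup hD.1]
  -- The targets of the arcs out of `k`, a possible loop included, are distinct collected
  -- hyperedges.
  have h2 : ∀ k, (D.toFinset.filter fun d => d.1 = k).card ≤
      1 + Multiset.card (R.addedFor (sepOwner rk k)) := by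
    intro k
    have hk := sepOwner_ne_root R h0 k
    refine le_trans ?_ (card_collected_le hk)
    refine card_le_card_of_injOn (fun d => sepOwner rk d.2) ?_ ?_
    · intro d hd
      simp only [coe_filter, List.mem_toFinset, Set.mem_ofPred_eq] at hd
      obtain ⟨hd, rfl⟩ := hd
      rw [mem_coe, R.mem_collected hk]
      refine .inr ⟨sepOwner_ne_root R h0 _, ?_⟩
      by_cases h : d.1 = d.2
      · rw [h]
      · exact (hD.2 _ _ h).1 hd
    · intro d hd d' hd' h
      simp only [coe_filter, Set.mem_ofPred_eq] at hd hd'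
      exact Prod.ext (hd.2.trans hd'.2.symm) (sepOwner_injective h)
  have h3 : ∑ k, Multiset.card (R.addedFor (sepOwner rk k)) ≤ Multiset.card R.added := by
    rw [R.added_eq_sum, Multiset.card_sum,
      ← sum_image (f := fun c => Multiset.card (R.addedFor c)) sepOwner_injective.injOn]
    refine sum_le_sum_of_subset fun c hc => ?_
    obtain ⟨k, -, rfl⟩ := mem_image.1 hc
    exact mem_erase.2 ⟨sepOwner_ne_root R h0 k, mem_univ _⟩
  rw [h1]
  refine (sum_le_sum fun k _ => h2 k).trans ?_
  rw [sum_add_distrib]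
  simp
  omega

end Counting

/-! ### Output of the added pairs and of the graph -/

section Output

variable {n m : ℕ} {K : ℕ} {t : ℕ} {s : Mem} {A : SubsetAlg}

/-- Record the edge in the registers `12`, `13`, and list it in the graph if it is new. -/
def emitProg : Prog :=
  block [.store 2 10 12, .store 3 10 13, .add 10 10 4, .add 17 14 13, .load 21 28 17]
    (.ite (.eq 21 5) (block [.store 28 17 4, .load 21 5 13, .add 21 21 12, .store 28 21 4, .store 0 9 12,
      .store 1 9 13, .add 9 9 4] .skip) .skip)

/-- The pairs recorded so far are `E`, and `G` lists the edges among them. -/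
structure HasOutput (K : ℕ) (E G : List (Fin m × Fin m)) (s : Mem) : Prop where
  length_added : s.reg 10 = E.length
  added : ∀ (k : ℕ) (q : Fin m × Fin m), E[k]? = some q → s.arr 2 k = q.1 ∧ s.arr 3 k = q.2
  length_graph : s.reg 9 = G.length
  graph : ∀ (k : ℕ) (q : Fin m × Fin m), G[k]? = some q → s.arr 0 k = q.1 ∧ s.arr 1 k = q.2
  nodup : (G.map fun q => s(q.1, q.2)).Nodup
  mem_iff : ∀ e, e ∈ (G.map fun q => s(q.1, q.2)) ↔ e ∈ (E.map fun q => s(q.1, q.2))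
  mark : ∀ x y : Fin m, s.arr 28 (x * K + y) = if s(x, y) ∈ (E.map fun q => s(q.1, q.2)) then 1 else 0

theorem HasOutput.congr {E G : List (Fin m × Fin m)} {s' : Mem} (h : HasOutput K E G s)
    (hr : ∀ r ∈ [9, 10], s'.reg r = s.reg r) (ha : ∀ a ∈ [0, 1, 2, 3, 28], s'.arr a = s.arr a) :
    HasOutput K E G s' := by
  simp only [List.mem_cons, List.not_mem_nil, or_false, forall_eq_or_imp, forall_eq] at hr ha
  obtain ⟨r9, r10⟩ := hr
  obtain ⟨a0, a1, a2, a3, a28⟩ := ha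
  exact ⟨r10 ▸ h.length_added, a2 ▸ a3 ▸ h.added, r9 ▸ h.length_graph, a0 ▸ a1 ▸ h.graph, h.nodup,
    h.mem_iff, a28 ▸ h.mark⟩

theorem getElem?_concat_update {α : Type*} {l : List α} {f : ℕ → ℕ} {g : α → ℕ} {x : α}
    (h : ∀ k q, l[k]? = some q → f k = g q) :
    ∀ k q, (l ++ [x])[k]? = some q → Function.update f l.length (g x) k = g q := by
  intro k q hq
  by_cases hk : k < l.length
  · rw [List.getElem?_append_left hk] at hq
    rw [Function.update_of_ne (by omega)]
    exact h k q hq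
  · have h1 := (List.getElem?_eq_some_iff.1 hq).1
    simp only [List.length_append, List.length_singleton] at h1
    obtain rfl : k = l.length := by omega
    simp only [List.getElem?_concat_length, Option.some.injEq] at hq
    rw [Function.update_self, hq]

theorem ite_ite_ite_eq (p q r : Prop) [Decidable p] [Decidable q] [Decidable r] [Decidable (p ∨ q ∨ r)] :
    (if r then 1 else if q then 1 else if p then 1 else 0) = if p ∨ q ∨ r then 1 else 0 := by
  by_cases p <;> by_cases q <;> by_cases r <;> simp_all

/-- Array `28` is an adjacency matrix with rows of width `K`. It starts out as zero and needs no
initialisation; both orders of a pair are marked, so a repeated edge is recognised in constant time.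
-/
theorem wp_emitProg {E G : List (Fin m × Fin m)} {x y : Fin m} (hb : HasBase n m K s) (hK : m ≤ K)
    (h : HasOutput K E G s) (h12 : s.reg 12 = x) (h13 : s.reg 13 = y) (h14 : s.reg 14 = x * K) :
    Wp A emitProg (fun t' s' => t' ≤ t + 14 ∧ ∃ G', HasOutput K (E ++ [(x, y)]) G' s') t s := by
  have e28 := h.mark x y
  have r1 := hb.row y (y.2.trans_le hK)
  have a2 := getElem?_concat_update (x := (x, y)) fun k q hq => (h.added k q hq).1
  have a3 := getElem?_concat_update (x := (x, y)) fun k q hq => (h.added k q hq).2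
  by_cases hmem : s(x, y) ∈ E.map fun q => s(q.1, q.2)
  · rw [if_pos hmem] at e28
    simp [emitProg, h12, h13, h14, h.length_added, hb.reg_one, hb.reg_zero, e28]
    refine ⟨G, ⟨by simp, fun k q hq => ?_, by simpa using h.length_graph, by simpa using h.graph, h.nodup,
      fun e => ?_, fun a b => ?_⟩⟩
    · simpa using ⟨a2 k q hq, a3 k q hq⟩
    · rw [h.mem_iff, List.map_append, List.mem_append, List.map_singleton, List.mem_singleton]
      refine ⟨.inl, ?_⟩
      rintro (h | rfl)
      exacts [h, hmem]
    · rw [List.map_append]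
      simp only [List.mem_append, List.map_singleton, List.mem_singleton]
      have h1 : (s(a, b) ∈ E.map (fun q => s(q.1, q.2)) ∨ s(a, b) = s(x, y)) ↔
          s(a, b) ∈ E.map fun q => s(q.1, q.2) := by
        refine ⟨?_, .inl⟩
        rintro (h | h)
        exacts [h, h ▸ hmem]
      simp only [h1]
      simpa using h.mark a b
  · rw [if_neg hmem] at e28
    have a0 := getElem?_concat_update (x := (x, y)) fun k q hq => (h.graph k q hq).1
    have a1 := getElem?_concat_update (x := (x, y)) fun k q hq => (h.graph k q hq).2
    simp [emitProg, h12, h13, h14, h.length_added, h.length_graph, hb.reg_one, hb.reg_zero, e28, r1]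
    refine ⟨G ++ [(x, y)], ⟨by simp, fun k q hq => ?_, by simp, fun k q hq => ?_, ?_,
      fun e => ?_, fun a b => ?_⟩⟩
    · simpa using ⟨a2 k q hq, a3 k q hq⟩
    · simpa using ⟨a0 k q hq, a1 k q hq⟩
    · rw [List.map_append, List.nodup_append]
      refine ⟨h.nodup, by simp, ?_⟩
      intro a ha b hb' hab
      simp only [List.map_singleton, List.mem_singleton] at hb'
      rw [hab, hb', h.mem_iff] at ha
      exact hmem ha
    · rw [List.map_append, List.map_append, List.mem_append, List.mem_append, h.mem_iff]
    · rw [List.map_append]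
      simp only [List.mem_append, List.map_singleton, List.mem_singleton]
      have hinj : ∀ c d : Fin m, (a : ℕ) * K + b = c * K + d ↔ a = c ∧ b = d := by
        intro c d
        constructor
        · intro he
          have := mul_add_inj (b.2.trans_le hK) (d.2.trans_le hK) he
          exact ⟨Fin.ext this.1, Fin.ext this.2⟩
        · rintro ⟨rfl, rfl⟩; rfl
      simp only [Mem.setReg_arr, Mem.setArr_arr, Nat.reduceEqDiff, if_true, if_false]
      simp [Function.update_apply, hinj, h.mark]
      exact ite_ite_ite_eq ..

variable {H : HGraph n m} {R : TreeRun H} {rk : Equiv.Perm (Fin m)}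

/-- Emit all pairs from the two sides of each separator. -/
def pairsProg : Prog :=
  block [.const 9 0, .const 10 0, .const 8 1] (forUp 8 1
    (block [.load 11 13 8, .load 20 5 11, .load 19 24 11, .const 18 0] (forUp 18 19
      (block [.add 12 20 18, .load 12 25 12, .load 14 5 12, .load 15 26 11, .const 16 0] (forUp 16 15
        (block [.add 13 20 16, .load 13 27 13] emitProg))))))

theorem take_add_one_product {α β : Type*} {l : List α} {l' : List β} {i : ℕ} (hi : i < l.length) :
    (l.take (i + 1)) ×ˢ l' = (l.take i) ×ˢ l' ++ l'.map (Prod.mk l[i]) := by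
  rw [List.take_succ_eq_append_getElem hi]
  simp only [SProd.sprod, List.product]
  rw [List.flatMap_append, List.flatMap_singleton]

theorem addedFor_eq_coe {LA LB : List (Fin m)} {c : Fin m} (hA : LA.Nodup) (hB : LB.Nodup)
    (hA' : LA.toFinset = R.sideOf c c) (hB' : LB.toFinset = R.sideOf c (R.parent c)) :
    R.addedFor c = ((LA ×ˢ LB).map fun q => s(q.1, q.2) : List (Sym2 (Fin m))) := by
  rw [TreeRun.addedFor, ← hA', ← hB', product_val, List.toFinset_val, List.toFinset_val, hA.dedup,
    hB.dedup, Multiset.coe_product, Multiset.map_coe]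

/-- A pair costs 18 steps, and each member of the first side 8 more. As the second side is
non-empty, the latter are charged to pairs as well, 26 steps per pair in all. -/
theorem wp_pairsProg {LA LB : Fin m → List (Fin m)} (hb : HasBase n m K s) (hK : m ≤ K)
    (h0 : (rk R.root : ℕ) = 0) (hord : ∀ x : Fin m, s.arr 13 (rk x) = x)
    (hsd : HasSides K s LA LB) (hA : ∀ c, (LA c).Nodup) (hB : ∀ c, (LB c).Nodup)
    (hA' : ∀ c, c ≠ R.root → (LA c).toFinset = R.sideOf c c)
    (hB' : ∀ c, c ≠ R.root → (LB c).toFinset = R.sideOf c (R.parent c))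
    (h28 : ∀ i, s.arr 28 i = 0) :
    Wp A pairsProg (fun t' s' => t' ≤ t + 7 * m + 26 * Multiset.card R.added + 4 ∧
      ∃ E G : List (Fin m × Fin m), HasOutput K E G s' ∧
        (E.map fun q => s(q.1, q.2) : Multiset (Sym2 (Fin m))) = R.added) t s := by
  classical
  have hm : 1 ≤ m := Nat.one_le_iff_ne_zero.2 fun h => by subst h; exact R.root.elim0
  simp only [pairsProg, wp_block_cons, wp_block_nil, Instr.run_const]
  refine wp_forUp (k₀ := 1) (N := m) (fun k t' s' => ∃ E G : List (Fin m × Fin m), t' ≤ t + 3 + 7 * (k - 1) + 26 * E.length ∧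
      HasOutput K E G s' ∧ (E.map fun q => s(q.1, q.2) : Multiset (Sym2 (Fin m))) =
        ∑ c ∈ univ.filter fun c => c ≠ R.root ∧ (rk c : ℕ) < k, R.addedFor c)
    (by decide) (by simp [hb.reg_m]) (by simp [hb.reg_one]) (by simp) hm
    ⟨[], [], by simp, ⟨by simp, by simp, by simp, by simp, by simp, by simp, by simp [h28]⟩, ?_⟩ ?_ ?_
  · rw [filter_eq_empty_iff.2, sum_empty]
    · simp
    · rintro c - ⟨hc, h⟩
      have := pos_pos_of_ne h0 hc
      omega
  · rintro k t₁ s₁ hk1 hk h8 hs₁ ⟨E, G, ht₁, hout, hsum⟩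
    have hb₁ := (((hb.setReg 9 0 (by decide)).setReg 10 0 (by decide)).setReg 8 1 (by decide)).of_same
      hs₁ (by decide)
    obtain ⟨c, hc⟩ : ∃ c, (rk c : ℕ) = k := ⟨rk.symm ⟨k, hk⟩, by simp⟩
    have hcr : c ≠ R.root := by rintro rfl; omega
    have hadd := addedFor_eq_coe (hA c) (hB c) (hA' c hcr) (hB' c hcr)
    have hBpos : 1 ≤ (LB c).length := by
      rw [← List.toFinset_card_of_nodup (hB c), hB' c hcr, Nat.one_le_iff_ne_zero, Ne, card_eq_zero]
      exact ne_empty_of_mem ((R.mem_sideOf_parent hcr).2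
        ⟨(R.mem_collected hcr).2 (.inl rfl), not_desc_parent R.isRun.rank hcr⟩)
    have e13 : s₁.arr 13 k = c := by
      rw [hs₁.arr 13 (by decide), ← hc]; exact hord c
    have e24 : s₁.arr 24 c = (LA c).length := by
      rw [hs₁.arr 24 (by decide)]; exact hsd.left.cnt_eq c
    have e26 : s₁.arr 26 c = (LB c).length := by
      rw [hs₁.arr 26 (by decide)]; exact hsd.right.cnt_eq c
    have e25 : ∀ (i : ℕ) (hi : i < (LA c).length), s₁.arr 25 (c * K + i) = (LA c)[i] := fun i hi => by
      rw [hs₁.arr 25 (by decide)]; exact hsd.left.get hi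
    have e27 : ∀ (i : ℕ) (hi : i < (LB c).length), s₁.arr 27 (c * K + i) = (LB c)[i] := fun i hi => by
      rw [hs₁.arr 27 (by decide)]; exact hsd.right.get hi
    have r1 := hb₁.row c (c.2.trans_le hK)
    simp only [wp_block_cons, wp_block_nil, Instr.run_const, Instr.run_load]
    simp only [Mem.setReg_reg, Mem.setReg_arr, Nat.reduceEqDiff, if_true, if_false, h8, e13, e24, r1]
    refine wp_forUp (k₀ := 0) (N := (LA c).length) (fun i t' s' => ∃ G,
        t' ≤ t₁ + 5 + (8 + 18 * (LB c).length) * i ∧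
        HasOutput K (E ++ ((LA c).take i) ×ˢ (LB c)) G s')
      (by decide) (by simp) (by simp [hb₁.reg_one]) (by simp) (by simp)
      ⟨G, by simp, ?_⟩ ?_ ?_
    · have : E ++ (List.take 0 (LA c)) ×ˢ (LB c) = E := by simp [SProd.sprod, List.product]
      rw [this]
      exact hout.congr (by simp) (by simp)
    · rintro i t₂ s₂ - hi h18 hs₂ ⟨G, ht₂, hout⟩
      have hb₂ := ((((hb₁.setReg 11 c (by decide)).setReg 20 (c * K) (by decide)).setReg 19
        (LA c).length (by decide)).setReg 18 0 (by decide)).of_same hs₂ (by decide)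
      have f20 : s₂.reg 20 = c * K := by rw [hs₂.reg 20 (by decide)]; simp
      have f11 : s₂.reg 11 = c := by rw [hs₂.reg 11 (by decide)]; simp
      have f25 : s₂.arr 25 (c * K + i) = (LA c)[i] := by
        rw [hs₂.arr 25 (by decide)]; exact e25 i hi
      have f26 : s₂.arr 26 c = (LB c).length := by
        rw [hs₂.arr 26 (by decide)]; exact e26
      have r2 := hb₂.row (LA c)[i] ((LA c)[i].2.trans_le hK)
      simp only [wp_block_cons, wp_block_nil, Instr.run_const, Instr.run_load, Instr.run_add]
      simp only [Mem.setReg_reg, Mem.setReg_arr, Nat.reduceEqDiff, if_true, if_false, h18, f20, f11,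
        f25, f26, r2]
      refine wp_forUp (k₀ := 0) (N := (LB c).length) (fun j t' s' => ∃ G,
          t' ≤ t₂ + 6 + 18 * j ∧
          HasOutput K (E ++ ((LA c).take i) ×ˢ (LB c) ++ ((LB c).take j).map (Prod.mk (LA c)[i])) G s')
        (by decide) (by simp) (by simp [hb₂.reg_one]) (by simp) (by simp)
        ⟨G, by omega, ?_⟩ ?_ ?_
      · simp only [List.take_zero, List.map_nil, List.append_nil]
        exact hout.congr (by simp) (by simp)
      · rintro j t₃ s₃ - hj h16 hs₃ ⟨G, ht₃, hout⟩
        have hb₃ := (((((hb₂.setReg 12 (c * K + i) (by decide)).setReg 12 (LA c)[i] (by decide)).setReg 14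
          ((LA c)[i] * K) (by decide)).setReg 15 (LB c).length (by decide)).setReg 16 0
          (by decide)).of_same hs₃ (by decide)
        have g20 : s₃.reg 20 = c * K := by rw [hs₃.reg 20 (by decide)]; simpa using f20
        have g12 : s₃.reg 12 = (LA c)[i] := by rw [hs₃.reg 12 (by decide)]; simp
        have g14 : s₃.reg 14 = (LA c)[i] * K := by rw [hs₃.reg 14 (by decide)]; simp
        have g27 : s₃.arr 27 (c * K + j) = (LB c)[j] := by
          rw [hs₃.arr 27 (by decide), Mem.setReg_arr, Mem.setReg_arr, Mem.setReg_arr, Mem.setReg_arr,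
            Mem.setReg_arr, hs₂.arr 27 (by decide)]
          exact e27 j hj
        simp only [wp_block_cons, wp_block_nil, Instr.run_load, Instr.run_add]
        simp only [Mem.setReg_reg, Mem.setReg_arr, if_true, h16, g20, g27]
        refine (wp_emitProg (x := (LA c)[i]) (y := (LB c)[j]) (E := E ++ ((LA c).take i) ×ˢ (LB c) ++
            ((LB c).take j).map (Prod.mk (LA c)[i])) (G := G)
          ((hb₃.setReg 13 _ (by decide)).setReg 13 _ (by decide)) hK
          (hout.congr (by simp) (by simp)) (by simpa using g12) (by simp) (by simpa using g14)).mono ?_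
        rintro t₄ s₄ ⟨ht₄, G', hout'⟩
        refine ⟨G', by omega, ?_⟩
        rw [List.take_succ_eq_append_getElem hj, List.map_append, ← List.append_assoc]
        exact hout'.congr (by simp) (by simp)
      · rintro t₃ s₃ - hs₃ ⟨G, ht₃, hout⟩
        refine ⟨G, by rw [Nat.mul_succ]; omega, ?_⟩
        rw [take_add_one_product hi, ← List.append_assoc]
        rw [List.take_length] at hout
        exact hout.congr (by simp) (by simp)
    · rintro t₂ s₂ - hs₂ ⟨G, ht₂, hout⟩
      rw [List.take_length] at hout
      refine ⟨_, G, ?_, hout.congr (by simp) (by simp), ?_⟩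
      · have hl : ((LA c) ×ˢ (LB c)).length = (LA c).length * (LB c).length := List.length_product _ _
        rw [List.length_append, hl]
        obtain ⟨b, hb'⟩ := Nat.exists_eq_add_of_le hBpos
        rw [hb'] at ht₂ ⊢
        have : (8 + 18 * (1 + b)) * (LA c).length ≤ 26 * ((LA c).length * (1 + b)) := by nlinarith
        omega
      · rw [List.map_append, ← Multiset.coe_add, hsum, ← hadd, add_comm, ← sum_insert]
        · congr 1
          ext z
          simp only [mem_insert, mem_filter, mem_univ, true_and]
          constructor
          · rintro (rfl | h)
            · exact ⟨hcr, by omega⟩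
            · exact ⟨h.1, by omega⟩
          · rintro ⟨h1, h2⟩
            by_cases hz : z = c
            · exact .inl hz
            · rw [← perm_val_inj (pos := rk)] at hz
              exact .inr ⟨h1, by omega⟩
        · simp [hc]
  · rintro t' s' - hs ⟨E, G, ht, hout, hsum⟩
    have hE : (E.map fun q => s(q.1, q.2) : Multiset (Sym2 (Fin m))) = R.added := by
      rw [hsum, R.added_eq_sum]
      congr 1
      ext c
      simp
    have hlen : E.length = Multiset.card R.added := by
      rw [← hE]; simp
    exact ⟨by omega, E, G, hout, hE⟩

/-- Put the results where they are expected. -/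
def finishProg : Prog := block [.move 1 10, .load 2 13 5] (.instr (.move 0 9))

theorem wp_finishProg {E G : List (Fin m × Fin m)} (hb : HasBase n m K s) (hout : HasOutput K E G s)
    (h0 : (rk R.root : ℕ) = 0) (hord : ∀ x : Fin m, s.arr 13 (rk x) = x) :
    Wp A finishProg (fun t' s' => t' = t + 3 ∧ s'.pairs 2 3 (s'.reg 1) = natPairs E ∧
      s'.pairs 0 1 (s'.reg 0) = natPairs G ∧ s'.reg 2 = R.root) t s := by
  have e13 := hord R.root
  rw [h0] at e13
  simp only [finishProg, wp_block_cons, wp_block_nil]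
  refine wp_instr ⟨rfl, pairs_eq_natPairs ?_ ?_, pairs_eq_natPairs ?_ ?_, ?_⟩
  · simp [hout.length_added]
  · simpa using hout.added
  · simp [hout.length_graph]
  · simpa using hout.graph
  · simp [hb.reg_zero, e13]

theorem HasOutput.listsEdges {E G : List (Fin m × Fin m)} (hout : HasOutput K E G s)
    (hE : (E.map fun q => s(q.1, q.2) : Multiset (Sym2 (Fin m))) = R.added) : ListsEdges R.graph G := by
  refine ⟨hout.nodup, fun e => ?_⟩
  rw [hout.mem_iff, ← Multiset.mem_coe, hE, R.graph_eq]
  induction e with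
  | h i j => rw [R.mem_added_iff, SimpleGraph.mem_edgeSet]

end Output

/-! ### Comparison of the parameters with the total size -/

section Sizes

variable {n m : ℕ} {H : HGraph n m}

theorem HGraph.exists_mem_edge_of_connected (hconn : H.incidenceGraph.Connected) (hm : 0 < m)
    (v : Fin n) : ∃ i, v ∈ H.edge i := by
  obtain ⟨w⟩ := hconn.preconnected (Sum.inl v) (Sum.inr ⟨0, hm⟩)
  cases w with
  | cons h _ =>
    rw [incidenceGraph, SimpleGraph.fromRel_adj] at h
    rcases h.2 with ⟨v', i, h1, -, h3⟩ | ⟨v', i, -, h2, -⟩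
    · exact ⟨i, by rwa [Sum.inl.inj h1]⟩
    · simp at h2

/-- Connectedness excludes isolated vertices. So tables of length proportional to `n` are
affordable. -/
theorem HGraph.verts_le_size (hconn : H.incidenceGraph.Connected) (hm : 0 < m) : n ≤ H.size := by
  have h : (univ : Finset (Fin n)) ⊆ univ.biUnion H.edge := fun v _ => by
    obtain ⟨i, hi⟩ := H.exists_mem_edge_of_connected hconn hm v
    exact mem_biUnion.2 ⟨i, mem_univ _, hi⟩
  simpa [HGraph.size] using (card_le_card h).trans card_biUnion_le

theorem HGraph.edges_le_size : m ≤ H.size := by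
  have : ∑ _i : Fin m, 1 ≤ H.size := sum_le_sum fun i _ => card_pos.2 (H.edge_nonempty i)
  simpa using this

theorem ListsIncidences.length_eq {L : List (Fin n × Fin m)} (hL : ListsIncidences H.edge L) :
    L.length = H.size := by
  rw [← sum_length_vertsOf, HGraph.size]
  refine sum_congr rfl fun e _ => ?_
  rw [← List.toFinset_card_of_nodup (nodup_vertsOf hL.1 e)]
  congr 1
  ext v
  rw [List.mem_toFinset, mem_vertsOf hL]

end Sizes

/-! ### Assembly of the program -/

section Main

variable {n m : ℕ} {H : HGraph n m}

theorem inputMem_facts (L : List (Fin n × Fin m)) :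
    (inputMem L).reg 0 = n ∧ (inputMem L).reg 1 = m ∧ (inputMem L).reg 2 = L.length ∧
      (∀ (i : ℕ) (q : Fin n × Fin m), L[i]? = some q →
        (inputMem L).arr 0 i = q.1 ∧ (inputMem L).arr 1 i = q.2) ∧
      (∀ a i, 2 ≤ a → (inputMem L).arr a i = 0) ∧ (inputMem L).queries = [] := by
  obtain ⟨h1, h2⟩ := putPairs_get
    { reg := fun r => if r = 0 then n else if r = 1 then m else 0, arr := fun _ _ => 0, queries := [] }
    L (l := 2) (x := 0) (y := 1) (by decide)
  refine ⟨by simp [inputMem, Mem.putPairs], by simp [inputMem, Mem.putPairs], h1, h2, fun a i ha => ?_, rfl⟩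
  have h0 : a ≠ 0 := by omega
  have h1 : a ≠ 1 := by omega
  simp [inputMem, Mem.putPairs, Function.update_of_ne h0, Function.update_of_ne h1]

theorem Same.seq {p q : Prog} {s s₁ s₂ : Mem} (h : Same p s s₁) (h' : Same q s₁ s₂) :
    Same (.seq p q) s s₂ := by
  refine (h.weaken ?_ ?_ ?_).trans (h'.weaken ?_ ?_ ?_) <;>
  simp +contextual [Prog.regs, Prog.arrs, Prog.callFree]

/-- The program for the union join graph. -/
def unionJoinProg : Prog :=
  .seq setupProg (.seq adjProg (.seq searchProg (.seq parentProg (.seq numberProg (.seq callProg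
    (.seq sidesProg (.seq pairsProg finishProg)))))))

theorem exists_run_unionJoinProg (hconn : H.incidenceGraph.Connected) (hac : H.IsAcyclic)
    {A : SubsetAlg} (hA : A.IsCorrect) {L : List (Fin n × Fin m)} (hL : ListsIncidences H.edge L) :
    ∃ (R : TreeRun H) (q : Query), Wp A unionJoinProg (fun t s => Implements R s q ∧
      t ≤ 251 * (A.time q + H.size + H.unionJoinGraph.edgeSet.ncard)) 0 (inputMem L) := by
  classical
  have hm : 0 < m := by
    obtain ⟨T, hT⟩ := hac
    obtain ⟨x⟩ := hT.1.connected.nonempty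
    exact x.pos
  have hn : 0 < n := by
    obtain ⟨v, -⟩ := H.edge_nonempty ⟨0, hm⟩
    exact v.pos
  have hlen := hL.length_eq
  have hnle := H.verts_le_size hconn hm
  have hmle := H.edges_le_size
  obtain ⟨i0, i1, i2, iL, iz, iq⟩ := inputMem_facts L
  obtain ⟨t₁, s₁, ex₁, ht₁, hb₁⟩ := wp_setupProg (A := A) (t := 0) i0 i1 i2
  have S₁ := ex₁.same
  obtain ⟨t₂, s₂, ex₂, ht₂, hadj₂⟩ := wp_adjProg (A := A) (t := t₁) (L := L) hb₁
    (by rw [S₁.reg 2 (by decide), i2]) (by omega)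
    (by rw [S₁.arr 0 (by decide), S₁.arr 1 (by decide)]; exact iL)
    (by rw [S₁.arr 6 (by decide)]; exact fun i => iz 6 i (by decide))
    (by rw [S₁.arr 8 (by decide)]; exact fun i => iz 8 i (by decide))
  have hb₂ := hb₁.of_same ex₂.same (by decide)
  have S₂ := S₁.seq ex₂.same
  obtain ⟨t₃, s₃, ex₃, ht₃, l, hnd, hmax, hll, hl⟩ := wp_searchProg (A := A) (t := t₁ + t₂) hL hb₂ hadj₂
    (by omega)
    (by rw [S₂.arr 10 (by decide)]; exact fun i => iz 10 i (by decide))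
    (by rw [S₂.arr 12 (by decide)]; exact fun i => iz 12 i (by decide))
    (by rw [S₂.arr 14 (by decide)]; exact fun i => iz 14 i (by decide))
    (by rw [S₂.arr 15 (by decide)]; exact fun i => iz 15 i (by decide))
  have hb₃ := hb₂.of_same ex₃.same (by decide)
  have hadj₃ := hadj₂.of_same ex₃.same (by decide)
  have S₃ := S₂.seq ex₃.same
  -- From here on `rk` is the search order by which the arrays are indexed. The run `R` has a
  -- pre-order of its own and shares root, parents and separators with it.
  obtain ⟨root, rk, parent, hrun, hget⟩ := hmax.exists_isRun hac hnd hll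
  obtain ⟨R, rfl, rfl, hup⟩ := hrun.exists_treeRun
  have ord₃ : ∀ x : Fin m, s₃.arr 13 (rk x) = x := fun x => hl _ _ (hget x)
  have h0 := hrun.pos_root
  have hrk := hrun.rank
  obtain ⟨t₄, s₄, ex₄, ht₄, hpar₄⟩ := wp_parentProg (A := A) (t := t₁ + t₂ + t₃) hL hb₃ hadj₃ (by omega)
    hrun ord₃ (by rw [S₃.arr 16 (by decide)]; exact fun i => iz 16 i (by decide))
  have hb₄ := hb₃.of_same ex₄.same (by decide)
  have S₄ := S₃.seq ex₄.same
  have ord₄ : ∀ x : Fin m, s₄.arr 13 (rk x) = x := by rwa [ex₄.same.arr 13 (by decide)]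
  have par₄ : ∀ x, x ≠ R.root → s₄.arr 4 x = R.parent x := fun x hx => hpar₄.parent_eq x hx (rk x).2
  obtain ⟨Q, hQnd, hQmem, hQlen, hQget⟩ := hpar₄.query
  have hQ : ListsIncidences (fun k => R.up (sepOwner rk k)) Q := by
    refine ⟨hQnd, fun v c => ?_⟩
    rw [hQmem]
    simp only [hup, ← rk_sepOwner (rk := rk)]
    constructor
    · rintro ⟨-, x, hx, hv⟩
      rw [perm_val_inj] at hx
      rwa [← hx]
    · exact fun hv => ⟨(rk _).2, _, rfl, hv⟩
  obtain ⟨D, hD, hans⟩ := hA n (m - 1) (fun k => R.up (sepOwner rk k)) (fun k => by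
    rw [hup]; exact hrun.upSep_nonempty hconn (sepOwner_ne_root R h0 k)) Q hQ
  obtain ⟨t₅, s₅, ex₅, ht₅, h19, h21⟩ := wp_numberProg (A := A) (t := t₁ + t₂ + t₃ + t₄) hb₄ h0 hrk ord₄ par₄
    (by rw [S₄.arr 19 (by decide)]; exact fun i => iz 19 i (by decide))
    (by rw [S₄.arr 20 (by decide)]; exact fun i => iz 20 i (by decide))
    (by rw [S₄.arr 21 (by decide)]; exact fun i => iz 21 i (by decide))
  have hb₅ := hb₄.of_same ex₅.same (by decide)
  have S₅ := S₄.seq ex₅.same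
  obtain ⟨t₆, s₆, ex₆, ht₆, hqs, h11, hD6⟩ := wp_callProg (A := A) (t := t₁ + t₂ + t₃ + t₄ + t₅) (Q := Q)
    (D := D) hb₅ (by rw [ex₅.same.reg 10 (by decide)]; exact hQlen)
    (by rw [ex₅.same.arr 17 (by decide), ex₅.same.arr 18 (by decide)]; exact hQget) hans
  have hb₆ := hb₅.of_same ex₆.same (by decide)
  have S₆ := S₅.seq ex₆.same
  have S₄₆ := ex₅.same.seq ex₆.same
  rw [S₅.queries (by decide), iq, List.nil_append] at hqs
  obtain ⟨t₇, s₇, ex₇, ht₇, hsd⟩ := wp_sidesProg (A := A) (R := R) (t := t₁ + t₂ + t₃ + t₄ + t₅ + t₆) hb₆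
    (by omega) h0 hrk hD (by rw [S₄₆.arr 13 (by decide)]; exact ord₄)
    (by rw [S₄₆.arr 4 (by decide)]; exact par₄)
    (by rw [ex₆.same.arr 19 (by decide)]; exact h19) (by rw [ex₆.same.arr 21 (by decide)]; exact h21)
    h11 hD6
    (by rw [S₆.arr 24 (by decide)]; exact fun i => iz 24 i (by decide))
    (by rw [S₆.arr 26 (by decide)]; exact fun i => iz 26 i (by decide))
  have hb₇ := hb₆.of_same ex₇.same (by decide)
  have S₇ := S₆.seq ex₇.same
  have S₄₇ := S₄₆.seq ex₇.same
  obtain ⟨t₈, s₈, ex₈, ht₈, E, G, hout, hE⟩ := wp_pairsProg (A := A) (R := R)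
    (t := t₁ + t₂ + t₃ + t₄ + t₅ + t₆ + t₇) hb₇ (by omega) h0
    (by rw [S₄₇.arr 13 (by decide)]; exact ord₄) hsd
    (fun c => nodup_sideLists h0 hD True c) (fun c => nodup_sideLists h0 hD False c)
    (fun c hc => toFinset_sideLists_true h0 hD hc) (fun c hc => toFinset_sideLists_false h0 hD hc)
    (by rw [S₇.arr 28 (by decide)]; exact fun i => iz 28 i (by decide))
  have hb₈ := hb₇.of_same ex₈.same (by decide)
  have S₄₈ := S₄₇.seq ex₈.same
  obtain ⟨t₉, s₉, ex₉, ht₉, hp1, hp2, hroot⟩ := wp_finishProg (A := A) (R := R)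
    (t := t₁ + t₂ + t₃ + t₄ + t₅ + t₆ + t₇ + t₈) hb₈ hout h0
    (by rw [S₄₈.arr 13 (by decide)]; exact ord₄)
  have S₄₉ := S₄₈.seq ex₉.same
  have hcard := R.card_added_le
  have hDlen := length_subsetGraph_le h0 hD
  refine ⟨R, ⟨n, m - 1, natPairs Q⟩, _, s₉, .seq ex₁ (.seq ex₂ (.seq ex₃ (.seq ex₄ (.seq ex₅ (.seq ex₆
    (.seq ex₇ (.seq ex₈ ex₉))))))), ⟨?_, ?_, hroot, ?_, ⟨E, hp1, hE⟩, ⟨G, hp2, hout.listsEdges hE⟩⟩, ?_⟩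
  · rw [((ex₇.same.seq ex₈.same).seq ex₉.same).queries (by decide), hqs]
  · let f : Fin (m - 1) → {c : Fin m // c ≠ R.root} := fun k => ⟨sepOwner rk k, sepOwner_ne_root R h0 k⟩
    have hf : Function.Bijective f :=
      ⟨fun a b h => sepOwner_injective (Subtype.ext_iff.1 h), fun c => by
        obtain ⟨k, hk⟩ := exists_sepOwner R h0 c.2
        exact ⟨k, Subtype.ext hk⟩⟩
    exact ⟨.ofBijective f hf, Q, hQ, rfl⟩
  · rw [S₄₉.arr 4 (by decide)]
    exact par₄
  -- The phases add up to coefficients 5 of `n`, 120 of `m` and 85 of the number of incidences, and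
  -- a constant 41; all four quantities are at most multiples of N, and the sum is 251. Each
  -- addition costs 26 steps and at most one arc of 22, so the additions cost at most 96 per edge of
  -- G.
  · omega

end Main

end UnionJoin

open UnionJoin in
theorem mainTheorem3 :
    ∃ (P : Prog) (C : ℕ), ∀ (n m : ℕ) (H : HGraph n m),
      H.incidenceGraph.Connected → H.IsAcyclic →
      -- the characterisation of the edges, in any join tree
      (∀ T : SimpleGraph (Fin m), H.IsJoinTree T →
        ∀ (i j : Fin m) (p : T.Walk i j), i ≠ j → p.IsPath →
          (H.unionJoinGraph.Adj i j ↔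
            ∃ d ∈ p.darts, H.sep d.fst d.snd ⊆ H.sep i p.snd ∧
              H.sep d.fst d.snd ⊆ H.sep p.penultimate j)) ∧
      -- every run of the algorithm is correct and adds each edge at most twice
      (∀ R : TreeRun H,
        H.IsJoinTree R.tree ∧
        (∀ c, c ≠ R.root → R.tree.Adj c (R.parent c) ∧ R.up c = H.sep c (R.parent c)) ∧
        R.graph = H.unionJoinGraph ∧
        ∀ e : Sym2 (Fin m), Multiset.count e R.added ≤ 2) ∧
      -- the program carries out a run of the algorithm in the claimed time
      (∀ A : SubsetAlg, A.IsCorrect →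
        ∀ L : List (Fin n × Fin m), ListsIncidences H.edge L →
          ∃ (R : TreeRun H) (s : Mem) (q : Query) (t : ℕ),
            Exec A P (inputMem L) t s ∧ Implements R s q ∧
            t ≤ C * (A.time q + H.size + H.unionJoinGraph.edgeSet.ncard)) := by
  refine ⟨unionJoinProg, 251, fun n m H hconn hac => ⟨fun T hT i j p hij hp =>
    hT.unionJoinGraph_adj_iff p hij hp, fun R => ⟨R.tree_isJoinTree, fun c hc =>
      ⟨R.tree_adj_parent hc, R.up_eq_sep hc⟩, R.graph_eq, R.count_added_le_two⟩, fun A hA L hL => ?_⟩⟩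
  obtain ⟨R, q, t, s, hex, himp, ht⟩ := exists_run_unionJoinProg hconn hac hA hL
  exact ⟨R, s, q, t, hex, himp, by simpa using ht⟩
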